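/- **Interval exchanges.** Fix $d$. A combinatorial type $\pi$ of an interval exchange with $d$ bands labelled by $S=\{1,\dots,d\}$ consists of two finite words in $S$, read along the top and the bottom side of a horizontal interval, in which every label occurs exactly twice in total. The occurrences are the ends of the bands; a band may join top to bottom, top to top, or bottom to bottom. Widths $(\lambda_\alpha)_{\alpha\in S}$ satisfy the *switch condition* if the widths of the ends on the top and of the ends on the bottom have the same sum (a band with two ends on one side counts twice there). The type is *recurrent* if some strictly positive widths satisfy the switch condition. The interval thickened together with its untwisted bands is an oriented surface with boundary; each gap between neighbouring ends on the same side is a cusp on a boundary circle. The type is *complete* if every boundary circle carries exactly $3$ cusps (so it bounds an ideal triangle) or exactly $1$ cusp (so it bounds a once-punctured monogon). It is *non-classical* if it is recurrent and complete. The *configuration space* $W_\pi\subset\mathbb R^d$ is the set of widths $\lambda\ge 0$ with $\sum_\alpha\lambda_\alpha=1$ that satisfy the switch condition; its Lebesgue measure is the $(d-2)$-dimensional Euclidean volume, normalized to total mass $1$. **Rauzy induction.** Let $\alpha_1,\alpha_0$ be the bands with the rightmost ends on the top and on the bottom. If $\lambda_{\alpha_1}>\lambda_{\alpha_0}$, the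 rightmost bottom end of $\alpha_0$ is removed and reinserted next to the other end of $\alpha_1$: immediately to its right if that end is on the bottom, immediately to its left if it is on the top. The new width of $\alpha_1$ is $\lambda_{\alpha_1}-\lambda_{\alpha_0}$, the other widths are unchanged, and the widths are then rescaled to sum $1$. If $\lambda_{\alpha_1}<\lambda_{\alpha_0}$, the same is done with top and bottom exchanged. If $\lambda_{\alpha_1}=\lambda_{\alpha_0}$, the induction is undefined. The *reduced Rauzy diagram* has as vertices the types of non-classical interval exchanges up to relabelling of the bands, with an arrow $\pi\to\pi'$ if $\pi'$ results from $\pi$ by this step for some widths in $W_\pi$. A *sink* is a non-empty set $G$ of vertices such that every vertex of $G$ can be reached from every vertex of $G$ (itself included) by a directed path of positive length, and no arrow leads from $G$ to a vertex outside $G$. The *full parameter space* over $G$ is the disjoint union $\bigsqcup_{\pi\in G}W_\pi$ (one labelling being chosen for each unlabelled type), with the sum of the Lebesgue measures on the $W_\pi$. Rauzy induction, followed by relabelling to the chosen labelling, defines the *Rauzy map* $T$ on it; where the induction is undefined, put $T(x)=x$. **Theorem.** For every sink $G$, Rauzy induction is defined at Lebesgue-almost every point of the full parameter space over $G$, and Lebesgue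 measure is ergodic for the Rauzy map $T$: the map $T$ is measurable, preimages of Lebesgue-null sets are null, and every measurable set $A$ with $T^{-1}(A)=A$ has zero or full measure. -/

import Mathlib

open MeasureTheory Measure

noncomputable section

namespace RauzyInduction

/-! ## Exchange combinatorics -/

/-- The exchange combinatorics of an interval with `d` labelled bands: the labels of the band ends on
the top and on the bottom of the interval, each list being read from RIGHT to LEFT. The heads of
the two lists are the ends in the critical (rightmost) positions. -/
@[ext] structure Rows (d : ℕ) where
  top : List (Fin d)
  bot : List (Fin d)

namespace Rows

variable {d : ℕ}

/-- Every label is carried by exactly one band, that is by exactly two band ends. -/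
def IsExchange (π : Rows d) : Prop := ∀ a, (π.top ++ π.bot).count a = 2

/-- The switch condition: total width of the ends on the top = total width of the ends on the
bottom. -/
def Switch (π : Rows d) (x : Fin d → ℝ) : Prop := (π.top.map x).sum = (π.bot.map x).sum

/-- Recurrence: some assignment of strictly positive widths satisfies the switch condition. -/
def IsRecurrent (π : Rows d) : Prop := ∃ x : Fin d → ℝ, (∀ a, 0 < x a) ∧ π.Switch x

/-! ### Completeness of the train track

The interval thickened together with its (untwisted) bands is a surface with boundary that
carries the train track. Its boundary circles are the boundaries of the complementary regions, and
a circle has a cusp for each pair of neighbouring ends (on the same side of the interval) whose gap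
it passes. A disc glued to a circle with three cusps is an ideal triangle and a punctured disc glued
to a circle with one cusp is a once punctured monogon. -/

/-- The band ends: positions on the top (`inl`) and on the bottom (`inr`), counted from the right. -/
abbrev End (π : Rows d) : Type := Fin π.top.length ⊕ Fin π.bot.length

/-- The label of the band to which an end belongs. -/
def label (π : Rows d) : π.End → Fin d := Sum.elim π.top.get π.bot.get

/-- The number of ends on the same side of the interval that lie further right. -/
def index (π : Rows d) : π.End → ℕ := Sum.elim Fin.val Fin.val

/-- The number of ends on the same side of the interval. -/
def rowLength (π : Rows d) : π.End → ℕ := Sum.elim (fun _ => π.top.length) (fun _ => π.bot.length)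

/-- The two vertical edges of each end: `(e, true)` is the right one, `(e, false)` the left one. -/
abbrev Side (π : Rows d) : Type := π.End × Bool

/-- `p` and `q` are the two extremities of an edge of a band. A band from top to bottom joins right
to right and left to left; a band with both ends on the same side of the interval (orientation
reversing) joins right to left. -/
def BandLink (π : Rows d) (p q : π.Side) : Prop :=
  p.1 ≠ q.1 ∧ π.label p.1 = π.label q.1 ∧
    q.2 = if p.1.isLeft = q.1.isLeft then !p.2 else p.2

/-- `p` is the right edge of an end and `q` the left edge of its right neighbour: the boundary makes a
cusp between them. -/
def CuspLink (π : Rows d) (p q : π.Side) : Prop :=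
  p.1.isLeft = q.1.isLeft ∧ p.2 = true ∧ q.2 = false ∧ π.index p.1 = π.index q.1 + 1

/-- At the right and left extremities of the interval the boundary passes smoothly from the top to
the bottom. -/
def CornerLink (π : Rows d) (p q : π.Side) : Prop :=
  p.1.isLeft ≠ q.1.isLeft ∧
    ((p.2 = true ∧ q.2 = true ∧ π.index p.1 = 0 ∧ π.index q.1 = 0) ∨
     (p.2 = false ∧ q.2 = false ∧ π.index p.1 + 1 = π.rowLength p.1 ∧
        π.index q.1 + 1 = π.rowLength q.1))

def Link (π : Rows d) (p q : π.Side) : Prop :=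
  π.BandLink p q ∨ π.CuspLink p q ∨ π.CornerLink p q

/-- Two edges lie on the same boundary circle. -/
def SameBoundary (π : Rows d) : π.Side → π.Side → Prop := Relation.EqvGen π.Link

/-- The number of cusps on the boundary circle through `p`. The cusps are enumerated by the right edges
of the ends that are not rightmost. -/
def cuspCount (π : Rows d) (p : π.Side) : ℕ :=
  {q : π.Side | q.2 = true ∧ π.index q.1 ≠ 0 ∧ π.SameBoundary p q}.ncard

/-- All complementary regions are ideal triangles or once punctured monogons. -/
def IsComplete (π : Rows d) : Prop := ∀ p : π.Side, π.cuspCount p = 1 ∨ π.cuspCount p = 3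

/-- Combinatorial types of labelled non-classical interval exchanges. -/
def IsNonclassical (π : Rows d) : Prop := π.IsExchange ∧ π.IsRecurrent ∧ π.IsComplete

/-! ## Configuration spaces -/

/-- The configuration space `W`: non-negative widths of total sum one that satisfy the switch
condition. -/
def configSpace (π : Rows d) : Set (EuclideanSpace ℝ (Fin d)) :=
  {x | (∀ a, 0 ≤ x a) ∧ ∑ a, x a = 1 ∧ π.Switch x}

/-- Lebesgue measure on the configuration space: the `(d-2)`-dimensional volume, normalized to total
mass one. -/
def lebesgue (π : Rows d) : Measure π.configSpace :=
  (μH[(d : ℝ) - 2] (Set.univ : Set π.configSpace))⁻¹ • μH[(d : ℝ) - 2]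

/-- Rescale a vector of widths to total width one. -/
def normalize (π : Rows d) (x : Fin d → ℝ) (h0 : ∀ a, 0 ≤ x a) (h1 : 0 < ∑ a, x a)
    (h2 : π.Switch x) : π.configSpace :=
  ⟨WithLp.toLp 2 fun a => x a / ∑ b, x b, fun a => div_nonneg (h0 a) h1.le, by
    simp only [← Finset.sum_div]; exact div_self h1.ne', by
    have := congrArg (· / ∑ b, x b) h2
    simpa [Switch, div_eq_mul_inv, List.sum_map_mul_right] using this⟩

/-! ## Rauzy induction -/

/-- Exchange the roles of top and bottom. -/
def swap (π : Rows d) : Rows d := ⟨π.bot, π.top⟩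

/-- The combinatorics after the band `a`, critical on the top, has split the band `c`, critical on the
bottom. The rest of the top is `t` and the rest of the bottom is `b`. The critical end of `c` is
carried along `a` to the other end of `a`: it becomes the right neighbour of that end if that end is
on the bottom, and the left neighbour if it is on the top. (Rows are read from right to left.) -/
def topSplit (a : Fin d) (t : List (Fin d)) (c : Fin d) (b : List (Fin d)) : Rows d :=
  ⟨a :: t.flatMap (fun z => if z = a then [z, c] else [z]),
   b.flatMap (fun z => if z = a then [c, z] else [z])⟩

/-- The combinatorics after the band `c`, critical on the bottom, has split the band `a`, critical on
the top. -/
def botSplit (a : Fin d) (t : List (Fin d)) (c : Fin d) (b : List (Fin d)) : Rows d :=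
  (topSplit c b a t).swap

/-- The widths after the band `a` has split the band `c`. -/
def splitWidths (x : Fin d → ℝ) (a c : Fin d) : Fin d → ℝ := Function.update x a (x a - x c)

theorem splitWidths_nonneg {x : Fin d → ℝ} (h0 : ∀ a, 0 ≤ x a) {a c : Fin d} (h : x c < x a) (z) :
    0 ≤ splitWidths x a c z := by
  by_cases hz : z = a
  · subst hz; simp [splitWidths, h.le]
  · simp [splitWidths, hz, h0 z]

theorem splitWidths_sum_pos {x : Fin d → ℝ} (h0 : ∀ a, 0 ≤ x a) {a c : Fin d} (h : x c < x a) :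
    0 < ∑ z, splitWidths x a c z :=
  Finset.sum_pos' (fun z _ => splitWidths_nonneg h0 h z)
    ⟨a, Finset.mem_univ a, by simpa [splitWidths] using h⟩

theorem switch_topSplit {x : Fin d → ℝ} {a c : Fin d} {t b : List (Fin d)} (h : x c < x a)
    (hs : Switch ⟨a :: t, c :: b⟩ x) : (topSplit a t c b).Switch (splitWidths x a c) := by
  have hca : c ≠ a := by rintro rfl; exact lt_irrefl _ h
  have h1 : ∀ l : List (Fin d), ((l.flatMap (fun z => if z = a then [z, c] else [z])).map
      (splitWidths x a c)).sum = (l.map x).sum := by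
    intro l
    induction l with
    | nil => simp
    | cons z l ih =>
      rw [List.flatMap_cons, List.map_append, List.sum_append, ih]
      by_cases hz : z = a
      · subst hz; simp [splitWidths, hca]
      · simp [splitWidths, hz]
  have h2 : ∀ l : List (Fin d), ((l.flatMap (fun z => if z = a then [c, z] else [z])).map
      (splitWidths x a c)).sum = (l.map x).sum := by
    intro l
    induction l with
    | nil => simp
    | cons z l ih =>
      rw [List.flatMap_cons, List.map_append, List.sum_append, ih]
      by_cases hz : z = a
      · subst hz; simp [splitWidths, hca]
      · simp [splitWidths, hz]
  simp only [Switch, topSplit, List.map_cons, List.sum_cons, h1, h2] at hs ⊢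
  simp only [splitWidths, Function.update_self]
  linarith

open Classical in
/-- One step of Rauzy induction on labelled interval exchanges of total width one: the wider one of
the two critical bands splits the other one, and the widths are renormalized. There is no value if
the two critical bands have equal widths. -/
def rauzyStep : (π : Rows d) → π.configSpace → Option (Σ π' : Rows d, π'.configSpace)
  | ⟨a :: t, c :: b⟩, x =>
    if h : x.1 c < x.1 a then
      some ⟨topSplit a t c b, normalize _ (splitWidths x.1 a c) (splitWidths_nonneg x.2.1 h)
        (splitWidths_sum_pos x.2.1 h) (switch_topSplit h x.2.2.2)⟩
    else if h : x.1 a < x.1 c then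
      some ⟨botSplit a t c b, normalize _ (splitWidths x.1 c a) (splitWidths_nonneg x.2.1 h)
        (splitWidths_sum_pos x.2.1 h)
        (switch_topSplit (t := b) (b := t) h x.2.2.2.symm).symm⟩
    else none
  | _, _ => none

/-- An arrow of the labelled diagram: `π'` is obtained from `π` by a split that some widths realize. -/
def Arrow (π π' : Rows d) : Prop := ∃ x y, rauzyStep π x = some ⟨π', y⟩

/-! ## The reduced Rauzy diagram -/

/-- Change the labels of the bands. -/
def relabel (σ : Equiv.Perm (Fin d)) (π : Rows d) : Rows d := ⟨π.top.map σ, π.bot.map σ⟩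

instance relabelSetoid (d : ℕ) : Setoid (Rows d) where
  r π π' := ∃ σ : Equiv.Perm (Fin d), relabel σ π = π'
  iseqv :=
    { refl := fun π => ⟨1, by simp [relabel]⟩
      symm := by
        rintro π _ ⟨σ, rfl⟩
        exact ⟨σ⁻¹, by simp [relabel]⟩
      trans := by
        rintro π _ _ ⟨σ, rfl⟩ ⟨τ, rfl⟩
        exact ⟨τ * σ, by simp [relabel]⟩ }

/-- The same interval exchange with other labels. -/
def relabelPoint (σ : Equiv.Perm (Fin d)) {π π' : Rows d} (h : relabel σ π = π')
    (x : π.configSpace) : π'.configSpace :=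
  ⟨WithLp.toLp 2 fun a => x.1 (σ.symm a), fun a => x.2.1 _, by
    simpa using (Equiv.sum_comp σ.symm fun a => x.1 a).trans x.2.2.1, by
    subst h
    have := x.2.2.2
    simpa [Switch, relabel, Function.comp_def] using this⟩

end Rows

open Rows

variable {d : ℕ}

/-- Combinatorial types of interval exchanges with `d` bands, without labelling. -/
abbrev UType (d : ℕ) : Type := Quotient (relabelSetoid d)

/-- A fixed choice of labelling for each unlabelled type. It identifies the set of normalized interval
exchanges of this type with a configuration space. -/
def UType.rep (r : UType d) : Rows d := Quotient.out r

/-- The arrows of the reduced Rauzy diagram. -/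
def UType.Arrow (r r' : UType d) : Prop :=
  ∃ π π' : Rows d, ⟦π⟧ = r ∧ ⟦π'⟧ = r' ∧ Rows.Arrow π π'

/-- A sink of the reduced Rauzy diagram: a non-empty set of types of non-classical interval exchanges
such that each member can be reached from each member (itself included) by a splitting sequence of
positive length, and no member splits to a type outside the set. -/
structure IsSink (G : Set (UType d)) : Prop where
  nonempty : G.Nonempty
  nonclassical : ∀ r ∈ G, r.rep.IsNonclassical
  connected : ∀ r ∈ G, ∀ r' ∈ G, Relation.TransGen UType.Arrow r r'
  closed : ∀ r ∈ G, ∀ r', UType.Arrow r r' → r' ∈ G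

/-- The full parameter space over a set of types: the disjoint union of their configuration spaces. -/
abbrev ParamSpace (G : Set (UType d)) : Type := Σ r : G, (r : UType d).rep.configSpace

/-- Lebesgue measure on the full parameter space. -/
def paramLebesgue (G : Set (UType d)) : Measure (ParamSpace G) :=
  Measure.sum fun r : G => (r : UType d).rep.lebesgue.map (Sigma.mk r)

/-- The points at which Rauzy induction is defined (the critical bands have different widths). -/
def rauzyDomain (G : Set (UType d)) : Set (ParamSpace G) :=
  {p | (rauzyStep _ p.2).isSome}

theorem exists_relabel (π : Rows d) : ∃ σ : Equiv.Perm (Fin d), relabel σ π = UType.rep ⟦π⟧ :=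
  Setoid.symm (Quotient.mk_out π)

/-- A labelled interval exchange as a point of the parameter space. The relabelling is unique if each
label occurs. -/
def toParam {G : Set (UType d)} (q : Σ π : Rows d, π.configSpace)
    (hq : (⟦q.1⟧ : UType d) ∈ G) : ParamSpace G :=
  ⟨⟨⟦q.1⟧, hq⟩, relabelPoint _ (exists_relabel q.1).choose_spec q.2⟩

theorem IsSink.step_mem {G : Set (UType d)} (hG : IsSink G) (p : ParamSpace G)
    (h : p ∈ rauzyDomain G) : (⟦((rauzyStep _ p.2).get h).1⟧ : UType d) ∈ G :=
  hG.closed p.1 p.1.2 _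
    ⟨_, _, Quotient.out_eq _, rfl, p.2, ((rauzyStep _ p.2).get h).2, (Option.some_get h).symm⟩

open Classical in
/-- The Rauzy map on the full parameter space over a sink. Outside its natural domain it is given the
value of the identity. -/
def rauzyMap {G : Set (UType d)} (hG : IsSink G) (p : ParamSpace G) : ParamSpace G :=
  if h : p ∈ rauzyDomain G then toParam ((rauzyStep _ p.2).get h) (hG.step_mem p h) else p

end RauzyInduction

end

/-! Without rescaling, a split is a linear map `unsplit` between the positive cones of two switch
hyperplanes. A finite path then gives a linear isomorphism `Q` from final to initial widths, and the
widths following the path form a cone `cyl`. Null sets of the configuration spaces correspond to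
null cones for Haar measure on the hyperplanes (`lebesgue_eq_zero_iff`), so quasi-invariance is a
property of linear maps and only ergodicity is hard.

An invariant set gives cones compatible with splits. Nullity is inherited along arrows, so in a sink
these cones are null at every type or at none. In the second case a density argument applies
(`measure_diff_eq_zero`). Call a path balanced if the column sums of `Q` (the weights) are
comparable. Then `Q` has bounded distortion, and the invariant cone fills a definite fraction of the
cylinder. If most directions lie in arbitrarily small balanced cylinders, disjoint ones inside a
tight open neighbourhood cover most of the complement, which is therefore null.

Such cylinders come from a probabilistic and a deterministic estimate. Stop each path when some
weight first reaches `R`; all weights are then below `2R`. A linear form on the current widths that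
is not identically zero is smaller than `ε/R` only on a proportion `O(ε)` of the cylinder, uniformly
in `R` (`flatMeasure_small_form_le`, `dirMeasure_badCyl_le`). Applied to the widths and to the
partial sums of the switch relation, this shows that the directions for which one of the scales `R,
CR, ..., C^J R` is bad for every large `R` have measure `O(ε)`. Here `J` depends only on `d`, and
`C` is of order `1/ε`.

Along good scales, a band whose weight becomes large has become thin and so must have won. If a
proper set of bands monopolized the growth, it would play alone. Its ends would gather at the right
of both rows, and its partial switch sum would be conserved but become too small, hence vanish
identically (`false_of_isolated`). Completeness forbids this through a parity count of cusps: no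
block at either end of the rows can be classical. So all weights grow, nonnegative functionals
become positive (`exists_positive_window`), and repeated windows contract the cylinders projectively
(`exists_contraction`). -/

noncomputable section

namespace RauzyInduction

/-! ### Completeness excludes classical blocks. -/

namespace Rows

/-! ### Boundary circles of a train track with a classical block -/

section Boundary

variable {d : ℕ} {π : Rows d}

/-- A set of band edges that is a union of boundary circles. -/
def IsLinkClosed (π : Rows d) (O : Set π.Side) : Prop := ∀ p q, π.Link p q → (p ∈ O ↔ q ∈ O)

theorem IsLinkClosed.mem_of_sameBoundary {O : Set π.Side} (hO : π.IsLinkClosed O) {p q : π.Side}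
    (h : π.SameBoundary p q) : p ∈ O ↔ q ∈ O := by
  induction h with
  | rel x y h => exact hO x y h
  | refl x => exact Iff.rfl
  | symm x y _ ih => exact ih.symm
  | trans x y z _ _ ih₁ ih₂ => exact ih₁.trans ih₂

/-- The boundary circle through an edge. -/
def circle (π : Rows d) (p : π.Side) : Set π.Side := {q | π.SameBoundary p q}

theorem isLinkClosed_circle (p : π.Side) : π.IsLinkClosed (π.circle p) := fun _ _ h =>
  ⟨fun hx => Relation.EqvGen.trans _ _ _ hx (Relation.EqvGen.rel _ _ h),
    fun hy => Relation.EqvGen.trans _ _ _ hy (Relation.EqvGen.symm _ _ (Relation.EqvGen.rel _ _ h))⟩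

theorem mem_circle_self (p : π.Side) : p ∈ π.circle p := Relation.EqvGen.refl p

open Classical in
/-- Indicator of a set of edges along the top. -/
def topInd (O : Set π.Side) (b : Bool) (i : ℕ) : ℕ :=
  if h : i < π.top.length then if (Sum.inl ⟨i, h⟩, b) ∈ O then 1 else 0 else 0

open Classical in
/-- Indicator of a set of edges along the bottom. -/
def botInd (O : Set π.Side) (b : Bool) (i : ℕ) : ℕ :=
  if h : i < π.bot.length then if (Sum.inr ⟨i, h⟩, b) ∈ O then 1 else 0 else 0

/-- Written as indicator sums along the two rows, cusp counts can be compared by additive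
identities, and parity arguments reduce to arithmetic. -/
theorem cuspCount_eq (p : π.Side) : π.cuspCount p =
    ∑ i ∈ Finset.range π.top.length, (if i = 0 then 0 else topInd (π.circle p) true i) +
    ∑ i ∈ Finset.range π.bot.length, (if i = 0 then 0 else botInd (π.circle p) true i) := by
  classical
  rw [cuspCount, Set.ncard_eq_toFinset_card', Set.toFinset_ofPred, Finset.card_filter,
    Fintype.sum_prod_type, Fintype.sum_sum_type, Finset.sum_range, Finset.sum_range]
  congr 1
  · refine Finset.sum_congr rfl fun i _ => ?_
    by_cases hi : (i : ℕ) = 0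
    · simp [hi, index]
    · by_cases h : π.SameBoundary p (Sum.inl i, true) <;>
        simp [hi, h, index, topInd, circle, Finset.filter_insert, Finset.filter_singleton]
  · refine Finset.sum_congr rfl fun i _ => ?_
    by_cases hi : (i : ℕ) = 0
    · simp [hi, index]
    · by_cases h : π.SameBoundary p (Sum.inr i, true) <;>
        simp [hi, h, index, botInd, circle, Finset.filter_insert, Finset.filter_singleton]

theorem topInd_left {O : Set π.Side} (hO : π.IsLinkClosed O) {i : ℕ} (h : i + 1 < π.top.length) :
    topInd O false i = topInd O true (i + 1) := by
  have := hO (Sum.inl ⟨i + 1, h⟩, true) (Sum.inl ⟨i, by omega⟩, false)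
    (Or.inr (Or.inl ⟨rfl, rfl, rfl, rfl⟩))
  simp only [topInd, h, (by omega : i < π.top.length), dif_pos]
  classical exact if_congr this.symm rfl rfl

theorem botInd_left {O : Set π.Side} (hO : π.IsLinkClosed O) {i : ℕ} (h : i + 1 < π.bot.length) :
    botInd O false i = botInd O true (i + 1) := by
  have := hO (Sum.inr ⟨i + 1, h⟩, true) (Sum.inr ⟨i, by omega⟩, false)
    (Or.inr (Or.inl ⟨rfl, rfl, rfl, rfl⟩))
  simp only [botInd, h, (by omega : i < π.bot.length), dif_pos]
  classical exact if_congr this.symm rfl rfl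

theorem topInd_zero {O : Set π.Side} (hO : π.IsLinkClosed O) (ht : 0 < π.top.length)
    (hb : 0 < π.bot.length) : topInd O true 0 = botInd O true 0 := by
  have := hO (Sum.inl ⟨0, ht⟩, true) (Sum.inr ⟨0, hb⟩, true)
    (Or.inr (Or.inr ⟨by simp, Or.inl ⟨rfl, rfl, rfl, rfl⟩⟩))
  simp only [topInd, botInd, ht, hb, dif_pos]
  classical exact if_congr this rfl rfl

theorem topInd_last {O : Set π.Side} (hO : π.IsLinkClosed O) {m n : ℕ} (ht : m + 1 = π.top.length)
    (hb : n + 1 = π.bot.length) : topInd O false m = botInd O false n := by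
  have := hO (Sum.inl ⟨m, by omega⟩, false) (Sum.inr ⟨n, by omega⟩, false)
    (Or.inr (Or.inr ⟨by simp, Or.inr ⟨rfl, rfl, ht, hb⟩⟩))
  simp only [topInd, botInd, (by omega : m < π.top.length), (by omega : n < π.bot.length), dif_pos]
  classical exact if_congr this rfl rfl

theorem topInd_eq_botInd {O : Set π.Side} (hO : π.IsLinkClosed O) {i j : ℕ}
    (hi : i < π.top.length) (hj : j < π.bot.length) (h : π.top[i] = π.bot[j]) (b : Bool) :
    topInd O b i = botInd O b j := by
  have := hO (Sum.inl ⟨i, hi⟩, b) (Sum.inr ⟨j, hj⟩, b)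
    (Or.inl ⟨by simp, by simpa [label] using h, by simp⟩)
  simp only [topInd, botInd, hi, hj, dif_pos]
  classical exact if_congr this rfl rfl

theorem sum_range_eq_sum_map {α : Type*} (l : List α) (f : ℕ → ℕ) (g : α → ℕ)
    (h : ∀ i (hi : i < l.length), f i = g l[i]) :
    ∑ i ∈ Finset.range l.length, f i = (l.map g).sum := by
  induction l generalizing f with
  | nil => simp
  | cons a l ih =>
    rw [List.length_cons, Finset.sum_range_succ', ih (fun i => f (i + 1))
      (fun i hi => (h (i + 1) (by simpa using hi)).trans rfl), List.map_cons, List.sum_cons,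
      add_comm, h 0 (by simp)]
    rfl

/-- Two permuted words without repetitions, along which two functions agree on equal letters. -/
theorem sum_range_eq_of_perm {α : Type*} {l l' : List α} (hp : l.Perm l') (hl : l.Nodup)
    (f f' : ℕ → ℕ)
    (h : ∀ i j (hi : i < l.length) (hj : j < l'.length), l[i] = l'[j] → f i = f' j) :
    ∑ i ∈ Finset.range l.length, f i = ∑ i ∈ Finset.range l'.length, f' i := by
  classical
  have key : ∀ i (hi : i < l.length), f i = f (l.idxOf l[i]) := by
    intro i hi; rw [hl.idxOf_getElem]
  rw [sum_range_eq_sum_map l f (fun a => f (l.idxOf a)) key,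
    sum_range_eq_sum_map l' f' (fun a => f (l.idxOf a)), (hp.map _).sum_eq]
  intro j hj
  have hmem : l'[j] ∈ l := hp.mem_iff.2 (List.getElem_mem hj)
  have hlt := List.idxOf_lt_length_of_mem hmem
  exact (h _ j hlt hj (by simp)).symm

theorem nodup_of_count_le {α : Type*} [DecidableEq α] {l : List α} (h : ∀ a ∈ l, l.count a = 1) :
    l.Nodup := List.nodup_iff_count_le_one.2 fun a => by
  by_cases ha : a ∈ l
  · exact (h a ha).le
  · simp [List.count_eq_zero_of_not_mem ha]

variable {T₁ T₂ B₁ B₂ : List (Fin d)}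

theorem label_mem_iff_index_lt (hp : T₁.Perm B₁) (hT : ∀ a ∈ T₁, a ∉ T₂) (hB : ∀ a ∈ T₁, a ∉ B₂)
    (e : End (⟨T₁ ++ T₂, B₁ ++ B₂⟩ : Rows d)) :
    label _ e ∈ T₁ ↔ index _ e < T₁.length := by
  rcases e with i | i
  · by_cases h : (i : ℕ) < T₁.length
    · simp [label, index, List.getElem_append_left, h]
    · have h2 : label (⟨T₁ ++ T₂, B₁ ++ B₂⟩ : Rows d) (Sum.inl i) ∈ T₂ := by
        simp [label, List.getElem_append_right (not_lt.1 h)]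
      exact iff_of_false (fun h3 => hT _ h3 h2) h
  · rw [hp.length_eq]
    by_cases h : (i : ℕ) < B₁.length
    · simp [label, index, List.getElem_append_left, h, hp.mem_iff]
    · have h2 : label (⟨T₁ ++ T₂, B₁ ++ B₂⟩ : Rows d) (Sum.inr i) ∈ B₂ := by
        simp [label, List.getElem_append_right (not_lt.1 h)]
      exact iff_of_false (fun h3 => hB _ h3 h2) h

theorem topInd_eq_zero {O : Set π.Side} {b : Bool} {i : ℕ}
    (h : ∀ hi : i < π.top.length, (Sum.inl ⟨i, hi⟩, b) ∉ O) : topInd O b i = 0 := by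
  unfold topInd; split_ifs with h1 h2
  · exact absurd h2 (h h1)
  all_goals rfl

theorem botInd_eq_zero {O : Set π.Side} {b : Bool} {i : ℕ}
    (h : ∀ hi : i < π.bot.length, (Sum.inr ⟨i, hi⟩, b) ∉ O) : botInd O b i = 0 := by
  unfold botInd; split_ifs with h1 h2
  · exact absurd h2 (h h1)
  all_goals rfl

theorem topInd_eq_one {O : Set π.Side} {b : Bool} {i : ℕ} (hi : i < π.top.length)
    (h : (Sum.inl ⟨i, hi⟩, b) ∈ O) : topInd O b i = 1 := by
  simp [topInd, hi, h]

theorem botInd_eq_one {O : Set π.Side} {b : Bool} {i : ℕ} (hi : i < π.bot.length)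
    (h : (Sum.inr ⟨i, hi⟩, b) ∈ O) : botInd O b i = 1 := by
  simp [botInd, hi, h]

theorem not_mem_of_botInd_eq_zero {O : Set π.Side} {b : Bool} {i : ℕ} (hi : i < π.bot.length)
    (h : botInd O b i = 0) : (Sum.inr ⟨i, hi⟩, b) ∉ O := fun h' => by
  simp [botInd_eq_one hi h'] at h

/-- The sums of an indicator over the two rows of a classical block agree. -/
theorem sum_topInd_eq_sum_botInd {O : Set π.Side} (hO : π.IsLinkClosed O) {l l' : List (Fin d)}
    (hp : l.Perm l') (hl : l.Nodup) {m n : ℕ} (hm : m + l.length ≤ π.top.length)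
    (hn : n + l'.length ≤ π.bot.length)
    (h₁ : ∀ i (hi : i < l.length), π.top[m + i] = l[i])
    (h₂ : ∀ i (hi : i < l'.length), π.bot[n + i] = l'[i]) (b : Bool) :
    ∑ i ∈ Finset.range l.length, topInd O b (m + i) =
      ∑ i ∈ Finset.range l'.length, botInd O b (n + i) := by
  refine sum_range_eq_of_perm hp hl _ _ fun i j hi hj hij => ?_
  exact topInd_eq_botInd hO (by omega) (by omega) (by rw [h₁ i hi, h₂ j hj, hij]) b

theorem sum_range_ite_zero (f : ℕ → ℕ) {n N : ℕ} (hn : n < N) (hf : ∀ i, n < i → f i = 0) :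
    ∑ i ∈ Finset.range N, (if i = 0 then 0 else f i) = ∑ i ∈ Finset.range n, f (i + 1) := by
  obtain ⟨k, rfl⟩ : ∃ k, N = n + 1 + k := ⟨N - (n + 1), by omega⟩
  rw [Finset.sum_range_add, Finset.sum_range_succ']
  rw [Finset.sum_eq_zero (s := Finset.range k)]
  · simp
  · intro x _
    rw [if_neg (by omega), hf _ (by omega)]

/-- The rightmost parts of the rows cannot form a classical exchange on their own. -/
theorem not_isComplete_of_right_block (hT₁ : T₁ ≠ []) (hT₂ : T₂ ≠ []) (hB₂ : B₂ ≠ [])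
    (hp : T₁.Perm B₁) (hnd : T₁.Nodup) (hT : ∀ a ∈ T₁, a ∉ T₂) (hB : ∀ a ∈ T₁, a ∉ B₂) :
    ¬ IsComplete (⟨T₁ ++ T₂, B₁ ++ B₂⟩ : Rows d) := by
  intro hc
  have hlen := hp.length_eq
  have hn : 0 < T₁.length := List.length_pos_iff.2 hT₁
  have hn₂ : 0 < T₂.length := List.length_pos_iff.2 hT₂
  have hm₂ : 0 < B₂.length := List.length_pos_iff.2 hB₂
  have hmem := label_mem_iff_index_lt (B₂ := B₂) hp hT hB
  set π : Rows d := ⟨T₁ ++ T₂, B₁ ++ B₂⟩ with hπ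
  have htl : π.top.length = T₁.length + T₂.length := by simp [hπ]
  have hbl : π.bot.length = T₁.length + B₂.length := by simp [hπ, hlen]
  have hsum : ∀ {O : Set π.Side}, π.IsLinkClosed O → ∀ b,
      ∑ i ∈ Finset.range T₁.length, topInd O b i = ∑ i ∈ Finset.range T₁.length, botInd O b i := by
    intro O hO b
    have := sum_topInd_eq_sum_botInd hO hp hnd (m := 0) (n := 0) (by omega) (by omega)
      (fun i hi => by simp [hπ, List.getElem_append_left, hi])
      (fun i hi => by simp [hπ, List.getElem_append_left, hi]) b
    simpa [← hlen] using this
  have hshift : ∀ {O : Set π.Side}, π.IsLinkClosed O →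
      ∑ i ∈ Finset.range T₁.length, topInd O true (i + 1) =
        ∑ i ∈ Finset.range T₁.length, botInd O true (i + 1) := by
    intro O hO
    have := hsum hO false
    rw [Finset.sum_congr rfl fun i hi => topInd_left hO (i := i)
      (by have := Finset.mem_range.1 hi; omega)] at this
    rwa [Finset.sum_congr rfl fun i hi => botInd_left hO (i := i)
      (by have := Finset.mem_range.1 hi; omega)] at this
  -- The sum over right edges and its shift by one (the left edges) both agree on top and bottom,
  -- and so do the first terms, at the right corner. Only the terms at the border of the block
  -- remain.
  have hspec : ∀ {O : Set π.Side}, π.IsLinkClosed O →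
      topInd O true T₁.length = botInd O true T₁.length := by
    intro O hO
    have h1 := hsum hO true
    have h2 := hshift hO
    have h3 := topInd_zero hO (by omega) (by omega)
    have h4 := Finset.sum_range_succ (fun i => topInd O true i) T₁.length
    have h5 := Finset.sum_range_succ' (fun i => topInd O true i) T₁.length
    have h6 := Finset.sum_range_succ (fun i => botInd O true i) T₁.length
    have h7 := Finset.sum_range_succ' (fun i => botInd O true i) T₁.length
    omega
  -- A circle that meets the block but misses its border cusps cannot leave the block. It then has
  -- equally many cusps on top and bottom, an even number, which completeness forbids.
  have hall : ∀ p : π.Side, π.index p.1 < T₁.length →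
      (Sum.inl ⟨T₁.length, by omega⟩, true) ∈ π.circle p := by
    intro p hpi
    by_contra hnot
    have hO := π.isLinkClosed_circle p
    have hz : topInd (π.circle p) true T₁.length = 0 := by
      simp [topInd, hnot]
    have hz' := (hspec hO).symm.trans hz
    have hnot' := not_mem_of_botInd_eq_zero (i := T₁.length) (by omega) hz'
    have hcl : π.IsLinkClosed {q | π.index q.1 < T₁.length ∧ q ∈ π.circle p} := by
      intro x y hxy
      have hOxy := hO x y hxy
      have key : x ∈ π.circle p → (π.index x.1 < T₁.length ↔ π.index y.1 < T₁.length) := by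
        intro hx
        rcases hxy with h | h | h
        · rw [← hmem, ← hmem, h.2.1]
        · obtain ⟨h1, h2, h3, h4⟩ := h
          by_cases hxe : π.index x.1 = T₁.length
          · exfalso
            obtain ⟨x1, x2⟩ := x
            subst h2
            rcases x1 with x1 | x1
            · have : x1 = ⟨T₁.length, by omega⟩ := Fin.ext hxe
              exact hnot (this ▸ hx)
            · have : x1 = ⟨T₁.length, by omega⟩ := Fin.ext hxe
              exact hnot' (this ▸ hx)
          · omega
        · obtain ⟨h1, h2 | h2⟩ := h
          · omega
          · have e1 : π.rowLength x.1 > T₁.length := by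
              rcases x.1 with _ | _ <;> simp [rowLength, htl, hbl, hn₂, hm₂]
            have e2 : π.rowLength y.1 > T₁.length := by
              rcases y.1 with _ | _ <;> simp [rowLength, htl, hbl, hn₂, hm₂]
            omega
      constructor
      · rintro ⟨h1, h2⟩; exact ⟨(key h2).1 h1, hOxy.1 h2⟩
      · rintro ⟨h1, h2⟩; exact ⟨(key (hOxy.2 h2)).2 h1, hOxy.2 h2⟩
    have hin : ∀ q ∈ π.circle p, π.index q.1 < T₁.length := fun q hq =>
      ((hcl.mem_of_sameBoundary hq).1 ⟨hpi, mem_circle_self p⟩).1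
    have hcc := cuspCount_eq p
    rw [sum_range_ite_zero _ (n := T₁.length) (by omega) (fun i hi => topInd_eq_zero fun hi' h => by
        have := hin _ h; simp [index] at this; omega),
      sum_range_ite_zero _ (n := T₁.length) (by omega) (fun i hi => botInd_eq_zero fun hi' h => by
        have := hin _ h; simp [index] at this; omega), hshift hO] at hcc
    rcases hc p with h | h <;> omega
  set s : π.Side := (Sum.inl ⟨T₁.length, by omega⟩, true) with hs
  have hmemS : ∀ p : π.Side, π.index p.1 < T₁.length → p ∈ π.circle s := fun p h =>
    Relation.EqvGen.symm _ _ (hall p h)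
  have hO := π.isLinkClosed_circle s
  have ht : topInd (π.circle s) true T₁.length = 1 := topInd_eq_one (by omega) (mem_circle_self s)
  have ht' : ∀ i < T₁.length, topInd (π.circle s) true (i + 1) = 1 := by
    intro i hi
    rcases (Nat.succ_le_of_lt hi).lt_or_eq with h | h
    · exact topInd_eq_one (by omega) (hmemS _ h)
    · rw [Nat.succ_eq_add_one] at h; rw [h, ht]
  -- One circle carries the cusps of indices `1, ..., n` on both sides, where `n` is the length of
  -- the block; hence `2n ≤ 3`.
  have hn1 : T₁.length = 1 := by
    have hcc := cuspCount_eq s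
    have h1 : T₁.length ≤ ∑ i ∈ Finset.range π.top.length,
        (if i = 0 then 0 else topInd (π.circle s) true i) := by
      obtain ⟨k, hk⟩ : ∃ k, π.top.length = T₁.length + 1 + k := ⟨T₂.length - 1, by omega⟩
      rw [hk, Finset.sum_range_add, Finset.sum_range_succ']
      simp only [Nat.add_eq_zero_iff, one_ne_zero, and_false, if_false]
      rw [Finset.sum_congr rfl fun i hi => ht' i (Finset.mem_range.1 hi)]
      simp
    have h2 : T₁.length ≤ ∑ i ∈ Finset.range π.bot.length,
        (if i = 0 then 0 else botInd (π.circle s) true i) := by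
      obtain ⟨k, hk⟩ : ∃ k, π.bot.length = T₁.length + 1 + k := ⟨B₂.length - 1, by omega⟩
      rw [hk, Finset.sum_range_add, Finset.sum_range_succ']
      simp only [Nat.add_eq_zero_iff, one_ne_zero, and_false, if_false]
      rw [← hshift hO, Finset.sum_congr rfl fun i hi => ht' i (Finset.mem_range.1 hi)]
      simp
    rcases hc s with h | h <;> omega
  -- For a single band, the two right edges close up through the right corner. They cannot share a
  -- circle with the border cusp.
  have hcl : π.IsLinkClosed {q | π.index q.1 < T₁.length ∧ q.2 = true} := by
    intro x y hxy
    simp only [Set.mem_ofPred_eq, hn1]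
    rcases hxy with h | h | h
    · obtain ⟨h1, h2, h3⟩ := h
      have hi : π.index x.1 < 1 ↔ π.index y.1 < 1 := by rw [← hn1, ← hmem, ← hmem, h2]
      rw [← hi]
      refine and_congr_right fun h0 => ?_
      have hne : x.1.isLeft ≠ y.1.isLeft := by
        intro he
        apply h1
        have h0' := hi.1 h0
        rcases hx : x.1 with x1 | x1 <;> rcases hy : y.1 with y1 | y1 <;>
          simp only [hx, hy, index, Sum.elim_inl, Sum.elim_inr, Sum.isLeft_inl, Sum.isLeft_inr,
            reduceCtorEq] at h0 h0' he ⊢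
        · congr 1; ext; omega
        · congr 1; ext; omega
      rw [if_neg hne] at h3; rw [h3]
    · obtain ⟨h1, h2, h3, h4⟩ := h
      simp [h3]; omega
    · obtain ⟨h1, h2 | h2⟩ := h
      · simp [h2]
      · simp [h2]
  have hz : ∀ q ∈ π.circle (Sum.inl ⟨0, by omega⟩, true), π.index q.1 < T₁.length ∧ q.2 = true :=
    fun q hq => (hcl.mem_of_sameBoundary hq).1 ⟨hn, rfl⟩
  have := (hz _ (hall (Sum.inl ⟨0, by omega⟩, true) hn)).1
  simp [index, hs] at this

/-- The number of ends in the right part of the row of an end. -/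
def rightLength (T₁ B₁ : List (Fin d)) (π : Rows d) : π.End → ℕ :=
  Sum.elim (fun _ => T₁.length) (fun _ => B₁.length)

theorem label_mem_iff_le_index (hp : T₂.Perm B₂) (hT : ∀ a ∈ T₂, a ∉ T₁) (hB : ∀ a ∈ T₂, a ∉ B₁)
    (e : End (⟨T₁ ++ T₂, B₁ ++ B₂⟩ : Rows d)) :
    label _ e ∈ T₂ ↔ rightLength T₁ B₁ _ e ≤ index _ e := by
  rcases e with i | i
  · by_cases h : (i : ℕ) < T₁.length
    · have h2 : label (⟨T₁ ++ T₂, B₁ ++ B₂⟩ : Rows d) (Sum.inl i) ∈ T₁ := by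
        simp [label, List.getElem_append_left, h]
      exact iff_of_false (fun h3 => hT _ h3 h2) (not_le.2 h)
    · simp [label, index, rightLength, List.getElem_append_right (not_lt.1 h), not_lt.1 h]
  · by_cases h : (i : ℕ) < B₁.length
    · have h2 : label (⟨T₁ ++ T₂, B₁ ++ B₂⟩ : Rows d) (Sum.inr i) ∈ B₁ := by
        simp [label, List.getElem_append_left, h]
      exact iff_of_false (fun h3 => hB _ h3 h2) (not_le.2 h)
    · rw [hp.mem_iff]
      simp [label, index, rightLength, List.getElem_append_right (not_lt.1 h), not_lt.1 h]

theorem sum_range_ite_add (f : ℕ → ℕ) {n k : ℕ} (hn : 0 < n) :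
    ∑ i ∈ Finset.range k, f (n + i) ≤
      ∑ i ∈ Finset.range (n + k), (if i = 0 then 0 else f i) := by
  rw [Finset.sum_range_add]
  refine le_add_left (Finset.sum_le_sum fun i _ => ?_)
  rw [if_neg (by omega)]

theorem sum_range_ite_eq (f : ℕ → ℕ) {n k : ℕ} (hn : 0 < n) (hf : ∀ i < n, f i = 0) :
    ∑ i ∈ Finset.range (n + k), (if i = 0 then 0 else f i) = ∑ i ∈ Finset.range k, f (n + i) := by
  rw [Finset.sum_range_add, Finset.sum_eq_zero (s := Finset.range n), zero_add]
  · exact Finset.sum_congr rfl fun i _ => if_neg (by omega)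
  · intro i hi
    simp [hf i (Finset.mem_range.1 hi)]

/-- The leftmost parts of the rows cannot form a classical exchange on their own. -/
theorem not_isComplete_of_left_block (hT₁ : T₁ ≠ []) (hB₁ : B₁ ≠ []) (hT₂ : T₂ ≠ [])
    (hp : T₂.Perm B₂) (hnd : T₂.Nodup) (hT : ∀ a ∈ T₂, a ∉ T₁) (hB : ∀ a ∈ T₂, a ∉ B₁) :
    ¬ IsComplete (⟨T₁ ++ T₂, B₁ ++ B₂⟩ : Rows d) := by
  intro hc
  have hlen := hp.length_eq
  have hn : 0 < T₁.length := List.length_pos_iff.2 hT₁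
  have hn' : 0 < B₁.length := List.length_pos_iff.2 hB₁
  obtain ⟨m, hm⟩ : ∃ m, T₂.length = m + 1 :=
    ⟨T₂.length - 1, by have := List.length_pos_iff.2 hT₂; omega⟩
  have hmem := label_mem_iff_le_index hp hT hB
  set π : Rows d := ⟨T₁ ++ T₂, B₁ ++ B₂⟩ with hπ
  have htl : π.top.length = T₁.length + (m + 1) := by simp [hπ, hm]
  have hbl : π.bot.length = B₁.length + (m + 1) := by simp [hπ, ← hlen, hm]
  have hsum : ∀ {O : Set π.Side}, π.IsLinkClosed O → ∀ b,
      ∑ i ∈ Finset.range (m + 1), topInd O b (T₁.length + i) =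
        ∑ i ∈ Finset.range (m + 1), botInd O b (B₁.length + i) := by
    intro O hO b
    have := sum_topInd_eq_sum_botInd hO hp hnd (m := T₁.length) (n := B₁.length) (by omega)
      (by omega) (fun i hi => by simp [hπ]) (fun i hi => by simp [hπ]) b
    simpa [← hlen, hm] using this
  -- The mirror argument: the last left edges are joined at the left corner, and the other left
  -- edges are the right edges of the block without its first one.
  have hspec : ∀ {O : Set π.Side}, π.IsLinkClosed O →
      topInd O true T₁.length = botInd O true B₁.length := by
    intro O hO
    have h1 := hsum hO true
    have h2 := hsum hO false
    have h3 := topInd_last hO (m := T₁.length + m) (n := B₁.length + m) (by omega) (by omega)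
    rw [Finset.sum_range_succ, Finset.sum_range_succ, h3, _root_.add_left_inj,
      Finset.sum_congr rfl fun i hi => topInd_left hO (i := T₁.length + i)
      (by have := Finset.mem_range.1 hi; omega), Finset.sum_congr rfl fun i hi =>
      botInd_left hO (i := B₁.length + i) (by have := Finset.mem_range.1 hi; omega)] at h2
    rw [Finset.sum_range_succ', Finset.sum_range_succ'] at h1
    simp only [← add_assoc, add_zero] at h1 h2
    omega
  have hall : ∀ p : π.Side, rightLength T₁ B₁ π p.1 ≤ π.index p.1 →
      (Sum.inl ⟨T₁.length, by omega⟩, true) ∈ π.circle p := by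
    intro p hpi
    by_contra hnot
    have hO := π.isLinkClosed_circle p
    have hz : topInd (π.circle p) true T₁.length = 0 := by
      simp [topInd, hnot]
    have hz' := (hspec hO).symm.trans hz
    have hnot' := not_mem_of_botInd_eq_zero (i := B₁.length) (by omega) hz'
    have hcl : π.IsLinkClosed {q | rightLength T₁ B₁ π q.1 ≤ π.index q.1 ∧ q ∈ π.circle p} := by
      intro x y hxy
      have hOxy := hO x y hxy
      have key : x ∈ π.circle p → (rightLength T₁ B₁ π x.1 ≤ π.index x.1 ↔
          rightLength T₁ B₁ π y.1 ≤ π.index y.1) := by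
        intro hx
        rcases hxy with h | h | h
        · rw [← hmem, ← hmem, h.2.1]
        · obtain ⟨h1, h2, h3, h4⟩ := h
          have hr : rightLength T₁ B₁ π x.1 = rightLength T₁ B₁ π y.1 := by
            rcases hx1 : x.1 with x1 | x1 <;> rcases hy1 : y.1 with y1 | y1 <;>
              simp [hx1, hy1, rightLength] at h1 ⊢
          by_cases hxe : π.index x.1 = rightLength T₁ B₁ π x.1
          · exfalso
            obtain ⟨x1, x2⟩ := x
            subst h2
            rcases x1 with x1 | x1
            · have : x1 = ⟨T₁.length, by omega⟩ := Fin.ext hxe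
              exact hnot (this ▸ hx)
            · have : x1 = ⟨B₁.length, by omega⟩ := Fin.ext hxe
              exact hnot' (this ▸ hx)
          · omega
        · have e1 : 0 < rightLength T₁ B₁ π x.1 ∧
              rightLength T₁ B₁ π x.1 + (m + 1) = π.rowLength x.1 := by
            rcases x.1 with _ | _ <;> simp [rowLength, rightLength, htl, hbl, hn, hn']
          have e2 : 0 < rightLength T₁ B₁ π y.1 ∧
              rightLength T₁ B₁ π y.1 + (m + 1) = π.rowLength y.1 := by
            rcases y.1 with _ | _ <;> simp [rowLength, rightLength, htl, hbl, hn, hn']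
          obtain ⟨h1, h2 | h2⟩ := h <;> omega
      constructor
      · rintro ⟨h1, h2⟩; exact ⟨(key h2).1 h1, hOxy.1 h2⟩
      · rintro ⟨h1, h2⟩; exact ⟨(key (hOxy.2 h2)).2 h1, hOxy.2 h2⟩
    have hin : ∀ q ∈ π.circle p, rightLength T₁ B₁ π q.1 ≤ π.index q.1 := fun q hq =>
      ((hcl.mem_of_sameBoundary hq).1 ⟨hpi, mem_circle_self p⟩).1
    have hcc := cuspCount_eq p
    rw [htl, hbl, sum_range_ite_eq _ hn (fun i hi => topInd_eq_zero fun hi' h => by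
        have := hin _ h; simp [index, rightLength] at this; omega),
      sum_range_ite_eq _ hn' (fun i hi => botInd_eq_zero fun hi' h => by
        have := hin _ h; simp [index, rightLength] at this; omega), hsum hO] at hcc
    rcases hc p with h | h <;> omega
  set s : π.Side := (Sum.inl ⟨T₁.length, by omega⟩, true) with hs
  have hmemS : ∀ p : π.Side, rightLength T₁ B₁ π p.1 ≤ π.index p.1 → p ∈ π.circle s := fun p h =>
    Relation.EqvGen.symm _ _ (hall p h)
  have hO := π.isLinkClosed_circle s
  have hm0 : m = 0 := by
    have hcc := cuspCount_eq s
    have h1 := sum_range_ite_add (topInd (π.circle s) true) (k := m + 1) hn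
    have h2 := sum_range_ite_add (botInd (π.circle s) true) (k := m + 1) hn'
    rw [← hsum hO] at h2
    rw [Finset.sum_congr rfl fun i hi => topInd_eq_one (O := π.circle s)
      (by have := Finset.mem_range.1 hi; omega) (hmemS (Sum.inl ⟨_, _⟩, true)
        (by simp [rightLength, index]))] at h1 h2
    simp only [Finset.sum_const, Finset.card_range, smul_eq_mul, mul_one] at h1 h2
    rw [← htl] at h1
    rw [← hbl] at h2
    rcases hc s with h | h <;> omega
  -- The left edges of the single band close up through the left corner, so their circle contains no
  -- right edge and misses `s`.
  have hcl : π.IsLinkClosed {q | rightLength T₁ B₁ π q.1 ≤ π.index q.1 ∧ q.2 = false} := by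
    intro x y hxy
    simp only [Set.mem_ofPred_eq]
    rcases hxy with h | h | h
    · obtain ⟨h1, h2, h3⟩ := h
      have hi : rightLength T₁ B₁ π x.1 ≤ π.index x.1 ↔ rightLength T₁ B₁ π y.1 ≤ π.index y.1 := by
        rw [← hmem, ← hmem, h2]
      rw [← hi]
      refine and_congr_right fun h0 => ?_
      have hne : x.1.isLeft ≠ y.1.isLeft := by
        intro he
        apply h1
        have h0' := hi.1 h0
        rcases hx : x.1 with x1 | x1 <;> rcases hy : y.1 with y1 | y1 <;>
          simp only [hx, hy, index, rightLength, Sum.elim_inl, Sum.elim_inr, Sum.isLeft_inl,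
            Sum.isLeft_inr, reduceCtorEq] at h0 h0' he ⊢
        · congr 1; ext; have := x1.2; have := y1.2; omega
        · congr 1; ext; have := x1.2; have := y1.2; omega
      rw [if_neg hne] at h3; rw [h3]
    · obtain ⟨h1, h2, h3, h4⟩ := h
      have e2 : π.index x.1 < rightLength T₁ B₁ π y.1 + 1 := by
        rcases hx1 : x.1 with x1 | x1 <;> rcases hy1 : y.1 with y1 | y1 <;>
          simp [hx1, hy1, rightLength, index] at h1 ⊢
        · have := x1.2; omega
        · have := x1.2; omega
      simp [h2]; omega
    · have e1 : 0 < rightLength T₁ B₁ π x.1 ∧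
          rightLength T₁ B₁ π x.1 + (m + 1) = π.rowLength x.1 := by
        rcases x.1 with _ | _ <;> simp [rowLength, rightLength, htl, hbl, hn, hn']
      have e2 : 0 < rightLength T₁ B₁ π y.1 ∧
          rightLength T₁ B₁ π y.1 + (m + 1) = π.rowLength y.1 := by
        rcases y.1 with _ | _ <;> simp [rowLength, rightLength, htl, hbl, hn, hn']
      obtain ⟨h1, h2 | h2⟩ := h
      · simp [h2]
      · simp only [h2, and_true]; omega
  have hz : ∀ q ∈ π.circle (Sum.inl ⟨T₁.length, by omega⟩, false), q.2 = false :=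
    fun q hq => ((hcl.mem_of_sameBoundary hq).1 ⟨le_rfl, rfl⟩).2
  have := hz _ (hall (Sum.inl ⟨T₁.length, by omega⟩, false) le_rfl)
  simp [hs] at this

/-- A classical exchange is not complete. -/
theorem not_isComplete_of_perm (hT₁ : T₁ ≠ []) (hp : T₁.Perm B₁) (hnd : T₁.Nodup) :
    ¬ IsComplete (⟨T₁, B₁⟩ : Rows d) := by
  intro hc
  have hn : 0 < T₁.length := List.length_pos_iff.2 hT₁
  have hlen := hp.length_eq
  set π : Rows d := ⟨T₁, B₁⟩ with hπ
  set p : π.Side := (Sum.inl ⟨0, hn⟩, true)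
  have hO := π.isLinkClosed_circle p
  -- Top and bottom sums agree, and so do their corner terms, which are not cusps. Removing these
  -- leaves an even number of cusps.
  have h1 := sum_topInd_eq_sum_botInd hO hp hnd (m := 0) (n := 0) (by simp [hπ]) (by simp [hπ])
    (fun i hi => by simp [hπ]) (fun i hi => by simp [hπ]) true
  have h2 := topInd_zero hO hn (by simp [hπ]; omega)
  have hcc := cuspCount_eq p
  obtain ⟨m, hm⟩ : ∃ m, T₁.length = m + 1 := ⟨T₁.length - 1, by omega⟩
  have e1 : π.top.length = m + 1 := hm
  have e2 : π.bot.length = m + 1 := by rw [← hm, hlen]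
  rw [← hlen, hm] at h1
  rw [e1, e2, Finset.sum_range_succ', Finset.sum_range_succ'] at hcc
  rw [Finset.sum_range_succ', Finset.sum_range_succ'] at h1
  simp only [Nat.add_eq_zero_iff, one_ne_zero, and_false, if_false, if_true, zero_add] at hcc h1
  rcases hc p with h | h <;> omega

end Boundary

end Rows

end RauzyInduction

end

/-! ### Admissible types and the combinatorics of a single split. -/

noncomputable section

namespace RauzyInduction

namespace Rows

variable {d : ℕ}

/-! ### Admissible types -/

/-- The number of ends on the top minus the number of ends on the bottom. -/
def excess (π : Rows d) (a : Fin d) : ℝ := (π.top.count a : ℝ) - π.bot.count a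

theorem sum_map_eq_sum_count (l : List (Fin d)) (x : Fin d → ℝ) :
    (l.map x).sum = ∑ a, (l.count a : ℝ) * x a := by
  induction l with
  | nil => simp
  | cons b l ih =>
    simp [ih, List.count_cons, add_mul, Finset.sum_add_distrib, add_comm]

theorem switch_iff (π : Rows d) (x : Fin d → ℝ) :
    π.Switch x ↔ ∑ a, π.excess a * x a = 0 := by
  simp only [Switch, sum_map_eq_sum_count, excess, sub_mul, Finset.sum_sub_distrib, sub_eq_zero]

/-- Strictly positive widths satisfying the switch condition. -/
def posCone (π : Rows d) : Set (Fin d → ℝ) := {x | (∀ a, 0 < x a) ∧ π.Switch x}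

/-- The combinatorial consequences of recurrence and completeness used below: apart from the
exchange property and recurrence, the type is not classical, and it does not split into two
exchanges one of which is classical. -/
structure Admissible (π : Rows d) : Prop where
  exchange : π.IsExchange
  recurrent : (π.posCone).Nonempty
  nonorientable : ∃ a, π.excess a ≠ 0
  inseparable : ∀ (L : Finset (Fin d)) (T₁ T₂ B₁ B₂ : List (Fin d)), π.top = T₁ ++ T₂ →
    π.bot = B₁ ++ B₂ → (∀ a ∈ T₁, a ∈ L) → (∀ a ∈ T₂, a ∉ L) → (∀ a ∈ B₁, a ∈ L) →
    (∀ a ∈ B₂, a ∉ L) → (∃ a, a ∈ L) → (∃ a, a ∉ L) →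
    (∃ a ∈ L, π.excess a ≠ 0) ∧ ∃ a ∉ L, π.excess a ≠ 0

theorem IsExchange.count_add {π : Rows d} (h : π.IsExchange) (a : Fin d) :
    π.top.count a + π.bot.count a = 2 := by rw [← List.count_append]; exact h a

theorem IsExchange.count_eq_one {π : Rows d} (h : π.IsExchange) {a : Fin d}
    (ha : π.excess a = 0) : π.top.count a = 1 ∧ π.bot.count a = 1 := by
  have h1 := h.count_add a
  have h2 : (π.top.count a : ℝ) = π.bot.count a := sub_eq_zero.1 ha
  have h3 : π.top.count a = π.bot.count a := by exact_mod_cast h2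
  omega

theorem exists_excess_pos {π : Rows d} (hr : π.posCone.Nonempty) {a : Fin d}
    (ha : π.excess a < 0) : ∃ b, 0 < π.excess b := by
  obtain ⟨x, hx, hs⟩ := hr
  by_contra! h
  rw [switch_iff] at hs
  have := (Finset.sum_eq_zero_iff_of_nonpos fun b _ =>
    mul_nonpos_of_nonpos_of_nonneg (h b) (hx b).le).1 hs a (Finset.mem_univ a)
  exact (mul_neg_of_neg_of_pos ha (hx a)).ne this

theorem exists_excess_neg {π : Rows d} (hr : π.posCone.Nonempty) {a : Fin d}
    (ha : 0 < π.excess a) : ∃ b, π.excess b < 0 := by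
  obtain ⟨x, hx, hs⟩ := hr
  by_contra! h
  rw [switch_iff] at hs
  have := (Finset.sum_eq_zero_iff_of_nonneg fun b _ => mul_nonneg (h b) (hx b).le).1 hs a
    (Finset.mem_univ a)
  exact (mul_pos ha (hx a)).ne' this

/-- A band of excess zero has one end in each row. A block consisting of such bands has the same
letters on top and bottom, once each, so it is classical and contradicts completeness. -/
theorem IsNonclassical.admissible {π : Rows d} (h : π.IsNonclassical) (hd : 0 < d) :
    π.Admissible := by
  obtain ⟨he, hr, hc⟩ := h
  replace hr : π.posCone.Nonempty := hr
  have key : ∀ P : Fin d → Prop, ∀ l l' : List (Fin d), (∀ a ∈ l, P a) → (∀ a ∈ l', P a) →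
      (∀ a, P a → l.count a = 1 ∧ l'.count a = 1) → l.Perm l' ∧ l.Nodup := by
    intro P l l' h1 h2 h3
    refine ⟨List.perm_iff_count.2 fun a => ?_, nodup_of_count_le fun a ha => (h3 a (h1 a ha)).1⟩
    by_cases ha : P a
    · rw [(h3 a ha).1, (h3 a ha).2]
    · rw [List.count_eq_zero_of_not_mem fun h => ha (h1 a h),
        List.count_eq_zero_of_not_mem fun h => ha (h2 a h)]
  refine ⟨he, hr, ?_, ?_⟩
  · by_contra! hz
    have h1 : ∀ a, π.top.count a = 1 ∧ π.bot.count a = 1 := fun a => he.count_eq_one (hz a)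
    obtain ⟨hp, hn⟩ := key (fun _ => True) π.top π.bot (by simp) (by simp) (fun a _ => h1 a)
    refine not_isComplete_of_perm (fun h => ?_) hp hn hc
    have := (h1 ⟨0, hd⟩).1
    simp [h] at this
  · intro L T₁ T₂ B₁ B₂ ht hb hT₁ hT₂ hB₁ hB₂ hL hS
    obtain ⟨top, bot⟩ := π
    dsimp only at ht hb
    subst ht hb
    set π : Rows d := ⟨T₁ ++ T₂, B₁ ++ B₂⟩
    have c1 : ∀ a ∈ L, (T₁ ++ T₂).count a = T₁.count a ∧ (B₁ ++ B₂).count a = B₁.count a := by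
      intro a ha
      simp [List.count_append, List.count_eq_zero_of_not_mem fun h => hT₂ a h ha,
        List.count_eq_zero_of_not_mem fun h => hB₂ a h ha]
    have c2 : ∀ a ∉ L, (T₁ ++ T₂).count a = T₂.count a ∧ (B₁ ++ B₂).count a = B₂.count a := by
      intro a ha
      simp [List.count_append, List.count_eq_zero_of_not_mem fun h => ha (hT₁ a h),
        List.count_eq_zero_of_not_mem fun h => ha (hB₁ a h)]
    have hE := fun a => he.count_add a
    have hEx : ∀ a, π.excess a = ((T₁ ++ T₂).count a : ℝ) - (B₁ ++ B₂).count a := fun a => rfl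
    constructor
    · by_contra! hz
      have h1 : ∀ a ∈ L, T₁.count a = 1 ∧ B₁.count a = 1 := by
        intro a ha
        rw [← (c1 a ha).1, ← (c1 a ha).2]; exact he.count_eq_one (hz a ha)
      obtain ⟨hp, hn⟩ := key (· ∈ L) T₁ B₁ hT₁ hB₁ h1
      obtain ⟨l, hl⟩ := hL
      obtain ⟨s, hs⟩ := hS
      refine not_isComplete_of_right_block (fun h => ?_) (fun h => ?_) (fun h => ?_) hp hn
        (fun a ha h => hT₂ a h (hT₁ a ha)) (fun a ha h => hB₂ a h (hT₁ a ha)) hc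
      · have := (h1 l hl).1; simp [h] at this
      -- If `T₂` were empty, `s` would have both ends on the bottom. Recurrence then demands a band
      -- of positive excess, but bands of `L` have excess zero and the others have no end on top.
      -- The remaining emptiness cases are analogous.
      · have hneg : π.excess s < 0 := by
          have e1 := (c2 s hs).1
          have e2 : (B₁ ++ B₂).count s = 2 := by
            have := hE s; change (T₁ ++ T₂).count s + (B₁ ++ B₂).count s = 2 at this
            rw [e1, h] at this; simpa using this
          rw [hEx, e1, e2, h]; norm_num
        obtain ⟨b, hb⟩ := exists_excess_pos hr hneg
        by_cases hbL : b ∈ L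
        · rw [hz b hbL] at hb; exact lt_irrefl _ hb
        · rw [hEx, (c2 b hbL).1, h] at hb
          simp only [List.count_nil, Nat.cast_zero, zero_sub, Left.neg_pos_iff] at hb
          exact absurd hb (not_lt.2 (Nat.cast_nonneg _))
      · have hneg : 0 < π.excess s := by
          have e1 := (c2 s hs).2
          have e2 : (T₁ ++ T₂).count s = 2 := by
            have := hE s; change (T₁ ++ T₂).count s + (B₁ ++ B₂).count s = 2 at this
            rw [e1, h] at this; simpa using this
          rw [hEx, e1, e2, h]; norm_num
        obtain ⟨b, hb⟩ := exists_excess_neg hr hneg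
        by_cases hbL : b ∈ L
        · rw [hz b hbL] at hb; exact lt_irrefl _ hb
        · rw [hEx, (c2 b hbL).2, h] at hb
          simp only [List.count_nil, Nat.cast_zero, sub_zero] at hb
          exact absurd hb (not_lt.2 (Nat.cast_nonneg _))
    · by_contra! hz
      have h1 : ∀ a, a ∉ L → T₂.count a = 1 ∧ B₂.count a = 1 := by
        intro a ha
        rw [← (c2 a ha).1, ← (c2 a ha).2]; exact he.count_eq_one (hz a ha)
      obtain ⟨hp, hn⟩ := key (· ∉ L) T₂ B₂ hT₂ hB₂ h1
      obtain ⟨l, hl⟩ := hL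
      obtain ⟨s, hs⟩ := hS
      refine not_isComplete_of_left_block (fun h => ?_) (fun h => ?_) (fun h => ?_) hp hn
        (fun a ha h => hT₂ a ha (hT₁ a h)) (fun a ha h => hT₂ a ha (hB₁ a h)) hc
      · have hneg : π.excess l < 0 := by
          have e1 := (c1 l hl).1
          have e2 : (B₁ ++ B₂).count l = 2 := by
            have := hE l; change (T₁ ++ T₂).count l + (B₁ ++ B₂).count l = 2 at this
            rw [e1, h] at this; simpa using this
          rw [hEx, e1, e2, h]; norm_num
        obtain ⟨b, hb⟩ := exists_excess_pos hr hneg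
        by_cases hbL : b ∈ L
        · rw [hEx, (c1 b hbL).1, h] at hb
          simp only [List.count_nil, Nat.cast_zero, zero_sub, Left.neg_pos_iff] at hb
          exact absurd hb (not_lt.2 (Nat.cast_nonneg _))
        · rw [hz b hbL] at hb; exact lt_irrefl _ hb
      · have hneg : 0 < π.excess l := by
          have e1 := (c1 l hl).2
          have e2 : (T₁ ++ T₂).count l = 2 := by
            have := hE l; change (T₁ ++ T₂).count l + (B₁ ++ B₂).count l = 2 at this
            rw [e1, h] at this; simpa using this
          rw [hEx, e1, e2, h]; norm_num
        obtain ⟨b, hb⟩ := exists_excess_neg hr hneg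
        by_cases hbL : b ∈ L
        · rw [hEx, (c1 b hbL).2, h] at hb
          simp only [List.count_nil, Nat.cast_zero, sub_zero] at hb
          exact absurd hb (not_lt.2 (Nat.cast_nonneg _))
        · rw [hz b hbL] at hb; exact lt_irrefl _ hb
      · have := (h1 s hs).1; simp [h] at this

theorem count_map_perm (σ : Equiv.Perm (Fin d)) (l : List (Fin d)) (a : Fin d) :
    (l.map σ).count a = l.count (σ.symm a) := by
  conv_lhs => rw [← σ.apply_symm_apply a]
  exact List.count_map_of_injective _ _ σ.injective _

theorem excess_relabel (σ : Equiv.Perm (Fin d)) (π : Rows d) (a : Fin d) :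
    (relabel σ π).excess a = π.excess (σ.symm a) := by
  simp [excess, relabel, count_map_perm]

theorem switch_relabel (σ : Equiv.Perm (Fin d)) (π : Rows d) (x : Fin d → ℝ) :
    (relabel σ π).Switch x ↔ π.Switch (x ∘ σ) := by
  simp [Switch, relabel]

theorem posCone_relabel (σ : Equiv.Perm (Fin d)) (π : Rows d) (x : Fin d → ℝ) :
    x ∈ (relabel σ π).posCone ↔ x ∘ σ ∈ π.posCone := by
  refine and_congr ⟨fun h a => h _, fun h a => ?_⟩ (switch_relabel σ π x)
  simpa using h (σ.symm a)

theorem Admissible.relabel {π : Rows d} (h : π.Admissible) (σ : Equiv.Perm (Fin d)) :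
    (relabel σ π).Admissible := by
  refine ⟨fun a => ?_, ?_, ?_, ?_⟩
  · simpa [Rows.relabel, count_map_perm] using h.exchange (σ.symm a)
  · obtain ⟨x, hx⟩ := h.recurrent
    refine ⟨x ∘ σ.symm, (posCone_relabel σ π _).2 ?_⟩
    simpa [Function.comp_assoc] using hx
  · obtain ⟨a, ha⟩ := h.nonorientable
    exact ⟨σ a, by simpa [excess_relabel] using ha⟩
  · intro L T₁ T₂ B₁ B₂ ht hb hT₁ hT₂ hB₁ hB₂ hL hS
    have hback : ∀ l l' : List (Fin d), l.map σ = l' → l = l'.map σ.symm := by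
      rintro l _ rfl; simp
    obtain ⟨⟨a, ha, ha'⟩, b, hb, hb'⟩ := h.inseparable (L.map σ.symm.toEmbedding)
      (T₁.map σ.symm) (T₂.map σ.symm) (B₁.map σ.symm) (B₂.map σ.symm)
      (by rw [← List.map_append]; exact hback _ _ ht)
      (by rw [← List.map_append]; exact hback _ _ hb)
      (by simpa using hT₁) (by simpa using hT₂) (by simpa using hB₁) (by simpa using hB₂)
      (by obtain ⟨a, ha⟩ := hL; exact ⟨σ.symm a, by simpa using ha⟩)
      (by obtain ⟨a, ha⟩ := hS; exact ⟨σ.symm a, by simpa using ha⟩)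
    refine ⟨⟨σ a, ?_, by simpa [excess_relabel] using ha'⟩,
      σ b, ?_, by simpa [excess_relabel] using hb'⟩
    · simpa [Finset.mem_map_equiv] using ha
    · simpa [Finset.mem_map_equiv] using hb

/-- Relations among the widths that are forced on a set of bands. -/
theorem Admissible.excess_eq_zero_of_sum {π : Rows d} (hr : π.posCone.Nonempty)
    (L : Finset (Fin d)) (h : ∀ y ∈ π.posCone, ∑ a ∈ L, π.excess a * y a = 0) :
    (∀ a ∈ L, π.excess a = 0) ∨ ∀ a ∉ L, π.excess a = 0 := by
  by_contra! hcon
  obtain ⟨⟨l, hl, hl'⟩, s, hs, hs'⟩ := hcon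
  obtain ⟨x, hx, hsw⟩ := hr
  have hls : l ≠ s := fun e => hs (e ▸ hl)
  obtain ⟨δ, hδ, hδ1, hδ2⟩ : ∃ δ : ℝ, 0 < δ ∧ δ * |(π.excess l)⁻¹| < x l ∧
      δ * |(π.excess s)⁻¹| < x s := by
    have p1 : 0 < |(π.excess l)⁻¹| := abs_pos.2 (inv_ne_zero hl')
    have p2 : 0 < |(π.excess s)⁻¹| := abs_pos.2 (inv_ne_zero hs')
    have q1 := div_pos (hx l) p1
    have q2 := div_pos (hx s) p2
    refine ⟨min (x l / |(π.excess l)⁻¹|) (x s / |(π.excess s)⁻¹|) / 2, by positivity, ?_, ?_⟩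
    · rw [← lt_div_iff₀ p1]
      exact (half_lt_self (lt_min q1 q2)).trans_le (min_le_left _ _)
    · rw [← lt_div_iff₀ p2]
      exact (half_lt_self (lt_min q1 q2)).trans_le (min_le_right _ _)
  -- The contributions of `l` and `s` to the switch sum change by `δ` and `-δ`: the full sum is
  -- kept, while the partial sum over `L` moves by `δ`. The bounds on `δ` keep the widths positive.
  set y : Fin d → ℝ := x + Pi.single l (δ * (π.excess l)⁻¹) - Pi.single s (δ * (π.excess s)⁻¹)
    with hy
  have hsum : ∀ A : Finset (Fin d), ∑ a ∈ A, π.excess a * y a = ∑ a ∈ A, π.excess a * x a +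
      (if l ∈ A then δ else 0) - if s ∈ A then δ else 0 := by
    intro A
    simp only [hy, Pi.add_apply, Pi.sub_apply, mul_sub, mul_add, Finset.sum_sub_distrib,
      Finset.sum_add_distrib, Pi.single_apply, mul_ite, mul_zero, Finset.sum_ite_eq']
    rw [show π.excess l * (δ * (π.excess l)⁻¹) = δ by field_simp,
      show π.excess s * (δ * (π.excess s)⁻¹) = δ by field_simp]
  have hyc : y ∈ π.posCone := by
    refine ⟨fun a => ?_, ?_⟩
    · have e1 := neg_abs_le (δ * (π.excess l)⁻¹)
      have e2 := le_abs_self (δ * (π.excess s)⁻¹)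
      rw [abs_mul, abs_of_pos hδ] at e1 e2
      simp only [hy, Pi.add_apply, Pi.sub_apply, Pi.single_apply]
      by_cases h1 : a = l
      · subst h1; simp only [if_true, hls, if_false]; linarith
      · by_cases h2 : a = s
        · subst h2; simp only [if_true, h1, if_false]; linarith
        · simp [h1, h2, hx a]
    · rw [switch_iff] at hsw ⊢
      rw [hsum, hsw]; simp
  have h1 := h x ⟨hx, hsw⟩
  have h2 := h y hyc
  rw [hsum, h1] at h2
  simp only [hl, hs, if_true, if_false] at h2
  linarith

/-! ### Splits -/

/-- `Split β π π' a c`: the band `a` splits the band `c`; `β` tells whether `a` is critical on the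
top. -/
inductive Split : Bool → Rows d → Rows d → Fin d → Fin d → Prop
  | top (a : Fin d) (t : List (Fin d)) (c : Fin d) (b : List (Fin d)) (h : a ≠ c) :
      Split true ⟨a :: t, c :: b⟩ (topSplit a t c b) a c
  | bot (a : Fin d) (t : List (Fin d)) (c : Fin d) (b : List (Fin d)) (h : a ≠ c) :
      Split false ⟨a :: t, c :: b⟩ (botSplit a t c b) c a

theorem Split.ne {β : Bool} {π π' : Rows d} {a c : Fin d} (h : Split β π π' a c) : a ≠ c := by
  cases h with
  | top _ _ _ _ h => exact h
  | bot _ _ _ _ h => exact h.symm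

/-- The critical bands. -/
def IsCritical (π : Rows d) (a : Fin d) : Prop := π.top.head? = some a ∨ π.bot.head? = some a

theorem Split.isCritical_winner {β : Bool} {π π' : Rows d} {a c : Fin d} (h : Split β π π' a c) :
    π'.IsCritical a := by
  cases h with
  | top => simp [IsCritical, topSplit]
  | bot => simp [IsCritical, botSplit, topSplit, swap]

theorem Split.isCritical_iff {β : Bool} {π π' : Rows d} {a c : Fin d} (h : Split β π π' a c)
    (x : Fin d) : π.IsCritical x ↔ x = a ∨ x = c := by
  cases h with
  | top => simp [IsCritical, eq_comm]
  | bot => simp [IsCritical, eq_comm, or_comm]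

theorem count_flatMap_right (l : List (Fin d)) (a c x : Fin d) :
    (l.flatMap (fun z => if z = a then [z, c] else [z])).count x =
      l.count x + if x = c then l.count a else 0 := by
  induction l with
  | nil => simp
  | cons z l ih =>
    rw [List.flatMap_cons, List.count_append, ih]
    by_cases hz : z = a
    · subst hz
      simp only [if_true, List.count_cons, List.count_nil, beq_iff_eq, @eq_comm _ c x]
      split_ifs <;> omega
    · simp only [hz, if_false, List.count_cons, List.count_nil, beq_iff_eq]
      split_ifs <;> omega

theorem count_flatMap_left (l : List (Fin d)) (a c x : Fin d) :
    (l.flatMap (fun z => if z = a then [c, z] else [z])).count x =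
      l.count x + if x = c then l.count a else 0 := by
  rw [← count_flatMap_right]
  refine List.Perm.count_eq (List.Perm.flatMap_left _ fun z _ => ?_) x
  split_ifs
  · exact List.Perm.swap _ _ _
  · rfl

/-- The substitution turns letters of `L` into words in `L` and fixes all others, so it respects the
left border of the initial block. -/
theorem dropWhile_flatMap {f : Fin d → List (Fin d)} {L : Finset (Fin d)}
    (hf : ∀ z, z ∈ L → ∀ w ∈ f z, w ∈ L) (hf' : ∀ z, z ∉ L → f z = [z]) (l : List (Fin d)) :
    (l.flatMap f).dropWhile (· ∈ L) = (l.dropWhile (· ∈ L)).flatMap f := by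
  induction l with
  | nil => simp
  | cons z l ih =>
    by_cases hz : z ∈ L
    · rw [List.flatMap_cons, List.dropWhile_append, List.dropWhile_cons_of_pos (by simpa using hz),
        ← ih, List.dropWhile_eq_nil_iff.2 (by simpa using hf z hz)]
      simp
    · rw [List.dropWhile_cons_of_neg (by simpa using hz), List.flatMap_cons, hf' z hz,
        List.singleton_append, List.dropWhile_cons_of_neg (by simpa using hz)]

/-- The number of ends of a band that do not belong to the rightmost parts of the rows labelled by
`L`. -/
def buried (π : Rows d) (L : Finset (Fin d)) (a : Fin d) : ℕ :=
  (π.top.dropWhile (· ∈ L)).count a + (π.bot.dropWhile (· ∈ L)).count a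

/-- The critical end of the loser is not buried. It lands beside the other end of the winner and
becomes buried exactly when that end is. So the total number of buried ends never decreases while
`L` plays alone. -/
theorem Split.buried_eq {β : Bool} {π π' : Rows d} {a c : Fin d} (h : Split β π π' a c)
    {L : Finset (Fin d)} (ha : a ∈ L) (hc : c ∈ L) (x : Fin d) :
    π'.buried L x = π.buried L x + if x = c then π.buried L a else 0 := by
  have key : ∀ (a : Fin d) (t : List (Fin d)) (c : Fin d) (b : List (Fin d)), a ∈ L → c ∈ L →
      ((topSplit a t c b).top.dropWhile (· ∈ L)).count x +
        ((topSplit a t c b).bot.dropWhile (· ∈ L)).count x =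
      (((a :: t).dropWhile (· ∈ L)).count x + ((c :: b).dropWhile (· ∈ L)).count x) +
        if x = c then (((a :: t).dropWhile (· ∈ L)).count a +
          ((c :: b).dropWhile (· ∈ L)).count a) else 0 := by
    intro a t c b ha hc
    rw [topSplit]
    dsimp only
    rw [List.dropWhile_cons_of_pos (by simpa using ha),
      List.dropWhile_cons_of_pos (by simpa using ha), List.dropWhile_cons_of_pos (by simpa using hc),
      dropWhile_flatMap, dropWhile_flatMap, count_flatMap_left, count_flatMap_right]
    · split_ifs <;> omega
    · intro z hz w hw; split_ifs at hw <;> simp at hw <;> grind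
    · intro z hz; rw [if_neg]; rintro rfl; exact hz ha
    · intro z hz w hw; split_ifs at hw <;> simp at hw <;> grind
    · intro z hz; rw [if_neg]; rintro rfl; exact hz ha
  cases h with
  | top a t c b h => exact key a t c b ha hc
  | bot _ t _ b h =>
    have := key a b c t ha hc
    simp only [buried, botSplit, swap]
    rw [add_comm, this]; split_ifs <;> omega

theorem buried_eq_zero_of_mem {π : Rows d} {L : Finset (Fin d)} (h : ∀ a ∈ L, π.buried L a = 0) :
    (∀ a ∈ π.top.dropWhile (· ∈ L), a ∉ L) ∧ ∀ a ∈ π.bot.dropWhile (· ∈ L), a ∉ L := by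
  constructor
  · intro a ha haL
    have h1 := h a haL
    have := List.count_pos_iff.2 ha
    simp only [buried] at h1; omega
  · intro a ha haL
    have h1 := h a haL
    have := List.count_pos_iff.2 ha
    simp only [buried] at h1; omega

/-- The moved end changes sides exactly if both ends of the winner lie on one side, and then the
excess of the loser changes by that of the winner; otherwise the winner has excess zero. Thus the
excess transforms like the coefficients of a linear form. -/
theorem Split.excess_eq {β : Bool} {π π' : Rows d} {a c : Fin d} (h : Split β π π' a c)
    (x : Fin d) : π'.excess x = π.excess x + if x = c then π.excess a else 0 := by
  have key : ∀ (a : Fin d) (t : List (Fin d)) (c : Fin d) (b : List (Fin d)), a ≠ c →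
      (topSplit a t c b).excess x = (⟨a :: t, c :: b⟩ : Rows d).excess x +
        if x = c then (⟨a :: t, c :: b⟩ : Rows d).excess a else 0 := by
    intro a t c b h
    simp only [excess, topSplit, List.count_cons, count_flatMap_left, count_flatMap_right]
    by_cases hx : x = c
    · subst hx; simp [h, h.symm]; ring
    · by_cases hx' : a = x
      · subst hx'; simp [hx, h.symm]
      · simp [hx, hx', Ne.symm hx]
  cases h with
  | top a t c b h => exact key a t c b h
  | bot _ t _ b h =>
    have e : ∀ (π : Rows d) x, π.swap.excess x = - π.excess x := by
      intro π x; simp [excess, swap]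
    have e' : ∀ x, (⟨c :: t, a :: b⟩ : Rows d).excess x = - (⟨a :: b, c :: t⟩ : Rows d).excess x := by
      intro x; simp [excess]
    rw [botSplit, e, key a b c t h.symm, e', e']
    split_ifs <;> ring

/-- The inverse of the change of widths in a split. -/
def unsplit (a c : Fin d) (y : Fin d → ℝ) : Fin d → ℝ := Function.update y a (y a + y c)

theorem unsplit_splitWidths {a c : Fin d} (h : a ≠ c) (x : Fin d → ℝ) :
    unsplit a c (splitWidths x a c) = x := by
  ext z; by_cases hz : z = a
  · subst hz; simp [unsplit, splitWidths, h.symm]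
  · simp [unsplit, splitWidths, hz]

theorem splitWidths_unsplit {a c : Fin d} (h : a ≠ c) (x : Fin d → ℝ) :
    splitWidths (unsplit a c x) a c = x := by
  ext z; by_cases hz : z = a
  · subst hz; simp [unsplit, splitWidths, h.symm]
  · simp [unsplit, splitWidths, hz]

theorem unsplit_apply (a c : Fin d) (y : Fin d → ℝ) (z : Fin d) :
    unsplit a c y z = y z + if z = a then y c else 0 := by
  by_cases hz : z = a
  · subst hz; simp [unsplit]
  · simp [unsplit, hz]

theorem sum_mul_unsplit (v y : Fin d → ℝ) (a c : Fin d) :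
    ∑ z, v z * unsplit a c y z = ∑ z, (v z + if z = c then v a else 0) * y z := by
  simp only [unsplit_apply, mul_add, add_mul, Finset.sum_add_distrib, mul_ite, ite_mul, mul_zero,
    zero_mul, Finset.sum_ite_eq', Finset.mem_univ, if_true]

theorem Split.switch_iff {β : Bool} {π π' : Rows d} {a c : Fin d} (h : Split β π π' a c)
    (y : Fin d → ℝ) : π'.Switch y ↔ π.Switch (unsplit a c y) := by
  rw [Rows.switch_iff, Rows.switch_iff, sum_mul_unsplit]
  simp only [h.excess_eq]

theorem Split.unsplit_mem_posCone {β : Bool} {π π' : Rows d} {a c : Fin d} (h : Split β π π' a c)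
    {y : Fin d → ℝ} (hy : y ∈ π'.posCone) : unsplit a c y ∈ π.posCone := by
  refine ⟨fun z => ?_, (h.switch_iff y).1 hy.2⟩
  rw [unsplit_apply]
  have := hy.1 z; have := hy.1 c
  split_ifs <;> linarith

theorem Split.splitWidths_mem_posCone {β : Bool} {π π' : Rows d} {a c : Fin d}
    (h : Split β π π' a c) {x : Fin d → ℝ} (hx : x ∈ π.posCone) (hlt : x c < x a) :
    splitWidths x a c ∈ π'.posCone := by
  refine ⟨fun z => ?_, (h.switch_iff _).2 (by rw [unsplit_splitWidths h.ne]; exact hx.2)⟩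
  by_cases hz : z = a
  · subst hz; simpa [splitWidths] using hlt
  · simpa [splitWidths, hz] using hx.1 z

/-- The linear forms on the widths that must not be too small. -/
def testForm (π : Rows d) : Fin d ⊕ Finset (Fin d) → ((Fin d → ℝ) →ₗ[ℝ] ℝ) :=
  Sum.elim (fun a => LinearMap.proj a) fun L => ∑ a ∈ L, π.excess a • LinearMap.proj a

/-- All test forms that do not vanish identically take values at least `θ`. -/
def IsGood (π : Rows d) (θ : ℝ) (y : Fin d → ℝ) : Prop :=
  ∀ i, (∃ u ∈ π.posCone, π.testForm i u ≠ 0) → θ ≤ |π.testForm i y|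

theorem IsGood.le_apply {π : Rows d} {θ : ℝ} {y : Fin d → ℝ} (h : π.IsGood θ y)
    (hy : y ∈ π.posCone) (a : Fin d) : θ ≤ y a := by
  have := h (Sum.inl a) ⟨y, hy, (hy.1 a).ne'⟩
  simpa [testForm, abs_of_pos (hy.1 a)] using this

theorem IsGood.le_sum {π : Rows d} {θ : ℝ} {y : Fin d → ℝ} (h : π.IsGood θ y) (L : Finset (Fin d))
    (hL : ∃ u ∈ π.posCone, ∑ a ∈ L, π.excess a * u a ≠ 0) :
    θ ≤ |∑ a ∈ L, π.excess a * y a| := by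
  have := h (Sum.inr L) (by simpa [testForm] using hL)
  simpa [testForm] using this

end Rows

end RauzyInduction

end

/-! ### Deterministic growth of the weights along good scales. -/

noncomputable section

namespace RauzyInduction

open Rows

/-! ### Infinite splitting sequences -/

/-- An infinite splitting sequence. -/
structure Run (d : ℕ) where
  rows : ℕ → Rows d
  wid : ℕ → Fin d → ℝ
  code : ℕ → Bool
  win : ℕ → Fin d
  lose : ℕ → Fin d
  split : ∀ n, Split (code n) (rows n) (rows (n + 1)) (win n) (lose n)
  mem : ∀ n, wid n ∈ (rows n).posCone
  wid_succ : ∀ n, wid (n + 1) = splitWidths (wid n) (win n) (lose n)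
  adm : ∀ n, (rows n).Admissible
  sum_zero : ∑ a, wid 0 a = 1

namespace Run

variable {d : ℕ} (r : Run d)

/-- The recursion satisfied by the coefficients of linear functionals of the initial widths. -/
def IsAcc (v : ℕ → Fin d → ℝ) : Prop :=
  ∀ n z, v (n + 1) z = v n z + if z = r.lose n then v n (r.win n) else 0

/-- The coefficients of the total width of the initial interval exchange. -/
def wt : ℕ → Fin d → ℝ
  | 0 => fun _ => 1
  | n + 1 => fun z => wt n z + if z = r.lose n then wt n (r.win n) else 0

theorem isAcc_wt : r.IsAcc r.wt := fun _ _ => rfl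

variable {r}

theorem IsAcc.nonneg {v : ℕ → Fin d → ℝ} (hv : r.IsAcc v) {m n : ℕ} (h : ∀ a, 0 ≤ v m a)
    (hmn : m ≤ n) (a : Fin d) : 0 ≤ v n a := by
  induction n, hmn using Nat.le_induction generalizing a with
  | base => exact h a
  | succ n _ ih => rw [hv]; split_ifs <;> simp [ih, add_nonneg]

theorem IsAcc.mono {v : ℕ → Fin d → ℝ} (hv : r.IsAcc v) {m n : ℕ} (h : ∀ a, 0 ≤ v m a)
    (hmn : m ≤ n) (a : Fin d) : v m a ≤ v n a := by
  induction n, hmn using Nat.le_induction with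
  | base => exact le_rfl
  | succ n hn ih =>
    rw [hv]
    have := hv.nonneg h hn (r.win n)
    split_ifs <;> linarith

/-- The recursion for coefficients is the transpose of `unsplit`, so the pairing with the widths is
conserved. -/
theorem IsAcc.sum_mul_wid {v : ℕ → Fin d → ℝ} (hv : r.IsAcc v) (n : ℕ) :
    ∑ a, v n a * r.wid n a = ∑ a, v 0 a * r.wid 0 a := by
  induction n with
  | zero => rfl
  | succ n ih =>
    rw [← ih]
    have : r.wid n = unsplit (r.win n) (r.lose n) (r.wid (n + 1)) := by
      rw [r.wid_succ, unsplit_splitWidths (r.split n).ne]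
    rw [this, sum_mul_unsplit]
    simp only [hv n]

theorem wt_nonneg (n : ℕ) (a : Fin d) : 0 ≤ r.wt n a :=
  r.isAcc_wt.nonneg (m := 0) (fun _ => zero_le_one) (Nat.zero_le n) a

theorem wt_mono {m n : ℕ} (h : m ≤ n) (a : Fin d) : r.wt m a ≤ r.wt n a :=
  r.isAcc_wt.mono (r.wt_nonneg m) h a

theorem one_le_wt (n : ℕ) (a : Fin d) : 1 ≤ r.wt n a := r.wt_mono (Nat.zero_le n) a

/-- The conserved pairing with the weights is the initial total width, and each of its terms is
nonnegative. Large weights therefore force small widths. -/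
theorem wt_mul_wid_le (n : ℕ) (a : Fin d) : r.wt n a * r.wid n a ≤ 1 := by
  have h : ∑ a, r.wt n a * r.wid n a = 1 := by
    rw [r.isAcc_wt.sum_mul_wid, ← r.sum_zero]; simp [wt]
  rw [← h]
  exact Finset.single_le_sum (f := fun a => r.wt n a * r.wid n a)
    (fun b _ => mul_nonneg (r.wt_nonneg n b) ((r.mem n).1 b).le) (Finset.mem_univ a)

theorem wid_le {n : ℕ} {a : Fin d} {x : ℝ} (hx : 0 < x) (h : x ≤ r.wt n a) :
    r.wid n a ≤ 1 / x := by
  rw [le_div_iff₀ hx, mul_comm]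
  exact (mul_le_mul_of_nonneg_right h ((r.mem n).1 a).le).trans (r.wt_mul_wid_le n a)

theorem sum_wt_ge (n : ℕ) : (n : ℝ) ≤ ∑ a, r.wt n a := by
  induction n with
  | zero => simpa using Finset.sum_nonneg fun a _ => r.wt_nonneg 0 a
  | succ n ih =>
    simp only [r.isAcc_wt n, Finset.sum_add_distrib, Finset.sum_ite_eq', Finset.mem_univ, if_true]
    push_cast
    linarith [r.one_le_wt n (r.win n)]

theorem exists_le_wt (R : ℝ) : ∃ n, ∃ a, R ≤ r.wt n a := by
  obtain ⟨n, hn⟩ := exists_nat_gt (d * R)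
  refine ⟨n, ?_⟩
  by_contra! h
  have : ∑ a, r.wt n a ≤ ∑ _a : Fin d, R := Finset.sum_le_sum fun a _ => (h a).le
  rw [Finset.sum_const, Finset.card_univ, Fintype.card_fin, nsmul_eq_mul] at this
  linarith [r.sum_wt_ge n]

variable (r) in
open Classical in
/-- The first time at which some coefficient of the total width is at least `R`. -/
def time (R : ℝ) : ℕ := Nat.find (r.exists_le_wt R)

theorem time_spec (R : ℝ) : ∃ a, R ≤ r.wt (r.time R) a := by
  classical exact Nat.find_spec (r.exists_le_wt R)

theorem wt_lt_of_lt_time {R : ℝ} {n : ℕ} (h : n < r.time R) (a : Fin d) : r.wt n a < R := by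
  classical
  have := Nat.find_min (r.exists_le_wt R) h
  push Not at this
  exact this a

theorem time_mono {R R' : ℝ} (h : R ≤ R') : r.time R ≤ r.time R' := by
  by_contra! hlt
  obtain ⟨a, ha⟩ := r.time_spec R'
  exact absurd (h.trans ha) (not_le.2 (wt_lt_of_lt_time hlt a))

/-- The last split adds two weights that were both below `R`. The assumption `1 < R` covers stopping
at time zero, where all weights are one. -/
theorem wt_time_lt {R : ℝ} (hR : 1 < R) (a : Fin d) : r.wt (r.time R) a < 2 * R := by
  rcases hn : r.time R with _ | n
  · simp only [wt]; linarith
  · have h := fun b => wt_lt_of_lt_time (r := r) (R := R) (n := n) (by omega) b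
    rw [r.isAcc_wt]
    have h1 := h a
    have h2 := h (r.win n)
    split_ifs <;> linarith

theorem wid_eq_of_not_win {m n : ℕ} (hmn : m ≤ n) {a : Fin d}
    (h : ∀ i, m ≤ i → i < n → r.win i ≠ a) : r.wid n a = r.wid m a := by
  induction n, hmn using Nat.le_induction with
  | base => rfl
  | succ n hn ih =>
    rw [r.wid_succ, splitWidths, Function.update_of_ne (h n hn (by omega)).symm,
      ih fun i h1 h2 => h i h1 (by omega)]

theorem excess_eq_of_not_lose {m n : ℕ} (hmn : m ≤ n) {a : Fin d}
    (h : ∀ i, m ≤ i → i < n → r.lose i ≠ a) : (r.rows n).excess a = (r.rows m).excess a := by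
  induction n, hmn using Nat.le_induction with
  | base => rfl
  | succ n hn ih =>
    rw [(r.split n).excess_eq, if_neg (h n hn (by omega)).symm, add_zero,
      ih fun i h1 h2 => h i h1 (by omega)]

/-- Every width is large at one time and small at a later one: the band must have won. -/
theorem exists_win {m n : ℕ} (hmn : m ≤ n) {a : Fin d} {ε C x : ℝ} (hx : 0 < x) (hC : 0 < C)
    (hεC : 1 < ε * C) (hgood : (r.rows m).IsGood (ε / x) (r.wid m)) (hw : C * x ≤ r.wt n a) :
    ∃ i, m ≤ i ∧ i < n ∧ r.win i = a := by
  by_contra! h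
  have h1 := hgood.le_apply (r.mem m) a
  have h2 := r.wid_le (mul_pos hC hx) hw
  rw [wid_eq_of_not_win hmn h] at h2
  have h3 := h1.trans h2
  rw [div_le_div_iff₀ hx (mul_pos hC hx)] at h3
  nlinarith

theorem abs_excess_le {π : Rows d} (h : π.IsExchange) (a : Fin d) : |π.excess a| ≤ 2 := by
  have h1 : (π.top.count a : ℝ) + π.bot.count a = 2 := by exact_mod_cast h.count_add a
  have h2 : (0 : ℝ) ≤ π.top.count a := Nat.cast_nonneg _
  have h3 : (0 : ℝ) ≤ π.bot.count a := Nat.cast_nonneg _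
  rw [excess, abs_le]; constructor <;> linarith

/-- Pigeonhole: strict growth at each of `N + 1` steps would exceed the bound `N`. -/
theorem exists_eq_succ_of_le {f : ℕ → ℕ} {N : ℕ} (hmono : ∀ s ≤ N, f s ≤ f (s + 1))
    (hN : f (N + 1) ≤ N) : ∃ s ≤ N, f s = f (s + 1) := by
  by_contra! h
  have : ∀ s ≤ N + 1, s ≤ f s := by
    intro s hs
    induction s with
    | zero => omega
    | succ s ih =>
      have := ih (by omega); have := hmono s (by omega); have := h s (by omega); omega
  have := this (N + 1) le_rfl
  omega

theorem sum_buried_le {π : Rows d} (h : π.IsExchange) (L : Finset (Fin d)) :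
    ∑ a, π.buried L a ≤ 2 * d := by
  calc ∑ a, π.buried L a ≤ ∑ _a : Fin d, 2 := Finset.sum_le_sum fun a _ => by
        rw [← h.count_add a]
        exact Nat.add_le_add ((List.dropWhile_sublist _).count_le a)
          ((List.dropWhile_sublist _).count_le a)
    _ = 2 * d := by simp [mul_comm]

/-- A set of bands that plays among itself for a long time is separated from the others. -/
theorem false_of_isolated {ε C : ℝ} (hC : 1 ≤ C) (hεC : 2 * d < ε * C)
    (L : Finset (Fin d)) (hLne : L.Nonempty) (hLu : ∃ a, a ∉ L)
    (t : ℕ → ℕ) (x : ℕ → ℝ) (hx : ∀ s, 0 < x s) (ht : ∀ s ≤ 2 * d, t s ≤ t (s + 1))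
    (hgood : ∀ s ≤ 2 * d, (r.rows (t s)).IsGood (ε / x s) (r.wid (t s)))
    (hw : ∀ s ≤ 2 * d, ∀ a ∈ L, C * x s ≤ r.wt (t (s + 1)) a)
    (hcrit : ∀ n, t 0 ≤ n → n < t (2 * d + 1) → r.win n ∈ L ∧ r.lose n ∈ L) : False := by
  have hd : (1 : ℝ) ≤ d := by
    obtain ⟨a, -⟩ := hLne
    exact_mod_cast a.pos
  have h1C : 1 < ε * C := by linarith
  have hC0 : 0 < C := by linarith
  have htm : ∀ s s', s ≤ s' → s' ≤ 2 * d + 1 → t s ≤ t s' := by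
    intro s s' h
    induction s', h using Nat.le_induction with
    | base => exact fun _ => le_rfl
    | succ k hk ih => exact fun h => (ih (by omega)).trans (ht k (by omega))
  -- The number of buried ends is nondecreasing and at most `2d`, so it is constant during one of
  -- the `2d + 1` stages.
  set U : ℕ → ℕ := fun n => ∑ a, (r.rows n).buried L a with hU
  have hUs : ∀ n, t 0 ≤ n → n < t (2 * d + 1) →
      U (n + 1) = U n + (r.rows n).buried L (r.win n) := by
    intro n h1 h2
    obtain ⟨h3, h4⟩ := hcrit n h1 h2
    simp only [hU, (r.split n).buried_eq h3 h4, Finset.sum_add_distrib, Finset.sum_ite_eq',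
      Finset.mem_univ, if_true]
  have hUm : ∀ m n, m ≤ n → t 0 ≤ m → n ≤ t (2 * d + 1) → U m ≤ U n := by
    intro m n hmn
    induction n, hmn using Nat.le_induction with
    | base => exact fun _ _ => le_rfl
    | succ k hk ih =>
      intro h1 h2
      rw [hUs k (by omega) (by omega)]
      have := ih h1 (by omega); omega
  obtain ⟨s, hs, hsU⟩ := exists_eq_succ_of_le (f := fun s => U (t s)) (N := 2 * d)
    (fun s hs => hUm _ _ (ht s hs) (htm _ _ (Nat.zero_le s) (by omega)) (htm _ _ (by omega) le_rfl))
    (sum_buried_le (r.adm _).exchange L)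
  have h0 : t 0 ≤ t s := htm _ _ (Nat.zero_le s) (by omega)
  have h1 : t (s + 1) ≤ t (2 * d + 1) := htm _ _ (by omega) le_rfl
  have hconst : ∀ n, t s ≤ n → n < t (s + 1) → (r.rows n).buried L (r.win n) = 0 := by
    intro n h2 h3
    have e1 := hUs n (by omega) (by omega)
    have e2 := hUm (t s) n h2 h0 (by omega)
    have e3 := hUm (n + 1) (t (s + 1)) h3 (by omega) h1
    omega
  have hbur : ∀ n, t s ≤ n → n ≤ t (s + 1) → ∀ a,
      (r.rows n).buried L a = (r.rows (t s)).buried L a := by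
    intro n hn
    induction n, hn using Nat.le_induction with
    | base => exact fun _ _ => rfl
    | succ k hk ih =>
      intro h a
      obtain ⟨h3, h4⟩ := hcrit k (by omega) (by omega)
      rw [(r.split k).buried_eq h3 h4, hconst k hk (by omega), ih (by omega)]
      simp
  -- Every band of `L` wins during that stage, and a winner with a buried end would have raised the
  -- total.
  have hz : ∀ a ∈ L, (r.rows (t s)).buried L a = 0 := by
    intro a ha
    obtain ⟨i, hi1, hi2, rfl⟩ := exists_win (ht s hs) (hx s) hC0 h1C (hgood s hs) (hw s hs a ha)
    rw [← hbur i hi1 hi2.le, hconst i hi1 hi2]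
  have hsumL : ∀ n, ∑ a ∈ L, (r.rows n).excess a * r.wid n a =
      - ∑ a ∈ Lᶜ, (r.rows n).excess a * r.wid n a := by
    intro n
    have := (switch_iff _ _).1 (r.mem n).2
    rw [← Finset.sum_add_sum_compl L] at this
    linarith
  -- Bands outside `L` neither win nor lose, so their part of the switch sum is frozen, and with it
  -- the part of `L`.
  have hsum : ∑ a ∈ L, (r.rows (t s)).excess a * r.wid (t s) a =
      ∑ a ∈ L, (r.rows (t (s + 1))).excess a * r.wid (t (s + 1)) a := by
    rw [hsumL, hsumL]
    congr 1
    refine Finset.sum_congr rfl fun a ha => ?_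
    rw [Finset.mem_compl] at ha
    rw [wid_eq_of_not_win (ht s hs) (a := a), excess_eq_of_not_lose (ht s hs) (a := a)]
    · rintro i h2 h3 rfl; exact ha (hcrit i (by omega) (by omega)).2
    · rintro i h2 h3 rfl; exact ha (hcrit i (by omega) (by omega)).1
  -- Otherwise goodness bounds the frozen sum below by `ε / x s`. At the end of the stage the widths
  -- in `L` are at most `1 / (C * x s)` and excesses at most two, so the sum is at most `2d / (C * x
  -- s)`, which is smaller.
  have htriv : ∀ y ∈ (r.rows (t s)).posCone, ∑ a ∈ L, (r.rows (t s)).excess a * y a = 0 := by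
    by_contra! h
    have h2 := (hgood s hs).le_sum L h
    rw [hsum] at h2
    have h3 : |∑ a ∈ L, (r.rows (t (s + 1))).excess a * r.wid (t (s + 1)) a| ≤
        2 * d * (1 / (C * x s)) := by
      calc _ ≤ ∑ a ∈ L, |(r.rows (t (s + 1))).excess a * r.wid (t (s + 1)) a| :=
            Finset.abs_sum_le_sum_abs _ _
        _ ≤ ∑ a ∈ L, 2 * (1 / (C * x s)) := Finset.sum_le_sum fun a ha => by
            rw [abs_mul, abs_of_pos ((r.mem _).1 a)]
            exact mul_le_mul (abs_excess_le (r.adm _).exchange a)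
              (r.wid_le (mul_pos hC0 (hx s)) (hw s hs a ha)) ((r.mem _).1 a).le zero_le_two
        _ ≤ ∑ a : Fin d, 2 * (1 / (C * x s)) :=
            Finset.sum_le_sum_of_subset_of_nonneg (Finset.subset_univ _) fun _ _ _ => by
              have := mul_pos hC0 (hx s); positivity
        _ = _ := by simp; ring
    have h4 := h2.trans h3
    rw [mul_one_div, div_le_div_iff₀ (hx s) (mul_pos hC0 (hx s))] at h4
    nlinarith [hx s]
  -- With no buried end, `L` occupies exactly the right parts of both rows, and inseparability
  -- contradicts the vanishing partial sum.
  obtain ⟨hT, hB⟩ := buried_eq_zero_of_mem hz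
  obtain ⟨⟨a, ha, ha'⟩, b, hb, hb'⟩ := (r.adm (t s)).inseparable L _ _ _ _
    (List.takeWhile_append_dropWhile (p := (· ∈ L))).symm
    (List.takeWhile_append_dropWhile (p := (· ∈ L))).symm
    (fun a ha => by simpa using List.mem_takeWhile_imp ha) hT
    (fun a ha => by simpa using List.mem_takeWhile_imp ha) hB hLne hLu
  rcases Admissible.excess_eq_zero_of_sum (r.adm (t s)).recurrent L htriv with h | h
  · exact ha' (h a ha)
  · exact hb' (h b hb)

/-- Goodness at the scale `x`. -/
def GoodAt (r : Run d) (ε x : ℝ) : Prop :=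
  (r.rows (r.time x)).IsGood (ε / x) (r.wid (r.time x))

open Classical in
/-- After sufficiently many good scales, many coefficients are large. -/
theorem exists_card_large (k : ℕ) (hk : k < d) : ∃ m : ℕ, ∀ (r : Run d) (ε C R : ℝ), 1 ≤ C →
    2 * d < ε * C → 0 < R → (∀ j ≤ m, r.GoodAt ε (C ^ j * R)) →
    k + 1 ≤ (Finset.univ.filter fun a => R ≤ r.wt (r.time (C ^ m * R)) a).card := by
  induction k with
  | zero =>
    refine ⟨0, fun r ε C R _ _ _ _ => ?_⟩
    obtain ⟨a, ha⟩ := r.time_spec R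
    exact Finset.card_pos.2 ⟨a, by simpa using ha⟩
  | succ k ih =>
    obtain ⟨m, hm⟩ := ih (by omega)
    -- The first `m` scales activate the induction hypothesis, the next ones form `2d + 1` stages of
    -- `m + 1` scales for the isolated game, and the last one forces a win.
    refine ⟨m + (2 * d + 1) * (m + 1) + 1, fun r ε C R hC hεC hR hgood => ?_⟩
    set M := m + (2 * d + 1) * (m + 1) + 1 with hM
    by_contra! hcard
    have hd : (1 : ℝ) ≤ d := by exact_mod_cast (by omega : 1 ≤ d)
    have hC0 : 0 < C := by linarith
    have hx : ∀ j, 0 < C ^ j * R := fun j => by positivity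
    set T : ℕ → ℕ := fun j => r.time (C ^ j * R) with hT
    have hTm : ∀ i j, i ≤ j → T i ≤ T j := fun i j hij =>
      r.time_mono (mul_le_mul_of_nonneg_right (pow_le_pow_right₀ hC hij) hR.le)
    have hRle : ∀ j, R ≤ C ^ j * R := fun j => le_mul_of_one_le_left hR.le (one_le_pow₀ hC)
    set L : Finset (Fin d) := Finset.univ.filter fun a => R ≤ r.wt (T M) a with hL
    -- At every intermediate scale the induction hypothesis yields at least `k + 1` large bands.
    -- They all belong to `L`, which has at most `k + 1` elements, so the large set is always `L`
    -- itself.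
    have hLw : ∀ s, s + m ≤ M → ∀ a ∈ L, C ^ s * R ≤ r.wt (T (s + m)) a := by
      intro s hs
      have h1 := hm r ε C (C ^ s * R) hC hεC (hx s) (fun j hj => by
        rw [← mul_assoc, ← pow_add]; exact hgood _ (by omega))
      rw [← mul_assoc, ← pow_add, add_comm m s] at h1
      have hsub : (Finset.univ.filter fun a => C ^ s * R ≤ r.wt (T (s + m)) a) ⊆ L := by
        intro a ha
        simp only [hL, Finset.mem_filter, Finset.mem_univ, true_and] at ha ⊢
        exact (hRle s).trans (ha.trans (r.wt_mono (hTm _ _ hs) a))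
      have heq := Finset.eq_of_subset_of_card_le hsub (by
        refine le_trans ?_ h1
        omega)
      intro a ha
      rw [← heq] at ha
      simpa using ha
    have hS : ∀ a, a ∉ L → ∀ n ≤ T M, r.wt n a < R := by
      intro a ha n hn
      simp only [hL, Finset.mem_filter, Finset.mem_univ, true_and, not_le] at ha
      exact (r.wt_mono hn a).trans_lt ha
    obtain ⟨b, hb⟩ := r.time_spec (C ^ M * R)
    have hbL : b ∈ L := by
      simp only [hL, Finset.mem_filter, Finset.mem_univ, true_and]
      exact (hRle M).trans hb
    have hLu : ∃ a, a ∉ L := by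
      by_contra! h
      have : L = Finset.univ := Finset.eq_univ_of_forall h
      rw [this, Finset.card_univ, Fintype.card_fin] at hcard
      omega
    -- A loser gains the weight of the winner: an outsider losing to a band of `L` would become
    -- large.
    have hA : ∀ n, T m ≤ n → n < T M → r.lose n ∉ L → r.win n ∉ L := by
      intro n h1 h2 h3 h4
      have h5 := hLw 0 (by omega) _ h4
      rw [zero_add, pow_zero, one_mul] at h5
      have h6 := hS _ h3 (n + 1) (by omega)
      rw [r.isAcc_wt, if_pos rfl] at h6
      have := r.wt_mono h1 (r.win n)
      have := r.wt_nonneg n (r.lose n)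
      linarith
    -- Once an outsider is critical, the winner is an outsider by `hA`, and it stays critical after
    -- the split; so no band of `L` wins before `T M`. But `b` has to win during the last scale.
    have hB : ∀ n, T m ≤ n → n ≤ T (M - 1) → ∀ a, (r.rows n).IsCritical a → a ∈ L := by
      intro n h1 h2 a ha
      by_contra haL
      have hcr : ∀ i, n ≤ i → i < T M → (∃ c, (r.rows i).IsCritical c ∧ c ∉ L) → r.win i ∉ L := by
        rintro i h3 h4 ⟨c, hc, hcL⟩
        rcases ((r.split i).isCritical_iff c).1 hc with rfl | rfl
        · exact hcL
        · exact hA i (by omega) h4 hcL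
      have hex : ∀ i, n ≤ i → i ≤ T M → ∃ c, (r.rows i).IsCritical c ∧ c ∉ L := by
        intro i hi
        induction i, hi using Nat.le_induction with
        | base => exact fun _ => ⟨a, ha, haL⟩
        | succ i hi ih =>
          exact fun h => ⟨r.win i, (r.split i).isCritical_winner, hcr i hi (by omega)
            (ih (by omega))⟩
      obtain ⟨i, h3, h4, h5⟩ := exists_win (r := r) (hTm (M - 1) M (by omega)) (hx (M - 1)) hC0
        (by linarith) (hgood (M - 1) (by omega)) (a := b) (by
          rw [← mul_assoc, ← pow_succ', Nat.sub_add_cancel (by omega)]; exact hb)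
      exact hcr i (by omega) h4 (hex i (by omega) h4.le) (h5 ▸ hbL)
    refine r.false_of_isolated hC hεC L ⟨b, hbL⟩ hLu (fun s => T (m + s * (m + 1)))
      (fun s => C ^ (m + s * (m + 1)) * R) (fun s => hx _)
      (fun s _ => hTm _ _ (by rw [add_one_mul]; omega)) (fun s hs => ?_) (fun s hs a ha => ?_) ?_
    · refine hgood _ ?_
      have : s * (m + 1) ≤ (2 * d + 1) * (m + 1) := Nat.mul_le_mul_right _ (by omega)
      omega
    · have h1 : (s + 1) * (m + 1) ≤ (2 * d + 1) * (m + 1) := Nat.mul_le_mul_right _ (by omega)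
      have h2 := hLw (m + s * (m + 1) + 1) (by rw [add_one_mul] at h1; omega) a ha
      rw [← mul_assoc, ← pow_succ']
      convert h2 using 3
      ring
    · intro n h1 h2
      rw [zero_mul, add_zero] at h1
      have h3 : n ≤ T (M - 1) := by
        refine h2.le.trans (hTm _ _ ?_)
        omega
      have h4 := hB n h1 h3
      exact ⟨h4 _ (((r.split n).isCritical_iff _).2 (Or.inl rfl)),
        h4 _ (((r.split n).isCritical_iff _).2 (Or.inr rfl))⟩

/-- While every band of a proper set `S` wins, as does some band outside, the set is not closed
under the relation from winners to losers. -/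
theorem false_of_closed {S : Finset (Fin d)} {m n p : ℕ}
    (hcl : ∀ i, m ≤ i → i < p → r.win i ∈ S → r.lose i ∈ S)
    {a b : Fin d} (ha : a ∉ S) (hb : b ∈ S) (hwa : ∃ i, m ≤ i ∧ i < n ∧ r.win i = a)
    (hwb : ∃ i, n ≤ i ∧ i < p ∧ r.win i = b) : False := by
  obtain ⟨i, hi1, hi2, rfl⟩ := hwa
  obtain ⟨j, hj1, hj2, rfl⟩ := hwb
  have : ∀ j, i ≤ j → j < p → r.win j ∉ S := by
    intro j hj
    induction j, hj using Nat.le_induction with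
    | base => exact fun _ => ha
    | succ j hj ih =>
      intro h hw
      have h1 := hcl (j + 1) (by omega) h hw
      rcases ((r.split (j + 1)).isCritical_iff _).1 (r.split j).isCritical_winner with h2 | h2
      · exact ih (by omega) (h2 ▸ hw)
      · exact ih (by omega) (h2 ▸ h1)
  exact this j (by omega) hj2 hb

open Classical in
/-- After sufficiently many good scales, the coefficients of the total width are balanced, and every
non-negative functional has become positive. -/
theorem exists_positive_window (d : ℕ) (hd : 0 < d) : ∃ m J : ℕ, ∀ (r : Run d) (ε C R : ℝ), 1 ≤ C →
    2 * d < ε * C → 1 < R → (∀ j ≤ J, r.GoodAt ε (C ^ j * R)) →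
    r.time R ≤ r.time (C ^ m * R) ∧ r.time (C ^ m * R) ≤ r.time (C ^ J * R) ∧
    (∀ j k, r.wt (r.time (C ^ J * R)) j ≤ 2 * C ^ J * r.wt (r.time (C ^ m * R)) k) ∧
    ∀ v, r.IsAcc v → (∀ a, 0 ≤ v (r.time (C ^ m * R)) a) →
      ∀ j k, v (r.time (C ^ m * R)) k ≤ v (r.time (C ^ J * R)) j := by
  obtain ⟨m, hm⟩ := exists_card_large (d := d) (d - 1) (by omega)
  -- After `m` scales all weights are large. Then come `2d` windows of `m + 1` scales, in each of
  -- which every band wins; a pair of windows adds at least one band to the positive set.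
  refine ⟨m, m + (2 * d) * (m + 1), fun r ε C R hC hεC hR1 hgood => ?_⟩
  have hd1 : (1 : ℝ) ≤ d := by exact_mod_cast hd
  have hC0 : 0 < C := by linarith
  have hR : 0 < R := by linarith
  have hx : ∀ j, 0 < C ^ j * R := fun j => by positivity
  set T : ℕ → ℕ := fun j => r.time (C ^ j * R) with hT
  have hTm : ∀ i j, i ≤ j → T i ≤ T j := fun i j hij =>
    r.time_mono (mul_le_mul_of_nonneg_right (pow_le_pow_right₀ hC hij) hR.le)
  have hw : ∀ s, s + m ≤ m + (2 * d) * (m + 1) → ∀ a, C ^ s * R ≤ r.wt (T (s + m)) a := by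
    intro s hs a
    have h1 := hm r ε C (C ^ s * R) hC hεC (hx s) (fun j hj => by
        rw [← mul_assoc, ← pow_add]; exact hgood _ (by omega))
    rw [← mul_assoc, ← pow_add, add_comm m s] at h1
    have h2 : (Finset.univ.filter fun a => C ^ s * R ≤ r.wt (T (s + m)) a) = Finset.univ :=
      Finset.eq_univ_of_card _ (le_antisymm (Finset.card_le_univ _) (by
        rw [Fintype.card_fin]; simp only [hT]; omega))
    have : a ∈ Finset.univ.filter fun a => C ^ s * R ≤ r.wt (T (s + m)) a := by simp [h2]
    simpa using this
  have hwin : ∀ s, s < 2 * d → ∀ a, ∃ i, T (m + s * (m + 1)) ≤ i ∧ i < T (m + (s + 1) * (m + 1)) ∧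
      r.win i = a := by
    intro s hs a
    have h1 : (s + 1) * (m + 1) ≤ (2 * d) * (m + 1) := Nat.mul_le_mul_right _ (by omega)
    have h2 := hw (m + s * (m + 1) + 1) (by rw [add_one_mul] at h1; omega) a
    refine exists_win (hTm _ _ (by rw [add_one_mul]; omega)) (hx (m + s * (m + 1))) hC0
      (by linarith) (hgood _ (by rw [add_one_mul] at h1; omega)) ?_
    rw [← mul_assoc, ← pow_succ']
    convert h2 using 3
    ring
  refine ⟨?_, hTm _ _ (by omega), fun j k => ?_, fun v hv h0 j k => ?_⟩
  · simpa [hT] using hTm 0 m (Nat.zero_le m)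
  · have h1 := hw 0 (by omega) k
    have h2 := r.wt_time_lt (R := C ^ (m + 2 * d * (m + 1)) * R)
      (lt_of_lt_of_le hR1 (le_mul_of_one_le_left hR.le (one_le_pow₀ hC))) j
    rw [pow_zero, one_mul, zero_add] at h1
    calc _ ≤ 2 * (C ^ (m + 2 * d * (m + 1)) * R) := h2.le
      _ = 2 * C ^ (m + 2 * d * (m + 1)) * R := by ring
      _ ≤ _ := mul_le_mul_of_nonneg_left h1 (by positivity)
  -- This set never shrinks, contains `k` from the start, and absorbs every band that loses to one
  -- of its members.
  · set S : ℕ → Finset (Fin d) := fun n => Finset.univ.filter fun j => v (T m) k ≤ v n j with hS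
    have hSm : ∀ n n', T m ≤ n → n ≤ n' → S n ⊆ S n' := by
      intro n n' h1 h2 a ha
      simp only [hS, Finset.mem_filter, Finset.mem_univ, true_and] at ha ⊢
      exact ha.trans (hv.mono (fun a => hv.nonneg h0 h1 a) h2 a)
    have hSl : ∀ n, T m ≤ n → r.win n ∈ S n → r.lose n ∈ S (n + 1) := by
      intro n h1 h2
      simp only [hS, Finset.mem_filter, Finset.mem_univ, true_and] at h2 ⊢
      rw [hv, if_pos rfl]
      have := hv.nonneg h0 h1 (r.lose n)
      linarith
    have hkS : ∀ n, T m ≤ n → k ∈ S n := fun n h => hSm (T m) n le_rfl h (by simp [hS])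
    have hgrow : ∀ s, s ≤ d → s + 1 ≤ (S (T (m + (2 * s) * (m + 1)))).card ∨
        S (T (m + (2 * s) * (m + 1))) = Finset.univ := by
      intro s
      induction s with
      | zero =>
        intro _
        left
        exact Finset.card_pos.2 ⟨k, hkS _ (hTm _ _ (by omega))⟩
      | succ s ih =>
        intro hs
        have hle : T (m + (2 * s) * (m + 1)) ≤ T (m + (2 * (s + 1)) * (m + 1)) :=
          hTm _ _ (by ring_nf; omega)
        have hsub := hSm _ _ (hTm m (m + (2 * s) * (m + 1)) (by omega)) hle
        by_cases huniv : S (T (m + (2 * (s + 1)) * (m + 1))) = Finset.univ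
        · exact Or.inr huniv
        left
        rcases ih (by omega) with h | h
        · refine lt_of_le_of_lt h (Finset.card_lt_card ((Finset.ssubset_iff_subset_ne).2
            ⟨hsub, fun heq => ?_⟩))
          obtain ⟨a, ha⟩ : ∃ a, a ∉ S (T (m + (2 * (s + 1)) * (m + 1))) := by
            by_contra! hcon
            exact huniv (Finset.eq_univ_of_forall hcon)
          -- If `S` stood still for two windows, it would be closed under passing from winner to
          -- loser, although an outsider wins in the first window and `k` in the second.
          refine r.false_of_closed (p := T (m + (2 * (s + 1)) * (m + 1))) ?_ ha
            (hkS _ (hTm _ _ (by omega))) (hwin (2 * s) (by omega) a) ?_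
          · intro i hi1 hi2 hiw
            have h1 : T m ≤ i := (hTm _ _ (by omega)).trans hi1
            rw [← heq] at hiw
            exact hSm _ _ (h1.trans (Nat.le_succ i)) hi2 (hSl i h1 (hSm _ _ (hTm _ _ (by omega)) hi1 hiw))
          · have := hwin (2 * s + 1) (by omega) k
            rwa [show 2 * s + 1 + 1 = 2 * (s + 1) by ring] at this
        · exact absurd (Finset.eq_univ_of_forall fun a => hsub (h ▸ Finset.mem_univ a)) huniv
    have hfin : S (T (m + 2 * d * (m + 1))) = Finset.univ := by
      rcases hgrow d le_rfl with h | h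
      · have := Finset.card_le_univ (S (T (m + 2 * d * (m + 1))))
        rw [Fintype.card_fin] at this
        omega
      · exact h
    have : j ∈ S (T (m + 2 * d * (m + 1))) := hfin ▸ Finset.mem_univ j
    simpa [hS] using this

end Run

end RauzyInduction

end

/-! ### Haar measure on hyperplanes and small values of linear forms. -/

noncomputable section

namespace RauzyInduction

/-! ### Lebesgue measure on a linear subspace -/

section Flat

variable {d : ℕ}

/-- Lebesgue measure on a linear subspace, as a measure on the ambient space. -/
def flatMeasure (H : Submodule ℝ (Fin d → ℝ)) : Measure (Fin d → ℝ) :=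
  (addHaar : Measure H).map Subtype.val

variable {H : Submodule ℝ (Fin d → ℝ)}

theorem flatMeasure_apply {A : Set (Fin d → ℝ)} (hA : MeasurableSet A) :
    flatMeasure H A = (addHaar : Measure H) (Subtype.val ⁻¹' A) :=
  map_apply measurable_subtype_coe hA

theorem flatMeasure_preimage_sub {u : Fin d → ℝ} (hu : u ∈ H) {A : Set (Fin d → ℝ)}
    (hA : MeasurableSet A) : flatMeasure H ((fun z => z - u) ⁻¹' A) = flatMeasure H A := by
  have hm : Measurable fun z : Fin d → ℝ => z - u := measurable_id.sub_const u
  rw [flatMeasure_apply (hm hA), flatMeasure_apply hA,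
    ← measure_preimage_add_right (addHaar : Measure H) (-⟨u, hu⟩) (Subtype.val ⁻¹' A)]
  congr 1

theorem flatMeasure_preimage_smul {r : ℝ} (hr : 0 < r) {A : Set (Fin d → ℝ)}
    (hA : MeasurableSet A) : flatMeasure H ((fun z => r • z) ⁻¹' A) =
      ENNReal.ofReal ((r ^ Module.finrank ℝ H)⁻¹) * flatMeasure H A := by
  have hm : Measurable fun z : Fin d → ℝ => r • z := measurable_const_smul r
  rw [flatMeasure_apply (hm hA), flatMeasure_apply hA]
  have := addHaar_preimage_smul (addHaar : Measure H) hr.ne' (Subtype.val ⁻¹' A)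
  rw [abs_of_pos (by positivity)] at this
  rw [← this]
  rfl

theorem flatMeasure_ker {ℓ : (Fin d → ℝ) →ₗ[ℝ] ℝ} (h : ∃ u ∈ H, ℓ u ≠ 0) :
    flatMeasure H {z | ℓ z = 0} = 0 := by
  have hm : MeasurableSet {z | ℓ z = 0} :=
    measurableSet_eq_fun (LinearMap.continuous_of_finiteDimensional ℓ).measurable measurable_const
  rw [flatMeasure_apply hm]
  obtain ⟨u, hu, hne⟩ := h
  have : (Subtype.val ⁻¹' {z | ℓ z = 0} : Set H) = LinearMap.ker (ℓ ∘ₗ H.subtype) := by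
    ext z; simp
  rw [this]
  refine addHaar_submodule _ _ fun htop => hne ?_
  have : (⟨u, hu⟩ : H) ∈ LinearMap.ker (ℓ ∘ₗ H.subtype) := htop ▸ Submodule.mem_top
  simpa using this

theorem exists_addHaar_eq_mul {E : Type*} [NormedAddCommGroup E] [NormedSpace ℝ E]
    [FiniteDimensional ℝ E] [MeasurableSpace E] [BorelSpace E] (μ ν : Measure E)
    [μ.IsAddHaarMeasure] [ν.IsAddHaarMeasure] :
    ∃ c : ENNReal, c ≠ 0 ∧ c ≠ ⊤ ∧ ∀ A, μ A = c * ν A := by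
  have : ProperSpace E := FiniteDimensional.proper_real E
  refine ⟨_, ENNReal.coe_ne_zero.2 (addHaarScalarFactor_pos_of_isAddHaarMeasure μ ν).ne',
    ENNReal.coe_ne_top, fun A => ?_⟩
  conv_lhs => rw [isAddLeftInvariant_eq_smul μ ν]
  rw [Measure.smul_apply]
  rfl

/-- Haar measure is unique up to a factor. Its value is irrelevant later, because only null sets and
ratios of measures are compared. -/
theorem flatMeasure_map (Q : (Fin d → ℝ) ≃ₗ[ℝ] (Fin d → ℝ)) {H' : Submodule ℝ (Fin d → ℝ)}
    (hQ : H'.map (Q : (Fin d → ℝ) →ₗ[ℝ] (Fin d → ℝ)) = H) :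
    ∃ c : ENNReal, c ≠ 0 ∧ c ≠ ⊤ ∧ ∀ A, MeasurableSet A →
      flatMeasure H A = c * flatMeasure H' (Q ⁻¹' A) := by
  subst hQ
  set e : H' ≃ₗ[ℝ] H'.map (Q : (Fin d → ℝ) →ₗ[ℝ] (Fin d → ℝ)) := Q.submoduleMap H'
  have : IsAddHaarMeasure ((addHaar : Measure H').map e) :=
    e.toContinuousLinearEquiv.isAddHaarMeasure_map _
  obtain ⟨c, h0, htop, h⟩ := exists_addHaar_eq_mul
    (addHaar : Measure (H'.map (Q : (Fin d → ℝ) →ₗ[ℝ] (Fin d → ℝ)))) ((addHaar : Measure H').map e)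
  refine ⟨c, h0, htop, fun A hA => ?_⟩
  have hQm : Measurable Q := (LinearMap.continuous_of_finiteDimensional Q.toLinearMap).measurable
  have hem : Measurable e := (LinearMap.continuous_of_finiteDimensional e.toLinearMap).measurable
  rw [flatMeasure_apply hA, flatMeasure_apply (hQm hA), h, map_apply hem (measurable_subtype_coe hA)]
  rfl

theorem flatMeasure_lt_top {A : Set (Fin d → ℝ)} (hA : Bornology.IsBounded A)
    (hm : MeasurableSet A) : flatMeasure H A < ⊤ := by
  rw [flatMeasure_apply hm]
  refine Bornology.IsBounded.measure_lt_top ?_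
  obtain ⟨C, hC⟩ := hA.exists_norm_le
  exact (Metric.isBounded_closedBall (x := (0 : H)) (r := C)).subset fun z hz => by
    simpa using hC _ hz

/-- In a truncated cone, the region where a non-zero linear form is small has small measure. -/
theorem flatMeasure_small_form_le {K : Set (Fin d → ℝ)} (hKm : MeasurableSet K)
    (hadd : ∀ z ∈ K, ∀ w ∈ K, z + w ∈ K) (hsmul : ∀ r : ℝ, 0 < r → ∀ z ∈ K, r • z ∈ K)
    (N ℓ : (Fin d → ℝ) →ₗ[ℝ] ℝ) {u : Fin d → ℝ} (huK : u ∈ K) (huH : u ∈ H) (hℓ : ℓ u ≠ 0)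
    {b θ : ℝ} (hb : 0 < b) (hub : N u ≤ b) (hθ : 0 < θ) :
    flatMeasure H {z | z ∈ K ∧ N z ≤ 1 ∧ |ℓ z| < θ} ≤
      ENNReal.ofReal (2 ^ Module.finrank ℝ H * (2 * θ * b / |ℓ u|)) *
        flatMeasure H {z | z ∈ K ∧ N z ≤ 1} := by
  have hNm : Measurable N := (LinearMap.continuous_of_finiteDimensional N).measurable
  have hℓm : Measurable ℓ := (LinearMap.continuous_of_finiteDimensional ℓ).measurable
  -- Translation by `η • u` moves `ℓ` by `2θ`, so the translates of the thin region by multiples of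
  -- it are disjoint. With `m` maximal such that `m * η * b ≤ 1`, all `m + 1` of them lie in the
  -- truncation at level two, whose measure is `2 ^ finrank` times that at level one.
  set η : ℝ := 2 * θ / |ℓ u| with hη
  have hℓu : 0 < |ℓ u| := abs_pos.2 hℓ
  have hη0 : 0 < η := by positivity
  set m : ℕ := ⌊1 / (η * b)⌋₊ with hm
  have hm1 : m * (η * b) ≤ 1 := by
    rw [← le_div_iff₀ (by positivity)]
    exact Nat.floor_le (by positivity)
  have hm2 : 1 ≤ (m + 1 : ℝ) * (η * b) := by
    rw [← div_le_iff₀ (by positivity)]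
    exact (Nat.lt_floor_add_one _).le
  set Bad : Set (Fin d → ℝ) := {z | z ∈ K ∧ N z ≤ 1 ∧ |ℓ z| < θ} with hBad
  have hBm : MeasurableSet Bad := hKm.inter ((measurableSet_le hNm measurable_const).inter
    (measurableSet_lt (continuous_abs.measurable.comp hℓm) measurable_const))
  have hdisj : Set.PairwiseDisjoint (↑(Finset.range (m + 1)))
      fun j : ℕ => (fun z => z - ((j : ℝ) * η) • u) ⁻¹' Bad := by
    intro i _ j _ hij
    rw [Function.onFun, Set.disjoint_left]
    rintro z ⟨-, -, h1⟩ ⟨-, -, h2⟩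
    rw [map_sub, map_smul, smul_eq_mul, abs_lt] at h1 h2
    have h3 : |((i : ℝ) - j) * (η * ℓ u)| < 2 * θ := by
      rw [abs_lt]; constructor <;> nlinarith
    rw [abs_mul, abs_mul, abs_of_pos hη0, hη, div_mul_cancel₀ _ hℓu.ne'] at h3
    have h4 : (1 : ℝ) ≤ |(i : ℝ) - j| := by
      have : (1 : ℤ) ≤ |(i : ℤ) - j| := Int.one_le_abs (sub_ne_zero.2 (by exact_mod_cast hij))
      exact_mod_cast this
    nlinarith
  have hsub : (⋃ j ∈ Finset.range (m + 1), (fun z => z - ((j : ℝ) * η) • u) ⁻¹' Bad) ⊆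
      (fun z : Fin d → ℝ => (2⁻¹ : ℝ) • z) ⁻¹' {z | z ∈ K ∧ N z ≤ 1} := by
    intro z hz
    simp only [Set.mem_iUnion, Finset.mem_range] at hz
    obtain ⟨j, hj, hzK, hzN, -⟩ := hz
    have hzeq : z = (z - ((j : ℝ) * η) • u) + ((j : ℝ) * η) • u := by simp
    constructor
    · refine hsmul _ (by norm_num) _ ?_
      rcases Nat.eq_zero_or_pos j with rfl | hj0
      · simpa using hzK
      · rw [hzeq]
        exact hadd _ hzK _ (hsmul _ (by positivity) _ huK)
    · rw [map_smul, smul_eq_mul]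
      rw [map_sub, map_smul, smul_eq_mul] at hzN
      have h1 : (j : ℝ) * η * N u ≤ j * η * b := by gcongr
      have h2 : (j : ℝ) * η * b ≤ m * (η * b) := by
        rw [mul_assoc]
        have : (j : ℝ) ≤ m := by exact_mod_cast Nat.lt_succ_iff.1 hj
        gcongr
      linarith
  have hKN : MeasurableSet {z | z ∈ K ∧ N z ≤ 1} :=
    hKm.inter (measurableSet_le hNm measurable_const)
  have hle := measure_mono (μ := flatMeasure H) hsub
  rw [measure_biUnion_finset hdisj fun j _ => (measurable_id.sub_const _) hBm,
    flatMeasure_preimage_smul (by norm_num) hKN] at hle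
  rw [Finset.sum_congr rfl fun j _ => flatMeasure_preimage_sub (H.smul_mem _ huH) hBm,
    Finset.sum_const, Finset.card_range, nsmul_eq_mul, inv_pow, inv_inv] at hle
  calc flatMeasure H Bad = 1 * flatMeasure H Bad := (one_mul _).symm
    _ ≤ (ENNReal.ofReal (η * b) * (m + 1 : ℕ)) * flatMeasure H Bad := by
        gcongr
        rw [← ENNReal.ofReal_natCast, ← ENNReal.ofReal_mul (by positivity), ← ENNReal.ofReal_one]
        refine ENNReal.ofReal_le_ofReal ?_
        push_cast
        linarith
    _ = ENNReal.ofReal (η * b) * ((m + 1 : ℕ) * flatMeasure H Bad) := mul_assoc _ _ _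
    _ ≤ ENNReal.ofReal (η * b) * (ENNReal.ofReal (2 ^ Module.finrank ℝ H) *
          flatMeasure H {z | z ∈ K ∧ N z ≤ 1}) := by gcongr
    _ = _ := by
        rw [← mul_assoc, ← ENNReal.ofReal_mul (by positivity)]
        congr 2
        rw [hη]; ring

end Flat

end RauzyInduction

end

/-! ### Paths, their cylinders, and generic widths. -/

noncomputable section

namespace RauzyInduction

open Rows

variable {d : ℕ}

/-! ### Cylinders -/

/-- The change of widths in a split, as a linear equivalence. -/
def splitEquiv (a c : Fin d) : (Fin d → ℝ) ≃ₗ[ℝ] (Fin d → ℝ) :=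
  if h : a ≠ c then
    { toFun := unsplit a c
      map_add' := fun x y => by
        ext z; simp only [unsplit_apply, Pi.add_apply]; split_ifs <;> ring
      map_smul' := fun s x => by
        ext z; simp only [unsplit_apply, Pi.smul_apply, smul_eq_mul, RingHom.id_apply]
        split_ifs <;> ring
      invFun := fun x => splitWidths x a c
      left_inv := splitWidths_unsplit h
      right_inv := unsplit_splitWidths h }
  else LinearEquiv.refl ℝ _

theorem splitEquiv_apply {a c : Fin d} (h : a ≠ c) (y : Fin d → ℝ) :
    splitEquiv a c y = unsplit a c y := by
  simp [splitEquiv, h]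

theorem splitEquiv_symm_apply {a c : Fin d} (h : a ≠ c) (y : Fin d → ℝ) :
    (splitEquiv a c).symm y = splitWidths y a c := by
  rw [LinearEquiv.symm_apply_eq, splitEquiv_apply h, unsplit_splitWidths h]

/-- A type together with the linear map from its widths to the initial ones. -/
abbrev PathState (d : ℕ) : Type := Rows d × ((Fin d → ℝ) ≃ₗ[ℝ] (Fin d → ℝ))

/-- One split. -/
def stepState (β : Bool) : PathState d → Option (PathState d)
  | (⟨a :: t, c :: b⟩, Q) =>
    if a = c then none
    else some (if β then (topSplit a t c b, (splitEquiv a c).trans Q)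
      else (botSplit a t c b, (splitEquiv c a).trans Q))
  | _ => none

theorem stepState_eq_some {β : Bool} {π π' : Rows d} {Q Q' : (Fin d → ℝ) ≃ₗ[ℝ] (Fin d → ℝ)} :
    stepState β (π, Q) = some (π', Q') ↔
      ∃ a c, Split β π π' a c ∧ Q' = (splitEquiv a c).trans Q := by
  constructor
  · rcases π with ⟨_ | ⟨a, t⟩, _ | ⟨c, b⟩⟩ <;> simp only [stepState, reduceCtorEq, false_imp_iff]
    by_cases h : a = c
    · simp [h]
    · rcases β with _ | _
      · simp only [h, if_false, Option.some.injEq, Bool.false_eq_true, Prod.mk.injEq]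
        rintro ⟨rfl, rfl⟩
        exact ⟨c, a, Split.bot a t c b h, rfl⟩
      · simp only [h, if_false, Option.some.injEq, if_true, Prod.mk.injEq]
        rintro ⟨rfl, rfl⟩
        exact ⟨a, c, Split.top a t c b h, rfl⟩
  · rintro ⟨a, c, h, rfl⟩
    cases h with
    | top a t c b h => simp [stepState, h]
    | bot _ _ _ _ h => simp [stepState, h]

/-- The type reached by a path, encoded by a word whose head is the last step. -/
def state (π₀ : Rows d) : List Bool → Option (PathState d)
  | [] => some (π₀, LinearEquiv.refl ℝ _)
  | β :: w => (state π₀ w).bind (stepState β)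

theorem state_cons {π₀ : Rows d} {β : Bool} {w : List Bool} {π' : Rows d}
    {Q' : (Fin d → ℝ) ≃ₗ[ℝ] (Fin d → ℝ)} :
    state π₀ (β :: w) = some (π', Q') ↔ ∃ π Q a c, state π₀ w = some (π, Q) ∧
      Split β π π' a c ∧ Q' = (splitEquiv a c).trans Q := by
  rw [state, Option.bind_eq_some_iff]
  constructor
  · rintro ⟨⟨π, Q⟩, h1, h2⟩
    obtain ⟨a, c, h3, h4⟩ := stepState_eq_some.1 h2
    exact ⟨π, Q, a, c, h1, h3, h4⟩
  · rintro ⟨π, Q, a, c, h1, h3, h4⟩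
    exact ⟨_, h1, stepState_eq_some.2 ⟨a, c, h3, h4⟩⟩

/-- The widths that follow a given path. -/
def cyl (π₀ : Rows d) (w : List Bool) : Set (Fin d → ℝ) :=
  {x | ∃ π Q, state π₀ w = some (π, Q) ∧ Q.symm x ∈ π.posCone}

theorem mem_cyl_iff {π₀ : Rows d} {w : List Bool} {π : Rows d}
    {Q : (Fin d → ℝ) ≃ₗ[ℝ] (Fin d → ℝ)} (h : state π₀ w = some (π, Q)) (x : Fin d → ℝ) :
    x ∈ cyl π₀ w ↔ Q.symm x ∈ π.posCone := by
  constructor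
  · rintro ⟨π', Q', h', hx⟩
    rw [h] at h'
    cases h'
    exact hx
  · exact fun hx => ⟨π, Q, h, hx⟩

/-- The hyperplane of the switch condition. -/
def switchSpace (π : Rows d) : Submodule ℝ (Fin d → ℝ) :=
  LinearMap.ker (∑ a, π.excess a • LinearMap.proj a : (Fin d → ℝ) →ₗ[ℝ] ℝ)

theorem mem_switchSpace {π : Rows d} {x : Fin d → ℝ} : x ∈ switchSpace π ↔ π.Switch x := by
  simp [switchSpace, switch_iff]

theorem posCone_subset_switchSpace {π : Rows d} {x : Fin d → ℝ} (h : x ∈ π.posCone) :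
    x ∈ switchSpace π := mem_switchSpace.2 h.2

theorem state_switch {π₀ : Rows d} {w : List Bool} {π : Rows d}
    {Q : (Fin d → ℝ) ≃ₗ[ℝ] (Fin d → ℝ)} (h : state π₀ w = some (π, Q)) (y : Fin d → ℝ) :
    π₀.Switch (Q y) ↔ π.Switch y := by
  induction w generalizing π Q y with
  | nil => cases h; rfl
  | cons β w ih =>
    obtain ⟨π', Q', a, c, h1, h2, rfl⟩ := state_cons.1 h
    rw [LinearEquiv.trans_apply, ih h1, splitEquiv_apply h2.ne, h2.switch_iff]

theorem map_switchSpace {π₀ : Rows d} {w : List Bool} {π : Rows d}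
    {Q : (Fin d → ℝ) ≃ₗ[ℝ] (Fin d → ℝ)} (h : state π₀ w = some (π, Q)) :
    (switchSpace π).map (Q : (Fin d → ℝ) →ₗ[ℝ] (Fin d → ℝ)) = switchSpace π₀ := by
  ext x
  rw [Submodule.mem_map_equiv, mem_switchSpace, mem_switchSpace, ← state_switch h,
    Q.apply_symm_apply]

theorem cyl_cons_subset {π₀ : Rows d} (β : Bool) (w : List Bool) :
    cyl π₀ (β :: w) ⊆ cyl π₀ w := by
  rintro x ⟨π, Q, h, hx⟩
  obtain ⟨π', Q', a, c, h1, h2, rfl⟩ := state_cons.1 h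
  refine ⟨π', Q', h1, ?_⟩
  have := h2.unsplit_mem_posCone hx
  rwa [← splitEquiv_apply h2.ne, LinearEquiv.symm_trans_apply, LinearEquiv.apply_symm_apply] at this

theorem cyl_subset_of_suffix {π₀ : Rows d} {u w : List Bool} (h : u <:+ w) :
    cyl π₀ w ⊆ cyl π₀ u := by
  obtain ⟨v, rfl⟩ := h
  induction v with
  | nil => exact subset_rfl
  | cons β v ih => exact (cyl_cons_subset β _).trans ih

theorem cyl_nil (π₀ : Rows d) : cyl π₀ [] = π₀.posCone := by
  ext x; rw [mem_cyl_iff rfl]; rfl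

theorem cyl_subset_posCone (π₀ : Rows d) (w : List Bool) : cyl π₀ w ⊆ π₀.posCone :=
  cyl_nil π₀ ▸ cyl_subset_of_suffix (List.nil_suffix)

/-- The winner of a split is strictly wider than the loser, so the widths determine each letter of
the path. -/
theorem eq_of_mem_cyl {π₀ : Rows d} {x : Fin d → ℝ} {w w' : List Bool}
    (hl : w.length = w'.length) (h : x ∈ cyl π₀ w) (h' : x ∈ cyl π₀ w') : w = w' := by
  induction w generalizing w' with
  | nil => exact (List.length_eq_zero_iff.1 hl.symm).symm
  | cons β w ih =>
    rcases w' with _ | ⟨β', w'⟩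
    · simp at hl
    obtain rfl := ih (by simpa using hl) (cyl_cons_subset _ _ h) (cyl_cons_subset _ _ h')
    obtain ⟨π, Q, h1, hx⟩ := h
    obtain ⟨π', Q', h1', hx'⟩ := h'
    obtain ⟨ρ, P, a, c, h2, h3, rfl⟩ := state_cons.1 h1
    obtain ⟨ρ', P', a', c', h2', h3', rfl⟩ := state_cons.1 h1'
    rw [h2] at h2'
    cases h2'
    rw [LinearEquiv.symm_trans_apply, splitEquiv_symm_apply h3.ne] at hx
    rw [LinearEquiv.symm_trans_apply, splitEquiv_symm_apply h3'.ne] at hx'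
    have e1 := hx.1 a
    have e2 := hx'.1 a'
    simp only [splitWidths, Function.update_self, sub_pos] at e1 e2
    congr 1
    cases h3 <;> cases h3' <;> first | rfl | exact absurd e1 (not_lt.2 e2.le)

/-- The words of a set none of whose proper initial paths belong to the set. -/
def minWords (F : Set (List Bool)) : Set (List Bool) := {w | w ∈ F ∧ ∀ u, u <:+ w → u ∈ F → u = w}

/-- Words whose cylinders meet are comparable: the initial path of the longer one, of the length of
the shorter, must be the shorter one. Minimality then makes them equal. -/
theorem pairwiseDisjoint_cyl (π₀ : Rows d) (F : Set (List Bool)) :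
    (minWords F).PairwiseDisjoint (cyl π₀) := by
  have key : ∀ w ∈ minWords F, ∀ w' ∈ minWords F, w.length ≤ w'.length →
      ∀ x, x ∈ cyl π₀ w → x ∈ cyl π₀ w' → w = w' := by
    intro w hw w' hw' hle x hx hx'
    set u := w'.drop (w'.length - w.length)
    have hu : u <:+ w' := List.drop_suffix _ _
    have hlen : w.length = u.length := by simp [u]; omega
    have := eq_of_mem_cyl hlen hx (cyl_subset_of_suffix hu hx')
    exact hw'.2 w (this ▸ hu) hw.1
  intro w hw w' hw' hne
  rw [Function.onFun, Set.disjoint_left]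
  intro x hx hx'
  rcases le_total w.length w'.length with h | h
  · exact hne (key w hw w' hw' h x hx hx')
  · exact hne (key w' hw' w hw h x hx' hx).symm

theorem exists_minWords {F : Set (List Bool)} {w : List Bool} (hw : w ∈ F) :
    ∃ u ∈ minWords F, u <:+ w := by
  induction hn : w.length using Nat.strong_induction_on generalizing w with
  | _ n ih =>
    by_cases h : ∀ u, u <:+ w → u ∈ F → u = w
    · exact ⟨w, ⟨hw, h⟩, List.suffix_rfl⟩
    · push Not at h
      obtain ⟨u, hu, huF, hne⟩ := h
      have hlt : u.length < n := by
        rw [← hn]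
        exact lt_of_le_of_ne hu.length_le fun h => hne (hu.eq_of_length h)
      obtain ⟨v, hv, hvu⟩ := ih _ hlt huF rfl
      exact ⟨v, hv, hvu.trans hu⟩

/-- The difference of two widths. -/
def diffForm (a c : Fin d) : (Fin d → ℝ) →ₗ[ℝ] ℝ where
  toFun x := x a - x c
  map_add' x y := by simp only [Pi.add_apply]; ring
  map_smul' r x := by simp only [Pi.smul_apply, smul_eq_mul, RingHom.id_apply]; ring

/-! ### Families of types that are closed under splits -/

/-- A finite family of admissible types, closed under splits. -/
structure IsSplitClosed (𝒢 : Set (Rows d)) : Prop where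
  finite : 𝒢.Finite
  admissible : ∀ π ∈ 𝒢, π.Admissible
  closed : ∀ π ∈ 𝒢, ∀ β π' a c, Split β π π' a c → π'.posCone.Nonempty → π' ∈ 𝒢
  exists_ne : ∀ π ∈ 𝒢, ∃ a t c b, π = ⟨a :: t, c :: b⟩ ∧ ∃ u ∈ π.posCone, u a ≠ u c

section Family

variable {𝒢 : Set (Rows d)} (h𝒢 : IsSplitClosed 𝒢) {π₀ : Rows d} (hπ₀ : π₀ ∈ 𝒢)

include h𝒢 hπ₀

theorem IsSplitClosed.mem_of_state {w : List Bool} {π : Rows d}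
    {Q : (Fin d → ℝ) ≃ₗ[ℝ] (Fin d → ℝ)} (h : state π₀ w = some (π, Q))
    (hne : π.posCone.Nonempty) : π ∈ 𝒢 := by
  induction w generalizing π Q with
  | nil => cases h; exact hπ₀
  | cons β w ih =>
    obtain ⟨π', Q', a, c, h1, h2, rfl⟩ := state_cons.1 h
    obtain ⟨y, hy⟩ := hne
    exact h𝒢.closed π' (ih h1 ⟨_, h2.unsplit_mem_posCone hy⟩) _ _ _ _ h2 ⟨y, hy⟩

/-- The widths with an infinite expansion. -/
def generic (π₀ : Rows d) : Set (Fin d → ℝ) := {x | ∀ n, ∃ w : List Bool, w.length = n ∧ x ∈ cyl π₀ w}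

/-- An expansion stops only when the two critical widths agree. By `exists_ne` this is a proper
subspace of the switch hyperplane. -/
theorem IsSplitClosed.measure_terminal (w : List Bool) :
    flatMeasure (switchSpace π₀) {x | x ∈ cyl π₀ w ∧ ∀ β, x ∉ cyl π₀ (β :: w)} = 0 := by
  rcases hs : state π₀ w with _ | ⟨π, Q⟩
  · convert measure_empty (μ := flatMeasure (switchSpace π₀))
    refine Set.eq_empty_of_forall_notMem ?_
    rintro x ⟨⟨π, Q, h, -⟩, -⟩
    rw [hs] at h; cases h
  by_cases hne : π.posCone.Nonempty
  · obtain ⟨a, t, c, b, hπ, u, hu, huac⟩ := h𝒢.exists_ne π (h𝒢.mem_of_state hπ₀ hs hne)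
    have hac : a ≠ c := by rintro rfl; exact huac rfl
    have hker := flatMeasure_ker (H := switchSpace π₀) (ℓ := diffForm a c ∘ₗ (Q.symm : (Fin d → ℝ) →ₗ[ℝ] (Fin d → ℝ)))
      ⟨Q u, mem_switchSpace.2 ((state_switch hs u).2 hu.2), by simpa [diffForm, sub_eq_zero] using huac⟩
    refine measure_mono_null ?_ hker
    · rintro x ⟨hx, hx'⟩
      rw [mem_cyl_iff hs] at hx
      by_contra hcon
      simp only [Set.mem_ofPred_eq, LinearMap.coe_comp, Function.comp_apply, LinearEquiv.coe_coe,
        diffForm, LinearMap.coe_mk, AddHom.coe_mk, sub_eq_zero] at hcon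
      subst hπ
      rcases lt_or_gt_of_ne hcon with hlt | hlt
      · have hsp := Split.bot a t c b hac
        refine hx' false ⟨_, _, state_cons.2 ⟨_, _, _, _, hs, hsp, rfl⟩, ?_⟩
        rw [LinearEquiv.symm_trans_apply, splitEquiv_symm_apply hsp.ne]
        exact hsp.splitWidths_mem_posCone hx hlt
      · have hsp := Split.top a t c b hac
        refine hx' true ⟨_, _, state_cons.2 ⟨_, _, _, _, hs, hsp, rfl⟩, ?_⟩
        rw [LinearEquiv.symm_trans_apply, splitEquiv_symm_apply hsp.ne]
        exact hsp.splitWidths_mem_posCone hx hlt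
  · convert measure_empty (μ := flatMeasure (switchSpace π₀))
    refine Set.eq_empty_of_forall_notMem ?_
    rintro x ⟨hx, -⟩
    exact hne ⟨_, (mem_cyl_iff hs x).1 hx⟩

theorem IsSplitClosed.measure_diff_generic :
    flatMeasure (switchSpace π₀) (π₀.posCone \ generic π₀) = 0 := by
  refine measure_mono_null (t := ⋃ w : List Bool, {x | x ∈ cyl π₀ w ∧ ∀ β, x ∉ cyl π₀ (β :: w)}) ?_
    (measure_iUnion_null fun w => h𝒢.measure_terminal hπ₀ w)
  rintro x ⟨hx, hg⟩
  by_contra hcon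
  simp only [Set.mem_iUnion, Set.mem_ofPred_eq, not_exists, not_and, not_forall, not_not] at hcon
  refine hg fun n => ?_
  induction n with
  | zero => exact ⟨[], rfl, cyl_nil π₀ ▸ hx⟩
  | succ n ih =>
    obtain ⟨w, hw, hxw⟩ := ih
    obtain ⟨β, hβ⟩ := hcon w hxw
    exact ⟨β :: w, by simp [hw], hβ⟩

/-- The coefficients of the total width. -/
def weight (Q : (Fin d → ℝ) ≃ₗ[ℝ] (Fin d → ℝ)) (a : Fin d) : ℝ := ∑ i, Q (Pi.single a 1) i

omit h𝒢 hπ₀ in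
-- A split adds the column of the winner to that of the loser. Every linear form in the initial
-- widths thus yields a sequence satisfying `Run.IsAcc`.
theorem map_single_splitEquiv {a c : Fin d} (h : a ≠ c) (φ : (Fin d → ℝ) →ₗ[ℝ] ℝ) (z : Fin d) :
    φ (splitEquiv a c (Pi.single z 1)) =
      φ (Pi.single z 1) + if z = c then φ (Pi.single a 1) else 0 := by
  have : splitEquiv a c (Pi.single z 1) =
      Pi.single z 1 + if z = c then (Pi.single a 1 : Fin d → ℝ) else 0 := by
    rw [splitEquiv_apply h]
    ext i
    rw [unsplit_apply]
    by_cases hz : z = c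
    · subst hz; simp [Pi.single_apply]
    · simp [Pi.single_apply, hz, Ne.symm hz]
  rw [this, map_add]
  split_ifs <;> simp

/-- The splitting sequence of generic widths. -/
theorem IsSplitClosed.exists_run {x : Fin d → ℝ} (hx : x ∈ generic π₀) (hx1 : ∑ a, x a = 1) :
    ∃ (r : Run d) (w : ℕ → List Bool) (Q : ℕ → ((Fin d → ℝ) ≃ₗ[ℝ] (Fin d → ℝ))),
      (∀ n, (w n).length = n) ∧ (∀ m n, m ≤ n → w m <:+ w n) ∧
      (∀ n, state π₀ (w n) = some (r.rows n, Q n)) ∧ (∀ n, x ∈ cyl π₀ (w n)) ∧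
      (∀ n, r.wid n = (Q n).symm x) ∧ (∀ n a, r.wt n a = weight (Q n) a) ∧
      ∀ φ : (Fin d → ℝ) →ₗ[ℝ] ℝ, r.IsAcc fun n z => φ (Q n (Pi.single z 1)) := by
  choose w hwl hxw using hx
  have hcons : ∀ n, ∃ β, w (n + 1) = β :: w n := by
    intro n
    rcases hw : w (n + 1) with _ | ⟨β, u⟩
    · have := hwl (n + 1); simp [hw] at this
    · refine ⟨β, ?_⟩
      have h1 := hwl (n + 1)
      have h2 := hxw (n + 1)
      rw [hw] at h1 h2
      rw [eq_of_mem_cyl (w := u) (w' := w n) (by rw [hwl]; simpa using h1)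
        (cyl_cons_subset _ _ h2) (hxw n)]
  choose code hcode using hcons
  have hst : ∀ n, ∃ π Q, state π₀ (w n) = some (π, Q) ∧ Q.symm x ∈ π.posCone := hxw
  choose rows Q hstate hmem using hst
  have hsplit : ∀ n, ∃ a c, Split (code n) (rows n) (rows (n + 1)) a c ∧
      Q (n + 1) = (splitEquiv a c).trans (Q n) := by
    intro n
    have h1 := hstate (n + 1)
    rw [hcode] at h1
    obtain ⟨π, P, a, c, h2, h3, h4⟩ := state_cons.1 h1
    rw [hstate n] at h2
    cases h2
    exact ⟨a, c, h3, h4⟩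
  choose win lose hsp hQ using hsplit
  have hw0 : w 0 = [] := List.length_eq_zero_iff.1 (hwl 0)
  have hQ0 : Q 0 = LinearEquiv.refl ℝ _ := by
    have := hstate 0
    rw [hw0] at this
    exact (Prod.mk.inj (Option.some.inj this)).2.symm
  let r : Run d :=
    { rows := rows
      wid := fun n => (Q n).symm x
      code := code
      win := win
      lose := lose
      split := hsp
      mem := hmem
      wid_succ := fun n => by
        rw [hQ, LinearEquiv.symm_trans_apply, splitEquiv_symm_apply (hsp n).ne]
      adm := fun n => h𝒢.admissible _ (h𝒢.mem_of_state hπ₀ (hstate n) ⟨_, hmem n⟩)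
      sum_zero := by rw [hQ0]; simpa using hx1 }
  have hacc : ∀ φ : (Fin d → ℝ) →ₗ[ℝ] ℝ, r.IsAcc fun n z => φ (Q n (Pi.single z 1)) := by
    intro φ n z
    have := map_single_splitEquiv (hsp n).ne
      (φ ∘ₗ (Q n : (Fin d → ℝ) →ₗ[ℝ] (Fin d → ℝ))) z
    simp only [hQ, LinearEquiv.trans_apply]
    exact this
  refine ⟨r, w, Q, hwl, ?_, hstate, hxw, fun n => rfl, ?_, hacc⟩
  · intro m n hmn
    induction n, hmn using Nat.le_induction with
    | base => exact List.suffix_rfl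
    | succ n _ ih => rw [hcode]; exact ih.trans (List.suffix_cons _ _)
  · intro n
    induction n with
    | zero => intro a; simp [Run.wt, weight, hQ0]
    | succ n ih =>
      intro a
      have h1 := hacc (∑ i, LinearMap.proj i) n a
      have h2 : ∀ Q : (Fin d → ℝ) ≃ₗ[ℝ] (Fin d → ℝ), ∀ z,
          (∑ i, LinearMap.proj i : (Fin d → ℝ) →ₗ[ℝ] ℝ) (Q (Pi.single z 1)) = weight Q z := by
        intro Q z; simp [weight]
      simp only [h2] at h1
      rw [h1, r.isAcc_wt, ih, ih]

end Family

end RauzyInduction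

end

/-! ### A finite measure on directions, and stopping words. -/

noncomputable section

namespace RauzyInduction

open Rows

variable {d : ℕ}

/-! ### The measure on directions -/

/-- Invariance under positive scaling. -/
def IsConic (S : Set (Fin d → ℝ)) : Prop := ∀ r : ℝ, 0 < r → ∀ x, r • x ∈ S ↔ x ∈ S

theorem smul_mem_posCone {π : Rows d} {r : ℝ} (hr : 0 < r) {x : Fin d → ℝ} (hx : x ∈ π.posCone) :
    r • x ∈ π.posCone := by
  refine ⟨fun a => mul_pos hr (hx.1 a), ?_⟩
  have := (switchSpace π).smul_mem r (posCone_subset_switchSpace hx)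
  exact mem_switchSpace.1 this

theorem add_mem_posCone {π : Rows d} {x y : Fin d → ℝ} (hx : x ∈ π.posCone) (hy : y ∈ π.posCone) :
    x + y ∈ π.posCone := by
  refine ⟨fun a => add_pos (hx.1 a) (hy.1 a), ?_⟩
  exact mem_switchSpace.1
    ((switchSpace π).add_mem (posCone_subset_switchSpace hx) (posCone_subset_switchSpace hy))

theorem isConic_of_smul_mem {S : Set (Fin d → ℝ)} (h : ∀ r : ℝ, 0 < r → ∀ x ∈ S, r • x ∈ S) :
    IsConic S := by
  intro r hr x
  refine ⟨fun hx => ?_, h r hr x⟩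
  have := h r⁻¹ (inv_pos.2 hr) _ hx
  rwa [inv_smul_smul₀ hr.ne'] at this

theorem isConic_posCone (π : Rows d) : IsConic π.posCone :=
  isConic_of_smul_mem fun _ hr _ => smul_mem_posCone hr

theorem isConic_cyl (π₀ : Rows d) (w : List Bool) : IsConic (cyl π₀ w) := by
  refine isConic_of_smul_mem fun r hr x => ?_
  rintro ⟨π, Q, h, hx⟩
  exact ⟨π, Q, h, by rw [map_smul]; exact smul_mem_posCone hr hx⟩

theorem add_mem_cyl {π₀ : Rows d} {w : List Bool} {x y : Fin d → ℝ} (hx : x ∈ cyl π₀ w)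
    (hy : y ∈ cyl π₀ w) : x + y ∈ cyl π₀ w := by
  obtain ⟨π, Q, h, hx⟩ := hx
  rw [mem_cyl_iff h] at hy ⊢
  rw [map_add]
  exact add_mem_posCone hx hy

theorem measurableSet_posCone (π : Rows d) : MeasurableSet π.posCone := by
  have : π.posCone = (⋂ a, {x | 0 < x a}) ∩ (switchSpace π : Set (Fin d → ℝ)) := by
    ext x; simp [posCone, mem_switchSpace]
  rw [this]
  exact (MeasurableSet.iInter fun a => measurableSet_lt measurable_const (measurable_pi_apply a)).inter
    (Submodule.closed_of_finiteDimensional _).measurableSet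

theorem measurable_linearEquiv (Q : (Fin d → ℝ) ≃ₗ[ℝ] (Fin d → ℝ)) : Measurable Q :=
  (LinearMap.continuous_of_finiteDimensional (Q : (Fin d → ℝ) →ₗ[ℝ] (Fin d → ℝ))).measurable

theorem measurable_linearForm (ℓ : (Fin d → ℝ) →ₗ[ℝ] ℝ) : Measurable ℓ :=
  (LinearMap.continuous_of_finiteDimensional ℓ).measurable

theorem measurableSet_cyl (π₀ : Rows d) (w : List Bool) : MeasurableSet (cyl π₀ w) := by
  rcases h : state π₀ w with _ | ⟨π, Q⟩
  · have : cyl π₀ w = ∅ := by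
      refine Set.eq_empty_of_forall_notMem ?_
      rintro x ⟨π, Q, h', -⟩
      rw [h] at h'; cases h'
    rw [this]; exact MeasurableSet.empty
  · have : cyl π₀ w = Q.symm ⁻¹' π.posCone := by ext x; exact mem_cyl_iff h x
    rw [this]
    exact measurable_linearEquiv _ (measurableSet_posCone π)

/-- The total width. -/
def total : (Fin d → ℝ) →ₗ[ℝ] ℝ := ∑ a, LinearMap.proj a

@[simp] theorem total_apply (x : Fin d → ℝ) : total x = ∑ a, x a := by simp [total]

/-- Positive widths of total width at most one. -/
def slice (π : Rows d) : Set (Fin d → ℝ) := {x | x ∈ π.posCone ∧ total x ≤ 1}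

theorem measurableSet_slice (π : Rows d) : MeasurableSet (slice π) :=
  (measurableSet_posCone π).inter (measurableSet_le (measurable_linearForm _) measurable_const)

theorem total_pos (hd : 0 < d) {π : Rows d} {x : Fin d → ℝ} (hx : x ∈ π.posCone) : 0 < total x := by
  have : Nonempty (Fin d) := ⟨⟨0, hd⟩⟩
  rw [total_apply]
  exact Finset.sum_pos (fun a _ => hx.1 a) Finset.univ_nonempty

theorem flatMeasure_slice_lt_top (π : Rows d) : flatMeasure (switchSpace π) (slice π) < ⊤ := by
  refine flatMeasure_lt_top ?_ (measurableSet_slice π)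
  refine (Metric.isBounded_closedBall (x := (0 : Fin d → ℝ)) (r := 1)).subset fun x hx => ?_
  rw [mem_closedBall_zero_iff, pi_norm_le_iff_of_nonneg zero_le_one]
  intro a
  rw [Real.norm_eq_abs, abs_of_pos (hx.1.1 a)]
  refine le_trans ?_ hx.2
  rw [total_apply]
  exact Finset.single_le_sum (f := x) (fun b _ => (hx.1.1 b).le) (Finset.mem_univ a)

/-- Rescaling to total width one. -/
def direction (x : Fin d → ℝ) : Fin d → ℝ := (total x)⁻¹ • x

theorem measurable_direction : Measurable (direction (d := d)) :=
  (measurable_linearForm _).inv.smul measurable_id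

/-- The image of Lebesgue measure under rescaling to total width one. -/
def dirMeasure (π : Rows d) : Measure (Fin d → ℝ) :=
  ((flatMeasure (switchSpace π)).restrict (slice π)).map direction

instance (π : Rows d) : IsFiniteMeasure (dirMeasure π) := by
  have : IsFiniteMeasure ((flatMeasure (switchSpace π)).restrict (slice π)) :=
    ⟨by rw [restrict_apply_univ]; exact flatMeasure_slice_lt_top π⟩
  exact isFiniteMeasure_map _ _

theorem direction_mem_iff {S : Set (Fin d → ℝ)} (hS : IsConic S) (hd : 0 < d) {π : Rows d}
    {x : Fin d → ℝ} (hx : x ∈ π.posCone) : direction x ∈ S ↔ x ∈ S :=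
  hS _ (inv_pos.2 (total_pos hd hx)) x

/-- A cone is saturated for rescaling, so its measure as a set of directions is the volume of its
truncation. This lets linear maps act on it. -/
theorem dirMeasure_apply (hd : 0 < d) (π : Rows d) {S : Set (Fin d → ℝ)} (hS : IsConic S)
    (hSm : MeasurableSet S) : dirMeasure π S = flatMeasure (switchSpace π) (S ∩ slice π) := by
  rw [dirMeasure, map_apply measurable_direction hSm,
    restrict_apply (measurable_direction hSm)]
  congr 1
  ext x
  exact and_congr_left fun hx => direction_mem_iff hS hd hx.1

theorem dirMeasure_total_ne (hd : 0 < d) (π : Rows d) : dirMeasure π {x | total x ≠ 1} = 0 := by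
  have hm : MeasurableSet {x : Fin d → ℝ | total x ≠ 1} :=
    (measurableSet_eq_fun (measurable_linearForm _) measurable_const).compl
  rw [dirMeasure, map_apply measurable_direction hm, restrict_apply (measurable_direction hm)]
  convert measure_empty (μ := flatMeasure (switchSpace π))
  refine Set.eq_empty_of_forall_notMem ?_
  rintro x ⟨hx, hx'⟩
  refine hx ?_
  rw [direction, map_smul, smul_eq_mul, inv_mul_cancel₀ (total_pos hd hx'.1).ne']

theorem slice_preimage_smul {π : Rows d} {S : Set (Fin d → ℝ)} (hS : IsConic S)
    (hSp : S ⊆ π.posCone) {r : ℝ} (hr : 0 < r) :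
    (fun z : Fin d → ℝ => r • z) ⁻¹' {x | x ∈ S ∧ total x ≤ r} = S ∩ slice π := by
  ext x
  simp only [Set.mem_preimage, Set.mem_ofPred_eq, hS r hr, map_smul, smul_eq_mul]
  refine and_congr_right fun hx => ?_
  constructor
  · intro h
    refine ⟨hSp hx, ?_⟩
    by_contra! hlt
    nlinarith
  · intro h
    nlinarith [h.2]

theorem flatMeasure_total_le {π : Rows d} {S : Set (Fin d → ℝ)} (hS : IsConic S)
    (hSm : MeasurableSet S) (hSp : S ⊆ π.posCone) {r : ℝ} (hr : 0 < r) :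
    flatMeasure (switchSpace π) {x | x ∈ S ∧ total x ≤ r} =
      ENNReal.ofReal (r ^ Module.finrank ℝ (switchSpace π)) *
        flatMeasure (switchSpace π) (S ∩ slice π) := by
  have hm : MeasurableSet {x | x ∈ S ∧ total x ≤ r} :=
    hSm.inter (measurableSet_le (measurable_linearForm _) measurable_const)
  have := flatMeasure_preimage_smul (H := switchSpace π) hr hm
  rw [slice_preimage_smul hS hSp hr] at this
  rw [this, ← mul_assoc, ← ENNReal.ofReal_mul (by positivity),
    mul_inv_cancel₀ (by positivity), ENNReal.ofReal_one, one_mul]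

theorem flatMeasure_eq_zero_of_dirMeasure (hd : 0 < d) {π : Rows d} {S : Set (Fin d → ℝ)}
    (hS : IsConic S) (hSm : MeasurableSet S) (hSp : S ⊆ π.posCone) (h : dirMeasure π S = 0) :
    flatMeasure (switchSpace π) S = 0 := by
  rw [dirMeasure_apply hd π hS hSm] at h
  refine measure_mono_null (t := ⋃ n : ℕ, {x | x ∈ S ∧ total x ≤ (n : ℝ) + 1}) ?_
    (measure_iUnion_null fun n => ?_)
  · intro x hx
    obtain ⟨n, hn⟩ := exists_nat_ge (total x)
    exact Set.mem_iUnion.2 ⟨n, hx, by linarith⟩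
  · rw [flatMeasure_total_le hS hSm hSp (by positivity), h, mul_zero]

theorem flatMeasure_slice_ne_zero (hd : 0 < d) {π : Rows d} {S : Set (Fin d → ℝ)}
    (hS : IsConic S) (hSm : MeasurableSet S) (hSp : S ⊆ π.posCone)
    (h : flatMeasure (switchSpace π) S ≠ 0) : flatMeasure (switchSpace π) (S ∩ slice π) ≠ 0 := by
  rw [← dirMeasure_apply hd π hS hSm]
  exact fun h' => h (flatMeasure_eq_zero_of_dirMeasure hd hS hSm hSp h')

/-! ### Coefficients of paths -/

theorem weight_cons {Q : (Fin d → ℝ) ≃ₗ[ℝ] (Fin d → ℝ)} {a c : Fin d} (h : a ≠ c) (z : Fin d) :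
    weight ((splitEquiv a c).trans Q) z = weight Q z + if z = c then weight Q a else 0 := by
  have := map_single_splitEquiv h (total ∘ₗ (Q : (Fin d → ℝ) →ₗ[ℝ] (Fin d → ℝ))) z
  simpa [weight] using this

theorem one_le_weight {π₀ : Rows d} {w : List Bool} {π : Rows d}
    {Q : (Fin d → ℝ) ≃ₗ[ℝ] (Fin d → ℝ)} (h : state π₀ w = some (π, Q)) (a : Fin d) :
    1 ≤ weight Q a := by
  induction w generalizing π Q a with
  | nil => cases h; simp [weight]
  | cons β w ih =>
    obtain ⟨π', Q', b, c, h1, h2, rfl⟩ := state_cons.1 h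
    rw [weight_cons h2.ne]
    have h3 := ih h1 a
    have h4 := ih h1 b
    split_ifs <;> linarith

theorem apply_eq_sum_single (φ : (Fin d → ℝ) →ₗ[ℝ] ℝ) (y : Fin d → ℝ) :
    φ y = ∑ a, φ (Pi.single a 1) * y a := by
  conv_lhs => rw [LinearMap.pi_apply_eq_sum_univ φ y]
  refine Finset.sum_congr rfl fun a _ => ?_
  rw [smul_eq_mul, mul_comm]
  congr 2
  ext j
  simp [Pi.single_apply, eq_comm]

theorem total_apply_eq (Q : (Fin d → ℝ) ≃ₗ[ℝ] (Fin d → ℝ)) (y : Fin d → ℝ) :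
    total (Q y) = ∑ a, weight Q a * y a := by
  have := apply_eq_sum_single (total ∘ₗ (Q : (Fin d → ℝ) →ₗ[ℝ] (Fin d → ℝ))) y
  simpa [weight] using this

/-- The paths along which some coefficient of the total width is at least `R`. -/
def heavyWords (π₀ : Rows d) (R : ℝ) : Set (List Bool) :=
  {w | ∃ π Q, state π₀ w = some (π, Q) ∧ ∃ a, R ≤ weight Q a}

/-- By minimality all weights were below `R` before the last split, which at most adds two of them.
-/
theorem weight_lt_of_mem_minWords {π₀ : Rows d} {R : ℝ} (hR : 1 < R) {w : List Bool}
    (hw : w ∈ minWords (heavyWords π₀ R)) {π : Rows d} {Q : (Fin d → ℝ) ≃ₗ[ℝ] (Fin d → ℝ)}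
    (h : state π₀ w = some (π, Q)) (a : Fin d) : weight Q a < 2 * R := by
  rcases w with _ | ⟨β, u⟩
  · cases h; simp only [weight, LinearEquiv.refl_apply, Finset.sum_pi_single', Finset.mem_univ, if_true]; linarith
  · obtain ⟨π', Q', b, c, h1, h2, rfl⟩ := state_cons.1 h
    have hu : ∀ z, weight Q' z < R := by
      by_contra! hcon
      have := hw.2 u (List.suffix_cons _ _) ⟨π', Q', h1, hcon⟩
      simpa using congrArg List.length this
    rw [weight_cons h2.ne]
    have h3 := hu a
    have h4 := hu b
    split_ifs <;> linarith

/-- Links the two forms of the stopping rule: the time `Run.time`, used for a single sequence, and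
the minimal heavy words, used for measure estimates. -/
theorem Run.mem_minWords {π₀ : Rows d} {r : Run d} {w : ℕ → List Bool}
    {Q : ℕ → ((Fin d → ℝ) ≃ₗ[ℝ] (Fin d → ℝ))} (hwl : ∀ n, (w n).length = n)
    (hsuf : ∀ m n, m ≤ n → w m <:+ w n) (hst : ∀ n, state π₀ (w n) = some (r.rows n, Q n))
    (hwt : ∀ n a, r.wt n a = weight (Q n) a) (R : ℝ) :
    w (r.time R) ∈ minWords (heavyWords π₀ R) := by
  constructor
  · obtain ⟨a, ha⟩ := r.time_spec R
    exact ⟨_, _, hst _, a, by rwa [← hwt]⟩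
  · rintro u hu ⟨π, Q', h1, a, ha⟩
    have hle : u.length ≤ r.time R := by simpa [hwl] using hu.length_le
    have hu' : u = w u.length :=
      (List.suffix_of_suffix_length_le hu (hsuf _ _ hle) (by rw [hwl])).eq_of_length (by rw [hwl])
    rw [hu', hst] at h1
    obtain rfl : Q u.length = Q' := (Prod.mk.inj (Option.some.inj h1)).2
    rw [← hwt] at ha
    have : ¬ u.length < r.time R := fun hlt => absurd ha (not_le.2 (Run.wt_lt_of_lt_time hlt a))
    rw [show u.length = r.time R by omega] at hu'
    exact hu'

end RauzyInduction

end

/-! ### Bad scales are rare. -/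

noncomputable section

namespace RauzyInduction

open Rows

variable {d : ℕ}

/-! ### The measure of the bad sets -/

/-- The widths that follow the path `w` and are not good at its end. -/
def badCyl (π₀ : Rows d) (θ : ℝ) (w : List Bool) : Set (Fin d → ℝ) :=
  {x | ∃ π Q, state π₀ w = some (π, Q) ∧ Q.symm x ∈ π.posCone ∧
    ¬ π.IsGood (θ * total x) (Q.symm x)}

theorem isConic_badCyl (π₀ : Rows d) (θ : ℝ) (w : List Bool) : IsConic (badCyl π₀ θ w) := by
  refine isConic_of_smul_mem fun r hr x => ?_
  rintro ⟨π, Q, h, hx, hb⟩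
  refine ⟨π, Q, h, by rw [map_smul]; exact smul_mem_posCone hr hx, fun hg => hb fun i hi => ?_⟩
  have := hg i hi
  rw [map_smul, map_smul, map_smul, smul_eq_mul, smul_eq_mul, abs_mul, abs_of_pos hr] at this
  exact le_of_mul_le_mul_left (by linarith) hr

theorem measurableSet_isGood (π : Rows d) (Q : (Fin d → ℝ) ≃ₗ[ℝ] (Fin d → ℝ)) (θ : ℝ) :
    MeasurableSet {x | π.IsGood (θ * total x) (Q.symm x)} := by
  have : {x | π.IsGood (θ * total x) (Q.symm x)} =
      ⋂ i, ⋂ _ : (∃ u ∈ π.posCone, π.testForm i u ≠ 0),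
        {x | θ * total x ≤ |π.testForm i (Q.symm x)|} := by
    ext x; simp only [IsGood, Set.mem_ofPred_eq, Set.mem_iInter]
  rw [this]
  refine MeasurableSet.iInter fun i => MeasurableSet.iInter fun _ => measurableSet_le ?_ ?_
  · exact (measurable_linearForm _).const_mul _
  · exact ((measurable_linearForm (π.testForm i)).comp (measurable_linearEquiv Q.symm)).abs

theorem badCyl_eq {π₀ : Rows d} {θ : ℝ} {w : List Bool} {π : Rows d}
    {Q : (Fin d → ℝ) ≃ₗ[ℝ] (Fin d → ℝ)} (h : state π₀ w = some (π, Q)) :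
    badCyl π₀ θ w = cyl π₀ w \ {x | π.IsGood (θ * total x) (Q.symm x)} := by
  ext x
  rw [Set.mem_sdiff, mem_cyl_iff h]
  constructor
  · rintro ⟨π', Q', h', h1, h2⟩
    rw [h] at h'; cases h'
    exact ⟨h1, h2⟩
  · rintro ⟨h1, h2⟩
    exact ⟨_, _, h, h1, h2⟩

theorem measurableSet_badCyl (π₀ : Rows d) (θ : ℝ) (w : List Bool) :
    MeasurableSet (badCyl π₀ θ w) := by
  rcases h : state π₀ w with _ | ⟨π, Q⟩
  · have : badCyl π₀ θ w = ∅ := by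
      refine Set.eq_empty_of_forall_notMem ?_
      rintro x ⟨π, Q, h', -⟩
      rw [h] at h'; cases h'
    rw [this]; exact MeasurableSet.empty
  · rw [badCyl_eq h]
    exact (measurableSet_cyl π₀ w).diff (measurableSet_isGood π Q θ)

/-- The widths that are not good when the coefficients reach the scale `R`. -/
def badSet (π₀ : Rows d) (ε R : ℝ) : Set (Fin d → ℝ) :=
  ⋃ w ∈ minWords (heavyWords π₀ R), badCyl π₀ (ε / R) w

/-- Weights below `2R` bound the total width of `Q u` by `2R` times that of `u`, while the threshold
is `ε / R`. The factors `R` cancel in `flatMeasure_small_form_le`, so the bad proportion is `O(ε)`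
at every scale. -/
theorem dirMeasure_badCyl_le (hd : 0 < d) {π₀ : Rows d} {K : Fin d ⊕ Finset (Fin d) → ℝ}
    {w : List Bool} {π : Rows d} {Q : (Fin d → ℝ) ≃ₗ[ℝ] (Fin d → ℝ)}
    (h : state π₀ w = some (π, Q))
    (hK : ∀ i, (∃ u ∈ π.posCone, π.testForm i u ≠ 0) → ∃ u ∈ π.posCone, π.testForm i u ≠ 0 ∧
      2 ^ d * (4 * total u / |π.testForm i u|) ≤ K i) (hK0 : ∀ i, 0 ≤ K i)
    {ε R : ℝ} (hε : 0 < ε) (hR : 1 < R) (hw : ∀ a, weight Q a < 2 * R) :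
    dirMeasure π₀ (badCyl π₀ (ε / R) w) ≤
      ENNReal.ofReal ((∑ i, K i) * ε) * dirMeasure π₀ (cyl π₀ w) := by
  rw [dirMeasure_apply hd _ (isConic_badCyl _ _ _) (measurableSet_badCyl _ _ _),
    dirMeasure_apply hd _ (isConic_cyl _ _) (measurableSet_cyl _ _)]
  classical
  set ν := flatMeasure (switchSpace π₀)
  have hcyl : cyl π₀ w ∩ slice π₀ = {z | z ∈ cyl π₀ w ∧ total z ≤ 1} := by
    ext z
    exact ⟨fun hz => ⟨hz.1, hz.2.2⟩, fun hz => ⟨hz.1, cyl_subset_posCone _ _ hz.1, hz.2⟩⟩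
  have hR0 : 0 < R := by linarith
  have hθ : 0 < ε / R := by positivity
  have hi : ∀ i, ν (if (∃ u ∈ π.posCone, π.testForm i u ≠ 0) then
      {z | z ∈ cyl π₀ w ∧ total z ≤ 1 ∧ |π.testForm i (Q.symm z)| < ε / R} else ∅) ≤
      ENNReal.ofReal (K i * ε) * ν (cyl π₀ w ∩ slice π₀) := by
    intro i
    split_ifs with hne
    swap
    · simp
    obtain ⟨u, hu, hℓ, hle⟩ := hK i hne
    have hu0 := total_pos hd hu
    have := flatMeasure_small_form_le (H := switchSpace π₀) (measurableSet_cyl π₀ w)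
      (fun z hz y hy => add_mem_cyl hz hy) (fun r hr z hz => ((isConic_cyl π₀ w) r hr z).2 hz)
      total (π.testForm i ∘ₗ (Q.symm : (Fin d → ℝ) →ₗ[ℝ] (Fin d → ℝ))) (u := Q u)
      ((mem_cyl_iff h _).2 (by simpa using hu))
      (mem_switchSpace.2 ((state_switch h u).2 hu.2)) (by simpa using hℓ)
      (b := 2 * R * total u) (θ := ε / R) (by positivity)
      (by
        rw [total_apply_eq, total_apply, Finset.mul_sum]
        exact Finset.sum_le_sum fun a _ => mul_le_mul_of_nonneg_right (hw a).le (hu.1 a).le) hθ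
    rw [hcyl]
    refine this.trans (mul_le_mul' (ENNReal.ofReal_le_ofReal ?_) le_rfl)
    simp only [LinearMap.comp_apply, LinearEquiv.coe_coe, LinearEquiv.symm_apply_apply]
    have hk : 2 ^ Module.finrank ℝ (switchSpace π₀) ≤ (2 : ℝ) ^ d := by
      refine pow_le_pow_right₀ (by norm_num) ?_
      simpa using Submodule.finrank_le (switchSpace π₀)
    have habs : 0 < |π.testForm i u| := abs_pos.2 hℓ
    have he : 2 * (ε / R) * (2 * R * total u) / |π.testForm i u| =
        (4 * total u / |π.testForm i u|) * ε := by field_simp; ring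
    rw [he, ← mul_assoc]
    refine mul_le_mul_of_nonneg_right (le_trans ?_ hle) hε.le
    exact mul_le_mul_of_nonneg_right hk (by positivity)
  calc ν (badCyl π₀ (ε / R) w ∩ slice π₀)
      ≤ ν (⋃ i, if (∃ u ∈ π.posCone, π.testForm i u ≠ 0) then
      {z | z ∈ cyl π₀ w ∧ total z ≤ 1 ∧ |π.testForm i (Q.symm z)| < ε / R} else ∅) := by
        refine measure_mono ?_
        rintro x ⟨⟨π', Q', h', hx, hb⟩, hs⟩
        have hxc : x ∈ cyl π₀ w := ⟨π', Q', h', hx⟩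
        rw [h] at h'; cases h'
        simp only [IsGood, not_forall, not_le] at hb
        obtain ⟨i, hne, hlt⟩ := hb
        refine Set.mem_iUnion.2 ⟨i, ?_⟩
        rw [if_pos hne]
        -- The threshold in `badCyl` carries the factor `total x` to make it conic; on the slice
        -- this factor is at most one.
        refine ⟨hxc, hs.2, hlt.trans_le ?_⟩
        exact mul_le_of_le_one_right hθ.le hs.2
    _ ≤ ∑ i, ν (if (∃ u ∈ π.posCone, π.testForm i u ≠ 0) then
      {z | z ∈ cyl π₀ w ∧ total z ≤ 1 ∧ |π.testForm i (Q.symm z)| < ε / R} else ∅) :=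
        measure_iUnion_fintype_le _ _
    _ ≤ ∑ i, ENNReal.ofReal (K i * ε) * ν (cyl π₀ w ∩ slice π₀) := Finset.sum_le_sum fun i _ => hi i
    _ = ENNReal.ofReal ((∑ i, K i) * ε) * ν (cyl π₀ w ∩ slice π₀) := by
        rw [← Finset.sum_mul, ← ENNReal.ofReal_sum_of_nonneg fun i _ => mul_nonneg (hK0 i) hε.le,
          Finset.sum_mul]

/-- Finiteness of the family makes the constant uniform over end types, and the estimates add up
because minimal words have disjoint cylinders. -/
theorem IsSplitClosed.exists_dirMeasure_badSet_le {𝒢 : Set (Rows d)} (h𝒢 : IsSplitClosed 𝒢)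
    (hd : 0 < d) : ∃ K : ℝ, 0 ≤ K ∧ ∀ π₀ ∈ 𝒢, ∀ ε R : ℝ, 0 < ε → 1 < R →
      dirMeasure π₀ (badSet π₀ ε R) ≤ ENNReal.ofReal (K * ε) * dirMeasure π₀ Set.univ := by
  have h1 : ∀ (π : Rows d) i, ∃ K : ℝ, 0 ≤ K ∧ ((∃ u ∈ π.posCone, π.testForm i u ≠ 0) →
      ∃ u ∈ π.posCone, π.testForm i u ≠ 0 ∧ 2 ^ d * (4 * total u / |π.testForm i u|) ≤ K) := by
    intro π i
    by_cases h : ∃ u ∈ π.posCone, π.testForm i u ≠ 0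
    · obtain ⟨u, hu, hne⟩ := h
      have := total_pos hd hu
      exact ⟨_, by positivity, fun _ => ⟨u, hu, hne, le_rfl⟩⟩
    · exact ⟨0, le_rfl, fun h' => absurd h' h⟩
  choose K0 hK0 hK using h1
  set S := h𝒢.finite.toFinset
  refine ⟨∑ i, ∑ π ∈ S, K0 π i, Finset.sum_nonneg fun i _ => Finset.sum_nonneg fun π _ => hK0 π i, ?_⟩
  intro π₀ hπ₀ ε R hε hR
  have hw : ∀ w ∈ minWords (heavyWords π₀ R), dirMeasure π₀ (badCyl π₀ (ε / R) w) ≤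
      ENNReal.ofReal ((∑ i, ∑ π ∈ S, K0 π i) * ε) * dirMeasure π₀ (cyl π₀ w) := by
    intro w hw
    obtain ⟨π, Q, hst, -⟩ := hw.1
    by_cases hne : π.posCone.Nonempty
    · have hπS : π ∈ S := h𝒢.finite.mem_toFinset.2 (h𝒢.mem_of_state hπ₀ hst hne)
      refine dirMeasure_badCyl_le hd hst (fun i hi => ?_)
        (fun i => Finset.sum_nonneg fun π _ => hK0 π i) hε hR
        (weight_lt_of_mem_minWords hR hw hst)
      obtain ⟨u, hu, h2, h3⟩ := hK π i hi
      exact ⟨u, hu, h2, h3.trans (Finset.single_le_sum (f := fun π => K0 π i)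
        (fun π _ => hK0 π i) hπS)⟩
    · have : badCyl π₀ (ε / R) w = ∅ := by
        refine Set.eq_empty_of_forall_notMem ?_
        rintro x ⟨π', Q', h', hx, -⟩
        rw [hst] at h'; cases h'
        exact hne ⟨_, hx⟩
      simp [this]
  calc dirMeasure π₀ (badSet π₀ ε R)
      ≤ ∑' w : minWords (heavyWords π₀ R), dirMeasure π₀ (badCyl π₀ (ε / R) w) :=
        measure_biUnion_le _ (Set.to_countable _) _
    _ ≤ ∑' w : minWords (heavyWords π₀ R), ENNReal.ofReal ((∑ i, ∑ π ∈ S, K0 π i) * ε) *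
        dirMeasure π₀ (cyl π₀ w) := ENNReal.tsum_le_tsum fun w => hw w w.2
    _ = ENNReal.ofReal ((∑ i, ∑ π ∈ S, K0 π i) * ε) *
        dirMeasure π₀ (⋃ w ∈ minWords (heavyWords π₀ R), cyl π₀ w) := by
        rw [ENNReal.tsum_mul_left, measure_biUnion (Set.to_countable _)
          (pairwiseDisjoint_cyl π₀ _) fun w _ => measurableSet_cyl π₀ w]
    _ ≤ _ := by gcongr; exact Set.subset_univ _

/-- The widths that are, from some time on, bad at one of `J + 1` consecutive scales. -/
def eventuallyBad (π₀ : Rows d) (ε C : ℝ) (J : ℕ) : Set (Fin d → ℝ) :=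
  ⋃ n : ℕ, ⋂ R : ℕ, ⋂ _ : n ≤ R, ⋃ j ∈ Finset.range (J + 1), badSet π₀ ε (C ^ j * R)

/-- The intersections increase with `n`, and each lies in the union of `J + 1` bad sets for the
single value `R = max n 2`. Continuity from below keeps the bound. -/
theorem dirMeasure_eventuallyBad_le {π₀ : Rows d} {K ε C : ℝ} (hC : 1 ≤ C) (J : ℕ)
    (h : ∀ R : ℝ, 1 < R →
      dirMeasure π₀ (badSet π₀ ε R) ≤ ENNReal.ofReal (K * ε) * dirMeasure π₀ Set.univ) :
    dirMeasure π₀ (eventuallyBad π₀ ε C J) ≤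
      (J + 1) * (ENNReal.ofReal (K * ε) * dirMeasure π₀ Set.univ) := by
  rw [eventuallyBad, Directed.measure_iUnion]
  · refine iSup_le fun n => ?_
    refine (measure_mono (Set.iInter₂_subset (max n 2) (le_max_left _ _))).trans ?_
    refine (measure_biUnion_finset_le _ _).trans ?_
    refine (Finset.sum_le_sum (g := fun _ => ENNReal.ofReal (K * ε) * dirMeasure π₀ Set.univ)
      fun j _ => h _ ?_).trans ?_
    · have h1 : (1 : ℝ) ≤ C ^ j := one_le_pow₀ hC
      have h2 : (2 : ℝ) ≤ ((max n 2 : ℕ) : ℝ) := by exact_mod_cast le_max_right n 2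
      nlinarith
    · simp
  · refine Monotone.directed_le fun n m hnm => ?_
    exact Set.iInter_mono fun R => Set.iInter_mono' fun hm => ⟨hnm.trans hm, subset_rfl⟩

theorem Run.goodAt_of_notMem {π₀ : Rows d} {r : Run d} {w : ℕ → List Bool} {x : Fin d → ℝ}
    (hx1 : total x = 1) {Q : ℕ → ((Fin d → ℝ) ≃ₗ[ℝ] (Fin d → ℝ))} (hwl : ∀ n, (w n).length = n)
    (hsuf : ∀ m n, m ≤ n → w m <:+ w n) (hst : ∀ n, state π₀ (w n) = some (r.rows n, Q n))
    (hwid : ∀ n, r.wid n = (Q n).symm x)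
    (hwt : ∀ n a, r.wt n a = weight (Q n) a) {ε R : ℝ} (h : x ∉ badSet π₀ ε R) :
    r.GoodAt ε R := by
  by_contra hcon
  refine h (Set.mem_biUnion (Run.mem_minWords hwl hsuf hst hwt R) ⟨_, _, hst _, ?_, ?_⟩)
  · rw [← hwid]; exact r.mem _
  · rwa [hx1, mul_one, ← hwid]

end RauzyInduction

end

/-! ### Projective contraction along good windows. -/

noncomputable section

namespace RauzyInduction

open Rows

variable {d : ℕ}

/-! ### Contraction -/

namespace Run

variable {r : Run d}

/-- At time `n` all functionals with values between zero and the total width have coefficients that are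
proportional to the coefficients of the total width up to an error `κ`. -/
def OscLE (r : Run d) (n : ℕ) (κ : ℝ) : Prop :=
  ∀ v, r.IsAcc v → (∀ a, 0 ≤ v 0 a) → (∀ a, v 0 a ≤ 1) →
    ∃ lo hi : ℝ, hi - lo ≤ κ ∧ ∀ a, lo * r.wt n a ≤ v n a ∧ v n a ≤ hi * r.wt n a

theorem IsAcc.const_mul_wt_sub {v : ℕ → Fin d → ℝ} (hv : r.IsAcc v) (s t : ℝ) :
    r.IsAcc fun n a => s * r.wt n a + t * v n a := by
  intro n z
  simp only [r.isAcc_wt n, hv n]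
  split_ifs <;> ring

/-- The functionals `v - lo * wt` and `hi * wt - v` are nonnegative. Positivity carries their values
at one band to all bands, and balance turns these into multiples of the weights. The two gains add
up to `(hi - lo) / β`. -/
theorem OscLE.of_positive {n₀ n₁ n₂ : ℕ} {κ β : ℝ} (h : r.OscLE n₀ κ) (hβ : 1 ≤ β) (h01 : n₀ ≤ n₁)
    (hbal : ∀ j k, r.wt n₂ j ≤ β * r.wt n₁ k)
    (hpos : ∀ v, r.IsAcc v → (∀ a, 0 ≤ v n₁ a) → ∀ j k, v n₁ k ≤ v n₂ j) :
    r.OscLE n₂ ((1 - 1 / β) * κ) := by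
  intro v hv h0 h1
  obtain ⟨lo, hi, hκ, hlh⟩ := h v hv h0 h1
  have hβ0 : 0 < β := by linarith
  have hg := hv.const_mul_wt_sub (-lo) 1
  have hh := hv.const_mul_wt_sub hi (-1)
  have hg1 := hg.nonneg (m := n₀) (fun a => by linarith [(hlh a).1]) h01
  have hh1 := hh.nonneg (m := n₀) (fun a => by linarith [(hlh a).2]) h01
  have hg2 := hpos _ hg hg1
  have hh2 := hpos _ hh hh1
  -- Any band would do; a winner exhibits one.
  set k := r.win 0
  set X := -lo * r.wt n₁ k + 1 * v n₁ k with hX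
  set Y := hi * r.wt n₁ k + -1 * v n₁ k with hY
  set W := r.wt n₁ k with hW
  have hW0 : 0 < W := by linarith [r.one_le_wt n₁ k]
  have hle : ∀ Z : ℝ, 0 ≤ Z → ∀ j, Z / (β * W) * r.wt n₂ j ≤ Z := by
    intro Z hZ j
    calc Z / (β * W) * r.wt n₂ j ≤ Z / (β * W) * (β * W) :=
          mul_le_mul_of_nonneg_left (hbal j k) (by positivity)
      _ = Z := div_mul_cancel₀ _ (by positivity)
  refine ⟨lo + X / (β * W), hi - Y / (β * W), ?_, fun j => ⟨?_, ?_⟩⟩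
  · have : hi - Y / (β * W) - (lo + X / (β * W)) = (1 - 1 / β) * (hi - lo) := by
      have : X + Y = (hi - lo) * W := by rw [hX, hY]; ring
      have h3 : X / (β * W) + Y / (β * W) = (hi - lo) / β := by
        rw [← add_div, this]; field_simp
      have h4 : hi - Y / (β * W) - (lo + X / (β * W)) =
        (hi - lo) - (X / (β * W) + Y / (β * W)) := by ring
      rw [h4, h3]; field_simp
    rw [this]
    refine mul_le_mul_of_nonneg_left hκ (sub_nonneg.2 ?_)
    rw [div_le_one hβ0]; exact hβ
  · have h3 := hle X (hg1 k) j
    have h4 := hg2 j k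
    rw [add_mul]; linarith
  · have h3 := hle Y (hh1 k) j
    have h4 := hh2 j k
    rw [sub_mul]; linarith

/-- Each window multiplies the oscillation by `1 - 1 / β`. The last one also gives balance at its
end, since weights only increase from `n₁` to `n₂`. -/
theorem exists_contraction {β : ℝ} (hβ : 1 ≤ β) (h : ∀ n₀, ∃ n₁ n₂, n₀ ≤ n₁ ∧ n₁ ≤ n₂ ∧
      (∀ j k, r.wt n₂ j ≤ β * r.wt n₁ k) ∧
      ∀ v, r.IsAcc v → (∀ a, 0 ≤ v n₁ a) → ∀ j k, v n₁ k ≤ v n₂ j) {θ : ℝ} (hθ : 0 < θ) :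
    ∃ n, (∀ j k, r.wt n j ≤ β * r.wt n k) ∧ r.OscLE n θ := by
  have hβ0 : 0 < β := by linarith
  have key : ∀ p : ℕ, ∃ n, (∀ j k, r.wt n j ≤ β * r.wt n k) ∧ r.OscLE n ((1 - 1 / β) ^ (p + 1)) := by
    intro p
    have step : ∀ n₀ κ, r.OscLE n₀ κ →
        ∃ n, (∀ j k, r.wt n j ≤ β * r.wt n k) ∧ r.OscLE n ((1 - 1 / β) * κ) := by
      intro n₀ κ hn₀
      obtain ⟨n₁, n₂, h01, h12, hbal, hpos⟩ := h n₀
      refine ⟨n₂, fun j k => (hbal j k).trans ?_, hn₀.of_positive hβ h01 hbal hpos⟩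
      exact mul_le_mul_of_nonneg_left (wt_mono h12 k) hβ0.le
    induction p with
    | zero =>
      obtain ⟨n, h1, h2⟩ := step 0 1 fun v hv h0 h1 => ⟨0, 1, by simp, fun a => by
        simpa [wt] using And.intro (h0 a) (h1 a)⟩
      exact ⟨n, h1, by simpa using h2⟩
    | succ p ih =>
      obtain ⟨n, -, h2⟩ := ih
      obtain ⟨m, h3, h4⟩ := step n _ h2
      exact ⟨m, h3, by rwa [pow_succ']⟩
  have hlt : 1 - 1 / β < 1 := by linarith [one_div_pos.2 hβ0]
  obtain ⟨p, hp⟩ := exists_pow_lt_of_lt_one hθ hlt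
  obtain ⟨n, h1, h2⟩ := key p
  refine ⟨n, h1, fun v hv h0 h3 => ?_⟩
  obtain ⟨lo, hi, h4, h5⟩ := h2 v hv h0 h3
  refine ⟨lo, hi, h4.trans (le_trans ?_ hp.le), h5⟩
  have h0 : 0 ≤ 1 - 1 / β := sub_nonneg.2 ((div_le_one hβ0).2 hβ)
  exact pow_le_pow_of_le_one h0 hlt.le (Nat.le_succ p)

theorem le_time_of_large (n : ℕ) : ∃ R₀ : ℕ, ∀ R : ℝ, R₀ ≤ R → n ≤ r.time R := by
  obtain ⟨R₀, hR₀⟩ := exists_nat_gt (∑ a, r.wt n a)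
  refine ⟨R₀, fun R hR => ?_⟩
  by_contra! hlt
  obtain ⟨a, ha⟩ := r.time_spec R
  have h1 := r.wt_mono hlt.le a
  have h2 := Finset.single_le_sum (f := r.wt n) (fun b _ => r.wt_nonneg n b) (Finset.mem_univ a)
  linarith

end Run

/-- The paths at whose end the coefficients of the total width are comparable. -/
def balancedWords (π₀ : Rows d) (β : ℝ) : Set (List Bool) :=
  {w | ∃ π Q, state π₀ w = some (π, Q) ∧ ∀ j k, weight Q j ≤ β * weight Q k}

/-- Outside the eventually bad set, good windows start arbitrarily late. Contraction is applied to
the coordinate forms: on the level of total width one, a coordinate is an average, weighted by `wt *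
wid`, of the ratios of its coefficients to the weights, and so lies between `lo` and `hi`. That `J`
precedes `ε` and `C` is essential. -/
theorem IsSplitClosed.exists_balanced_small {𝒢 : Set (Rows d)} (h𝒢 : IsSplitClosed 𝒢) (hd : 0 < d) :
    ∃ J : ℕ, ∀ π₀ ∈ 𝒢, ∀ ε C : ℝ, 1 ≤ C → 2 * d < ε * C → ∀ x ∈ generic π₀, total x = 1 →
      x ∉ eventuallyBad π₀ ε C J → ∀ θ > 0, ∃ w ∈ balancedWords π₀ (2 * C ^ J), x ∈ cyl π₀ w ∧
        ∀ y ∈ cyl π₀ w, total y = 1 → dist y x ≤ θ := by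
  obtain ⟨m, J, hmJ⟩ := Run.exists_positive_window d hd
  refine ⟨J, fun π₀ hπ₀ ε C hC hεC x hx hx1 hbad θ hθ => ?_⟩
  obtain ⟨r, w, Q, hwl, hsuf, hst, hxw, hwid, hwt, hacc⟩ :=
    h𝒢.exists_run hπ₀ hx (by simpa using hx1)
  have hβ : 1 ≤ 2 * C ^ J := by nlinarith [one_le_pow₀ hC (n := J)]
  have hwin : ∀ n₀, ∃ n₁ n₂, n₀ ≤ n₁ ∧ n₁ ≤ n₂ ∧ (∀ j k, r.wt n₂ j ≤ 2 * C ^ J * r.wt n₁ k) ∧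
      ∀ v, r.IsAcc v → (∀ a, 0 ≤ v n₁ a) → ∀ j k, v n₁ k ≤ v n₂ j := by
    intro n₀
    obtain ⟨R₀, hR₀⟩ := r.le_time_of_large n₀
    simp only [eventuallyBad, Set.mem_iUnion, Set.mem_iInter, not_exists, not_forall] at hbad
    obtain ⟨R, hR, hnot⟩ := hbad (max R₀ 2)
    have h2 : (2 : ℝ) ≤ R := by exact_mod_cast (le_max_right _ _).trans hR
    have h0 : (R₀ : ℝ) ≤ R := by exact_mod_cast (le_max_left _ _).trans hR
    obtain ⟨h3, h4, h5, h6⟩ := hmJ r ε C R hC hεC (by linarith) fun j hj =>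
      Run.goodAt_of_notMem hx1 hwl hsuf hst hwid hwt (hnot j (Finset.mem_range.2 (by omega)))
    exact ⟨_, _, (hR₀ _ h0).trans h3, h4, h5, h6⟩
  obtain ⟨n, hbal, hosc⟩ := Run.exists_contraction hβ hwin hθ
  refine ⟨w n, ⟨_, _, hst n, fun j k => by simpa only [hwt] using hbal j k⟩, hxw n, ?_⟩
  intro y hy hy1
  rw [dist_pi_le_iff hθ.le]
  intro i
  have hQ0 : Q 0 = LinearEquiv.refl ℝ _ := by
    have := hst 0
    rw [List.length_eq_zero_iff.1 (hwl 0)] at this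
    exact (Prod.mk.inj (Option.some.inj this)).2.symm
  obtain ⟨lo, hi, hle, hlh⟩ := hosc _ (hacc (LinearMap.proj i))
    (fun a => by
      simp only [hQ0, LinearEquiv.refl_apply, LinearMap.proj_apply, Pi.single_apply]
      split_ifs <;> simp)
    (fun a => by
      simp only [hQ0, LinearEquiv.refl_apply, LinearMap.proj_apply, Pi.single_apply]
      split_ifs <;> simp)
  have hb : ∀ z ∈ cyl π₀ (w n), total z = 1 → lo ≤ z i ∧ z i ≤ hi := by
    intro z hz hz1
    rw [mem_cyl_iff (hst n)] at hz
    set u := (Q n).symm z with hu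
    have e1 : z i = ∑ a, (LinearMap.proj i : (Fin d → ℝ) →ₗ[ℝ] ℝ) (Q n (Pi.single a 1)) * u a := by
      have := apply_eq_sum_single ((LinearMap.proj i : (Fin d → ℝ) →ₗ[ℝ] ℝ) ∘ₗ
        (Q n : (Fin d → ℝ) →ₗ[ℝ] (Fin d → ℝ))) u
      simpa [hu] using this
    have e2 : ∑ a, r.wt n a * u a = 1 := by
      simp only [hwt, ← total_apply_eq]; rw [hu, (Q n).apply_symm_apply, hz1]
    constructor
    · rw [e1, show lo = lo * ∑ a, r.wt n a * u a by rw [e2, mul_one], Finset.mul_sum]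
      refine Finset.sum_le_sum fun a _ => ?_
      rw [← mul_assoc]
      exact mul_le_mul_of_nonneg_right (hlh a).1 (hz.1 a).le
    · rw [e1, show hi = hi * ∑ a, r.wt n a * u a by rw [e2, mul_one], Finset.mul_sum]
      refine Finset.sum_le_sum fun a _ => ?_
      rw [← mul_assoc]
      exact mul_le_mul_of_nonneg_right (hlh a).2 (hz.1 a).le
  have h1 := hb y hy hy1
  have h2 := hb x (hxw n) hx1
  rw [Real.dist_eq, abs_le]
  constructor <;> linarith [h1.1, h1.2, h2.1, h2.2]

end RauzyInduction

end

/-! ### Bounded distortion and the density argument. -/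

noncomputable section

namespace RauzyInduction

open Rows

variable {d : ℕ}

/-! ### Invariant families of cones -/

/-- A measurable family of cones that is invariant under splits. -/
structure IsInvariantFamily (𝒢 : Set (Rows d)) (B : Rows d → Set (Fin d → ℝ)) : Prop where
  measurable : ∀ π ∈ 𝒢, MeasurableSet (B π)
  conic : ∀ π ∈ 𝒢, IsConic (B π)
  unsplit_mem_iff : ∀ π ∈ 𝒢, ∀ β π' a c, Split β π π' a c → ∀ y ∈ π'.posCone,
    unsplit a c y ∈ B π ↔ y ∈ B π'

theorem IsInvariantFamily.map_mem_iff {𝒢 : Set (Rows d)} (h𝒢 : IsSplitClosed 𝒢)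
    {B : Rows d → Set (Fin d → ℝ)} (hB : IsInvariantFamily 𝒢 B) {π₀ : Rows d} (hπ₀ : π₀ ∈ 𝒢)
    {w : List Bool} {π : Rows d} {Q : (Fin d → ℝ) ≃ₗ[ℝ] (Fin d → ℝ)}
    (h : state π₀ w = some (π, Q)) {y : Fin d → ℝ} (hy : y ∈ π.posCone) :
    Q y ∈ B π₀ ↔ y ∈ B π := by
  induction w generalizing π Q y with
  | nil => cases h; rfl
  | cons β w ih =>
    obtain ⟨π', Q', a, c, h1, h2, rfl⟩ := state_cons.1 h
    have hy' := h2.unsplit_mem_posCone hy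
    rw [LinearEquiv.trans_apply, splitEquiv_apply h2.ne, ih h1 hy',
      hB.unsplit_mem_iff π' (h𝒢.mem_of_state hπ₀ h1 ⟨_, hy'⟩) _ _ _ _ h2 y hy]

theorem IsConic.inter {S T : Set (Fin d → ℝ)} (hS : IsConic S) (hT : IsConic T) :
    IsConic (S ∩ T) := fun r hr x => and_congr (hS r hr x) (hT r hr x)

theorem IsConic.diff {S T : Set (Fin d → ℝ)} (hS : IsConic S) (hT : IsConic T) :
    IsConic (S \ T) := fun r hr x => and_congr (hS r hr x) (not_congr (hT r hr x))

/-- Balance gives `W / β * total y ≤ total (Q y) ≤ β * W * total y`. In final coordinates the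
truncated cylinder is pinched between truncations whose levels have ratio `β * β`, and homogeneity
transfers the fraction filled by `B` at the end type. -/
theorem IsInvariantFamily.dirMeasure_cyl_le (hd : 0 < d) {𝒢 : Set (Rows d)}
    (h𝒢 : IsSplitClosed 𝒢) {B : Rows d → Set (Fin d → ℝ)} (hB : IsInvariantFamily 𝒢 B)
    {π₀ : Rows d} (hπ₀ : π₀ ∈ 𝒢) {β : ℝ} (hβ : 1 ≤ β) {K : ENNReal}
    (hK : ∀ π ∈ 𝒢, flatMeasure (switchSpace π) (slice π) ≤
      K * flatMeasure (switchSpace π) ((π.posCone ∩ B π) ∩ slice π))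
    {w : List Bool} (hw : w ∈ balancedWords π₀ β) :
    dirMeasure π₀ (cyl π₀ w) ≤ ENNReal.ofReal ((β * β) ^ d) * K * dirMeasure π₀ (cyl π₀ w ∩ B π₀) := by
  obtain ⟨π, Q, hst, hbal⟩ := hw
  rcases (cyl π₀ w).eq_empty_or_nonempty with he | ⟨x, hx⟩
  · simp [he]
  have hπ : π ∈ 𝒢 := h𝒢.mem_of_state hπ₀ hst ⟨_, (mem_cyl_iff hst x).1 hx⟩
  rw [dirMeasure_apply hd _ (isConic_cyl _ _) (measurableSet_cyl _ _),
    dirMeasure_apply hd _ ((isConic_cyl _ _).inter (hB.conic _ hπ₀))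
      ((measurableSet_cyl _ _).inter (hB.measurable _ hπ₀))]
  obtain ⟨c, -, -, hc⟩ := flatMeasure_map Q (map_switchSpace hst)
  rw [hc _ ((measurableSet_cyl _ _).inter (measurableSet_slice _)),
    hc _ (((measurableSet_cyl _ _).inter (hB.measurable _ hπ₀)).inter (measurableSet_slice _))]
  set ν := flatMeasure (switchSpace π)
  have hβ0 : 0 < β := by linarith
  let k : Fin d := ⟨0, hd⟩
  set W := weight Q k
  have hW : 0 < W := by linarith [one_le_weight hst k]
  have hlow : ∀ y ∈ π.posCone, W / β * total y ≤ total (Q y) := by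
    intro y hy
    rw [total_apply_eq, total_apply, Finset.mul_sum]
    refine Finset.sum_le_sum fun a _ => mul_le_mul_of_nonneg_right ?_ (hy.1 a).le
    rw [div_le_iff₀ hβ0, mul_comm]; exact hbal k a
  have hup : ∀ y ∈ π.posCone, total (Q y) ≤ β * W * total y := by
    intro y hy
    rw [total_apply_eq, total_apply, Finset.mul_sum]
    exact Finset.sum_le_sum fun a _ => mul_le_mul_of_nonneg_right (hbal a k) (hy.1 a).le
  have h1 : Q ⁻¹' (cyl π₀ w ∩ slice π₀) ⊆ {y | y ∈ π.posCone ∧ total y ≤ β / W} := by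
    rintro y ⟨hy, hs⟩
    have hy' : y ∈ π.posCone := by simpa using (mem_cyl_iff hst _).1 hy
    refine ⟨hy', ?_⟩
    rw [le_div_iff₀ hW]
    have := (hlow y hy').trans hs.2
    rw [div_mul_eq_mul_div, div_le_one hβ0] at this
    linarith
  have h2 : {y | y ∈ π.posCone ∩ B π ∧ total y ≤ 1 / (β * W)} ⊆
      Q ⁻¹' (cyl π₀ w ∩ B π₀ ∩ slice π₀) := by
    rintro y ⟨⟨hy, hyB⟩, hs⟩
    have hcy : Q y ∈ cyl π₀ w := (mem_cyl_iff hst _).2 (by simpa using hy)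
    refine ⟨⟨hcy, (hB.map_mem_iff h𝒢 hπ₀ hst hy).2 hyB⟩, cyl_subset_posCone _ _ hcy, ?_⟩
    refine (hup y hy).trans ?_
    rw [le_div_iff₀ (by positivity)] at hs
    linarith
  have e1 := flatMeasure_total_le (isConic_posCone π) (measurableSet_posCone π) subset_rfl
    (r := β / W) (by positivity)
  have e2 := flatMeasure_total_le ((isConic_posCone π).inter (hB.conic π hπ))
    ((measurableSet_posCone π).inter (hB.measurable π hπ)) Set.inter_subset_left
    (r := 1 / (β * W)) (by positivity)
  have hps : π.posCone ∩ slice π = slice π := Set.inter_eq_right.2 fun y hy => hy.1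
  rw [hps] at e1
  set N := Module.finrank ℝ (switchSpace π)
  have hN : N ≤ d := by simpa using Submodule.finrank_le (switchSpace π)
  calc c * ν (Q ⁻¹' (cyl π₀ w ∩ slice π₀))
      ≤ c * (ENNReal.ofReal ((β / W) ^ N) * (K * ν ((π.posCone ∩ B π) ∩ slice π))) := by
        refine mul_le_mul' le_rfl ((measure_mono h1).trans (e1.le.trans ?_))
        exact mul_le_mul' le_rfl (hK π hπ)
    _ = c * (ENNReal.ofReal ((β * β) ^ N) * (K * (ENNReal.ofReal ((1 / (β * W)) ^ N) *
          ν ((π.posCone ∩ B π) ∩ slice π)))) := by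
        have : ENNReal.ofReal ((β / W) ^ N) =
            ENNReal.ofReal ((β * β) ^ N) * ENNReal.ofReal ((1 / (β * W)) ^ N) := by
          rw [← ENNReal.ofReal_mul (by positivity), ← mul_pow]
          congr 2; field_simp
        rw [this]; ring
    _ ≤ c * (ENNReal.ofReal ((β * β) ^ d) * (K * ν (Q ⁻¹' (cyl π₀ w ∩ B π₀ ∩ slice π₀)))) := by
        rw [← e2]
        refine mul_le_mul' le_rfl (mul_le_mul' (ENNReal.ofReal_le_ofReal ?_)
          (mul_le_mul' le_rfl (measure_mono h2)))
        exact pow_le_pow_right₀ (by nlinarith) hN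
    _ = ENNReal.ofReal ((β * β) ^ d) * K * (c * ν (Q ⁻¹' (cyl π₀ w ∩ B π₀ ∩ slice π₀))) := by ring

theorem IsInvariantFamily.exists_slice_le (hd : 0 < d) {𝒢 : Set (Rows d)}
    (h𝒢 : IsSplitClosed 𝒢) {B : Rows d → Set (Fin d → ℝ)} (hB : IsInvariantFamily 𝒢 B)
    (hpos : ∀ π ∈ 𝒢, flatMeasure (switchSpace π) (π.posCone ∩ B π) ≠ 0) :
    ∃ K : ENNReal, K ≠ ⊤ ∧ ∀ π ∈ 𝒢, flatMeasure (switchSpace π) (slice π) ≤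
      K * flatMeasure (switchSpace π) ((π.posCone ∩ B π) ∩ slice π) := by
  set f : Rows d → ENNReal := fun π => flatMeasure (switchSpace π) (slice π) /
    flatMeasure (switchSpace π) ((π.posCone ∩ B π) ∩ slice π)
  have hne : ∀ π ∈ 𝒢, flatMeasure (switchSpace π) ((π.posCone ∩ B π) ∩ slice π) ≠ 0 := fun π hπ =>
    flatMeasure_slice_ne_zero hd ((isConic_posCone π).inter (hB.conic π hπ))
      ((measurableSet_posCone π).inter (hB.measurable π hπ)) Set.inter_subset_left (hpos π hπ)
  have hlt : ∀ π, flatMeasure (switchSpace π) ((π.posCone ∩ B π) ∩ slice π) ≠ ⊤ := fun π =>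
    ((measure_mono Set.inter_subset_right).trans_lt (flatMeasure_slice_lt_top π)).ne
  refine ⟨∑ π ∈ h𝒢.finite.toFinset, f π, ?_, fun π hπ => ?_⟩
  · refine ENNReal.sum_ne_top.2 fun π hπ => ?_
    exact ENNReal.div_ne_top (flatMeasure_slice_lt_top π).ne
      (hne π (h𝒢.finite.mem_toFinset.1 hπ))
  · rw [← ENNReal.div_le_iff (hne π hπ) (hlt π)]
    exact Finset.single_le_sum (f := f) (fun _ _ => zero_le) (h𝒢.finite.mem_toFinset.2 hπ)

/-- An invariant family of cones that is nowhere null has full measure. -/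
theorem IsInvariantFamily.measure_diff_eq_zero (hd : 0 < d) {𝒢 : Set (Rows d)}
    (h𝒢 : IsSplitClosed 𝒢) {B : Rows d → Set (Fin d → ℝ)} (hB : IsInvariantFamily 𝒢 B)
    (hpos : ∀ π ∈ 𝒢, flatMeasure (switchSpace π) (π.posCone ∩ B π) ≠ 0) {π₀ : Rows d}
    (hπ₀ : π₀ ∈ 𝒢) : flatMeasure (switchSpace π₀) (π₀.posCone \ B π₀) = 0 := by
  obtain ⟨K, hKtop, hK⟩ := hB.exists_slice_le hd h𝒢 hpos
  obtain ⟨K₀, hK₀, hbad⟩ := h𝒢.exists_dirMeasure_badSet_le hd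
  obtain ⟨J, hsmall⟩ := h𝒢.exists_balanced_small hd
  have hDm : MeasurableSet (π₀.posCone \ B π₀) :=
    (measurableSet_posCone π₀).diff (hB.measurable _ hπ₀)
  have hDc : IsConic (π₀.posCone \ B π₀) := (isConic_posCone π₀).diff (hB.conic _ hπ₀)
  refine flatMeasure_eq_zero_of_dirMeasure hd hDc hDm Set.sdiff_subset ?_
  set μ := dirMeasure π₀
  by_contra hD
  -- a scale `ε` for which the eventually bad set does not cover the difference
  obtain ⟨ε, hε, hεlt⟩ : ∃ ε : ℝ, 0 < ε ∧
      (J + 1) * (ENNReal.ofReal (K₀ * ε) * μ Set.univ) < μ (π₀.posCone \ B π₀) := by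
    have hlim : Filter.Tendsto (fun ε : ℝ => (J + 1 : ENNReal) * (ENNReal.ofReal (K₀ * ε) * μ Set.univ))
        (nhdsWithin 0 (Set.Ioi 0)) (nhds ((J + 1) * (ENNReal.ofReal (K₀ * 0) * μ Set.univ))) := by
      refine ENNReal.Tendsto.const_mul (ENNReal.Tendsto.mul_const ?_ (Or.inr (measure_ne_top _ _)))
        (Or.inr (by finiteness))
      refine (ENNReal.continuous_ofReal.comp (continuous_const.mul continuous_id)).continuousAt.tendsto.mono_left
        nhdsWithin_le_nhds
    simp only [mul_zero, ENNReal.ofReal_zero, zero_mul] at hlim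
    obtain ⟨ε, h1, h2⟩ := ((hlim.eventually (gt_mem_nhds (pos_iff_ne_zero.2 hD))).and
      self_mem_nhdsWithin).exists
    exact ⟨ε, h2, h1⟩
  -- Enlarging `C` after fixing `ε` is harmless: the bound on the eventually bad set involves `J`
  -- but not `C`.
  set C : ℝ := max 1 ((2 * d + 1) / ε)
  have hC : 1 ≤ C := le_max_left _ _
  have hεC : 2 * d < ε * C := by
    have : (2 * d + 1) / ε ≤ C := le_max_right _ _
    rw [div_le_iff₀ hε] at this
    linarith
  set Y := eventuallyBad π₀ ε C J
  have hY : μ Y < μ (π₀.posCone \ B π₀) :=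
    (dirMeasure_eventuallyBad_le hC J fun R hR => hbad π₀ hπ₀ ε R hε hR).trans_lt hεlt
  set D' : Set (Fin d → ℝ) := {x | x ∈ π₀.posCone \ B π₀ ∧ x ∈ generic π₀ ∧ total x = 1 ∧ x ∉ Y}
  have hgen : μ (π₀.posCone \ generic π₀) = 0 := by
    have hgm : MeasurableSet (π₀.posCone \ generic π₀) := by
      have : generic π₀ = ⋂ n : ℕ, ⋃ w : List Bool, ⋃ _ : w.length = n, cyl π₀ w := by
        ext x; simp [generic]
      rw [this]
      exact (measurableSet_posCone π₀).diff (MeasurableSet.iInter fun n => MeasurableSet.iUnion fun w =>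
        MeasurableSet.iUnion fun _ => measurableSet_cyl π₀ w)
    have hgc : IsConic (π₀.posCone \ generic π₀) := (isConic_posCone π₀).diff fun r hr x =>
      forall_congr' fun n => exists_congr fun w => and_congr_right fun _ => isConic_cyl π₀ w r hr x
    simp only [μ]
    rw [dirMeasure_apply hd _ hgc hgm]
    exact measure_mono_null Set.inter_subset_left (h𝒢.measure_diff_generic hπ₀)
  have hD' : μ D' ≠ 0 := by
    intro h0
    refine absurd hY (not_lt.2 ?_)
    calc μ (π₀.posCone \ B π₀)
        ≤ μ (D' ∪ ((π₀.posCone \ generic π₀) ∪ ({x | total x ≠ 1} ∪ Y))) := by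
          refine measure_mono fun x hx => ?_
          by_cases h1 : x ∈ generic π₀
          · by_cases h2 : total x = 1
            · by_cases h3 : x ∈ Y
              · exact Or.inr (Or.inr (Or.inr h3))
              · exact Or.inl ⟨hx, h1, h2, h3⟩
            · exact Or.inr (Or.inr (Or.inl h2))
          · exact Or.inr (Or.inl ⟨hx.1, h1⟩)
      _ ≤ μ D' + (μ (π₀.posCone \ generic π₀) + (μ {x | total x ≠ 1} + μ Y)) :=
          (measure_union_le _ _).trans (add_le_add le_rfl ((measure_union_le _ _).trans
            (add_le_add le_rfl (measure_union_le _ _))))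
      _ = μ Y := by rw [h0, hgen, dirMeasure_total_ne hd]; simp
  set β : ℝ := 2 * C ^ J
  have hβ : 1 ≤ β := by nlinarith [one_le_pow₀ hC (n := J)]
  set K' : ENNReal := ENNReal.ofReal ((β * β) ^ d) * K
  have hK' : K' ≠ ⊤ := ENNReal.mul_ne_top ENNReal.ofReal_ne_top hKtop
  have key : ∀ η : ENNReal, η ≠ 0 → μ D' ≤ K' * η := by
    intro η hη
    -- Since `D'` misses the invariant cone, outer regularity leaves that cone at most `η` of `U`.
    -- The minimal words of `F` cover `D'` by disjoint balanced cylinders, which lie in `U` on the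
    -- level of total width one.
    obtain ⟨U, hDU, hU, hUlt⟩ := D'.exists_isOpen_lt_add (measure_ne_top μ _) hη
    set F : Set (List Bool) := {w | w ∈ balancedWords π₀ β ∧ ∀ y ∈ cyl π₀ w, total y = 1 → y ∈ U}
    have hcov : D' ⊆ ⋃ w ∈ minWords F, cyl π₀ w := by
      intro x hx
      obtain ⟨ρ, hρ, hball⟩ := Metric.isOpen_iff.1 hU x (hDU hx)
      obtain ⟨w, hw, hxw, hdist⟩ := hsmall π₀ hπ₀ ε C hC hεC x hx.2.1 hx.2.2.1 hx.2.2.2 (ρ / 2)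
        (by positivity)
      have hwF : w ∈ F := ⟨hw, fun y hy hy1 => hball (Metric.mem_ball.2
        ((hdist y hy hy1).trans_lt (by linarith)))⟩
      obtain ⟨u, hu, huw⟩ := exists_minWords hwF
      exact Set.mem_biUnion hu (cyl_subset_of_suffix huw hxw)
    have hBm := hB.measurable _ hπ₀
    have hUB : μ (U ∩ B π₀) ≤ η := by
      have h1 : μ (U ∩ B π₀) + μ (U \ B π₀) = μ U := measure_inter_add_sdiff _ hBm
      have h2 : μ D' ≤ μ (U \ B π₀) := measure_mono fun x hx => ⟨hDU hx, hx.1.2⟩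
      have h3 : μ (U ∩ B π₀) + μ D' ≤ η + μ D' := by
        rw [add_comm η]
        exact ((add_le_add le_rfl h2).trans h1.le).trans hUlt.le
      exact (ENNReal.add_le_add_iff_right (measure_ne_top μ D')).1 h3
    calc μ D' ≤ μ (⋃ w ∈ minWords F, cyl π₀ w) := measure_mono hcov
      _ = ∑' w : minWords F, μ (cyl π₀ w) := measure_biUnion (Set.to_countable _)
          (pairwiseDisjoint_cyl π₀ _) fun w _ => measurableSet_cyl π₀ w
      _ ≤ ∑' w : minWords F, K' * μ (cyl π₀ w ∩ B π₀) := ENNReal.tsum_le_tsum fun w =>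
          hB.dirMeasure_cyl_le hd h𝒢 hπ₀ hβ hK w.2.1.1
      _ = K' * μ (⋃ w ∈ minWords F, (cyl π₀ w ∩ B π₀)) := by
          rw [ENNReal.tsum_mul_left, measure_biUnion (Set.to_countable _) _
            fun w _ => (measurableSet_cyl π₀ w).inter hBm]
          exact (pairwiseDisjoint_cyl π₀ F).mono fun w => Set.inter_subset_left
      _ ≤ K' * (μ (U ∩ B π₀) + μ {x | total x ≠ 1}) := by
          refine mul_le_mul' le_rfl (le_trans (measure_mono ?_) (measure_union_le _ _))
          refine Set.iUnion₂_subset fun w hw x hx => ?_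
          by_cases h1 : total x = 1
          · exact Or.inl ⟨hw.1.2 x hx.1 h1, hx.2⟩
          · exact Or.inr h1
      _ ≤ K' * η := by
          rw [dirMeasure_total_ne hd, add_zero]
          exact mul_le_mul' le_rfl hUB
  refine hD' (le_antisymm (le_of_forall_pos_le_add fun δ hδ => ?_) zero_le)
  rw [zero_add]
  by_cases hK0 : K' = 0
  · have := key 1 one_ne_zero
    rw [hK0, zero_mul] at this
    exact this.trans zero_le
  · refine (key (δ / K') (ENNReal.div_pos hδ.ne' hK').ne').trans ?_
    exact ENNReal.mul_div_le

end RauzyInduction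

end

/-! ### Volume on configuration spaces and Haar measure on cones. -/

noncomputable section

namespace RauzyInduction

open Rows

variable {d : ℕ}

/-! ### Lebesgue measure on the configuration spaces -/

/-- The form that defines the switch condition. -/
def switchForm (π : Rows d) : (Fin d → ℝ) →ₗ[ℝ] ℝ := ∑ a, π.excess a • LinearMap.proj a

theorem switchForm_apply (π : Rows d) (x : Fin d → ℝ) : switchForm π x = ∑ a, π.excess a * x a := by
  simp [switchForm]

theorem switchForm_eq_zero {π : Rows d} {x : Fin d → ℝ} : switchForm π x = 0 ↔ π.Switch x := by
  rw [switchForm_apply, switch_iff]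

/-- The total width and the defect of the switch condition. -/
def levelMap (π : Rows d) : EuclideanSpace ℝ (Fin d) →ₗ[ℝ] ℝ × ℝ :=
  (total.prod (switchForm π)) ∘ₗ
    (WithLp.linearEquiv 2 ℝ (Fin d → ℝ) : EuclideanSpace ℝ (Fin d) →ₗ[ℝ] (Fin d → ℝ))

theorem levelMap_apply (π : Rows d) (x : EuclideanSpace ℝ (Fin d)) :
    levelMap π x = (total x.ofLp, switchForm π x.ofLp) := rfl

theorem Rows.Admissible.exists_excess_ne {π : Rows d} (h : π.Admissible) :
    ∃ a b, π.excess a ≠ π.excess b := by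
  obtain ⟨a, ha⟩ := h.nonorientable
  rcases lt_or_gt_of_ne ha with hlt | hlt
  · obtain ⟨b, hb⟩ := exists_excess_pos h.recurrent hlt
    exact ⟨a, b, (hlt.trans hb).ne⟩
  · obtain ⟨b, hb⟩ := exists_excess_neg h.recurrent hlt
    exact ⟨a, b, (hb.trans hlt).ne'⟩

/-- The excess is not constant, so total width and switch form are independent. This is where the
dimension `d - 2` comes from. -/
theorem Rows.Admissible.finrank_ker_levelMap {π : Rows d} (h : π.Admissible) :
    Module.finrank ℝ (LinearMap.ker (levelMap π)) + 2 = d := by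
  have hsurj : Function.Surjective (levelMap π) := by
    obtain ⟨a, b, hab⟩ := h.exists_excess_ne
    rintro ⟨s, t⟩
    have hne : π.excess a - π.excess b ≠ 0 := sub_ne_zero.2 hab
    refine ⟨WithLp.toLp 2 (((t - π.excess b * s) / (π.excess a - π.excess b)) • Pi.single a 1 +
      ((π.excess a * s - t) / (π.excess a - π.excess b)) • Pi.single b 1), ?_⟩
    rw [levelMap_apply]
    ext
    · simp only [map_add, map_smul, total_apply, Finset.sum_pi_single', Finset.mem_univ, if_true,
        smul_eq_mul]
      field_simp; ring
    · simp only [map_add, map_smul, switchForm_apply, Pi.single_apply, mul_ite, mul_one, mul_zero,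
        Finset.sum_ite_eq', Finset.mem_univ, if_true, smul_eq_mul]
      field_simp; ring
  have := LinearMap.finrank_range_add_finrank_ker (levelMap π)
  rw [LinearMap.range_eq_top.2 hsurj, finrank_top] at this
  simp at this
  omega

theorem Rows.configSpace_iff {π : Rows d} {x : EuclideanSpace ℝ (Fin d)} :
    x ∈ π.configSpace ↔ (∀ a, 0 ≤ x a) ∧ levelMap π x = (1, 0) := by
  rw [levelMap_apply, Prod.mk.injEq, switchForm_eq_zero, total_apply]
  rfl

theorem measurable_ofLp : Measurable (WithLp.ofLp : EuclideanSpace ℝ (Fin d) → (Fin d → ℝ)) :=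
  WithLp.measurable_ofLp 2 _

theorem measurableSet_configSpace (π : Rows d) : MeasurableSet π.configSpace := by
  have : π.configSpace = WithLp.ofLp ⁻¹' ((⋂ a, {x : Fin d → ℝ | 0 ≤ x a}) ∩
      ({x | total x = 1} ∩ {x | switchForm π x = 0})) := by
    ext x
    simp [configSpace, switchForm_eq_zero]
  rw [this]
  refine measurable_ofLp (MeasurableSet.inter (MeasurableSet.iInter fun a =>
    measurableSet_le measurable_const (measurable_pi_apply a)) (MeasurableSet.inter ?_ ?_))
  · exact measurableSet_eq_fun (measurable_linearForm _) measurable_const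
  · exact measurableSet_eq_fun (measurable_linearForm _) measurable_const

/-- The widths that can be rescaled to a point of a subset of the configuration space. -/
def coneOver (π : Rows d) (A : Set π.configSpace) : Set (Fin d → ℝ) :=
  {y | ∃ h0 h1 h2, normalize π y h0 h1 h2 ∈ A}

theorem mem_coneOver_iff {π : Rows d} {A : Set π.configSpace} {y : Fin d → ℝ} :
    y ∈ coneOver π A ↔ 0 < total y ∧ WithLp.toLp 2 (direction y) ∈ Subtype.val '' A := by
  have key : ∀ h0 h1 h2, (normalize π y h0 h1 h2).1 = WithLp.toLp 2 (direction y) := by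
    intro h0 h1 h2
    simp only [Rows.normalize, direction]
    congr 1; ext a
    simp [div_eq_inv_mul]
  constructor
  · rintro ⟨h0, h1, h2, h⟩
    exact ⟨by simpa using h1, _, h, key _ _ _⟩
  · rintro ⟨h1, x, hx, hxy⟩
    have hy : y = total y • x.1.ofLp := by
      rw [hxy, direction, smul_inv_smul₀ h1.ne']
    have h0 : ∀ a, 0 ≤ y a := fun a => by
      rw [hy]; exact mul_nonneg h1.le (x.2.1 a)
    have h2 : π.Switch y := by
      rw [hy]
      exact mem_switchSpace.1 ((switchSpace π).smul_mem _ (mem_switchSpace.2 x.2.2.2))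
    refine ⟨h0, by simpa using h1, h2, ?_⟩
    rwa [show normalize π y h0 (by simpa using h1) h2 = x from
      Subtype.ext ((key _ _ _).trans hxy.symm)]

theorem measurableSet_coneOver {π : Rows d} {A : Set π.configSpace} (hA : MeasurableSet A) :
    MeasurableSet (coneOver π A) := by
  have : coneOver π A = {y | 0 < total y} ∩
      (fun y => WithLp.toLp 2 (direction y)) ⁻¹' (Subtype.val '' A) := by
    ext y; exact mem_coneOver_iff
  rw [this]
  refine (measurableSet_lt measurable_const (measurable_linearForm _)).inter ?_
  exact ((WithLp.measurable_toLp 2 _).comp measurable_direction)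
    (MeasurableSet.subtype_image (measurableSet_configSpace π) hA)

theorem isConic_coneOver (π : Rows d) (A : Set π.configSpace) : IsConic (coneOver π A) := by
  intro r hr y
  have h1 : direction (r • y) = direction y := by
    rw [direction, direction, map_smul, smul_eq_mul, mul_inv, smul_smul, mul_right_comm,
      inv_mul_cancel₀ hr.ne', one_mul]
  rw [mem_coneOver_iff, mem_coneOver_iff, h1, map_smul, smul_eq_mul, mul_pos_iff_of_pos_left hr]

section

variable {π : Rows d}

/-- The linear coordinates on the hyperplane of the switch condition given by the total width and a
translation of the configuration space. -/
def levelCoord (p : π.configSpace) : (ℝ × LinearMap.ker (levelMap π)) →ₗ[ℝ] switchSpace π where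
  toFun z := ⟨z.1 • p.1.ofLp + z.2.1.ofLp, by
    refine (switchSpace π).add_mem ((switchSpace π).smul_mem _ (mem_switchSpace.2 p.2.2.2)) ?_
    have := z.2.2
    rw [LinearMap.mem_ker, levelMap_apply, Prod.mk_eq_zero] at this
    exact mem_switchSpace.2 (switchForm_eq_zero.1 this.2)⟩
  map_add' z w := by
    ext a
    simp only [Prod.fst_add, Prod.snd_add, Submodule.coe_add, WithLp.ofLp_add, Pi.add_apply,
      Pi.smul_apply, smul_eq_mul]
    ring
  map_smul' r z := by
    ext a
    simp only [Prod.smul_fst, Prod.smul_snd, Submodule.coe_smul, WithLp.ofLp_smul, Pi.add_apply,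
      Pi.smul_apply, smul_eq_mul, RingHom.id_apply]
    ring

theorem total_levelCoord (p : π.configSpace) (z : ℝ × LinearMap.ker (levelMap π)) :
    total (levelCoord p z).1 = z.1 := by
  have h1 := z.2.2
  rw [LinearMap.mem_ker, levelMap_apply, Prod.mk_eq_zero] at h1
  have h2 : total p.1.ofLp = 1 := by rw [total_apply]; exact p.2.2.1
  change total (z.1 • p.1.ofLp + z.2.1.ofLp) = z.1
  rw [map_add, map_smul, h1.1, h2, smul_eq_mul, mul_one, add_zero]

theorem levelCoord_bijective (p : π.configSpace) : Function.Bijective (levelCoord p) := by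
  constructor
  · rw [← LinearMap.ker_eq_bot, LinearMap.ker_eq_bot']
    rintro ⟨t, v⟩ hz
    have ht := total_levelCoord p (t, v)
    rw [hz] at ht
    obtain rfl : 0 = t := by simpa using ht
    have hv := congrArg Subtype.val hz
    change (0 : ℝ) • p.1.ofLp + v.1.ofLp = 0 at hv
    rw [zero_smul, zero_add] at hv
    refine Prod.ext rfl (Subtype.ext ?_)
    exact (WithLp.ofLp_injective 2) hv
  · rintro ⟨y, hy⟩
    have hp : levelMap π p.1 = (1, 0) := (configSpace_iff.1 p.2).2
    refine ⟨(total y, ⟨WithLp.toLp 2 y - total y • p.1, ?_⟩), ?_⟩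
    · rw [LinearMap.mem_ker, map_sub, map_smul, hp, levelMap_apply,
        switchForm_eq_zero.2 (mem_switchSpace.1 hy)]
      simp
    · refine Subtype.ext ?_
      change total y • p.1.ofLp + (WithLp.toLp 2 y - total y • p.1).ofLp = y
      simp

theorem hausdorffMeasure_eq (h : π.Admissible) (p : π.configSpace) (A : Set π.configSpace) :
    μH[(d : ℝ) - 2] A = μH[(Module.finrank ℝ (LinearMap.ker (levelMap π)) : ℝ)]
      {v : LinearMap.ker (levelMap π) | p.1 + v.1 ∈ Subtype.val '' A} := by
  have hk := h.finrank_ker_levelMap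
  have hdim : (d : ℝ) - 2 = Module.finrank ℝ (LinearMap.ker (levelMap π)) := by
    have : (Module.finrank ℝ (LinearMap.ker (levelMap π)) : ℝ) + 2 = d := by exact_mod_cast hk
    linarith
  have h0 : (0 : ℝ) ≤ Module.finrank ℝ (LinearMap.ker (levelMap π)) := Nat.cast_nonneg _
  rw [hdim, ← (isometry_subtype_coe (s := π.configSpace)).hausdorffMeasure_image (Or.inl h0)]
  have hf : Isometry fun v : LinearMap.ker (levelMap π) => p.1 + v.1 :=
    (IsometryEquiv.addLeft p.1).isometry.comp isometry_subtype_coe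
  rw [← hf.hausdorffMeasure_image (Or.inl h0)]
  congr 1
  ext z
  constructor
  · rintro ⟨x, hx, rfl⟩
    refine ⟨⟨x.1 - p.1, ?_⟩, ?_, ?_⟩
    · rw [LinearMap.mem_ker, map_sub, (configSpace_iff.1 p.2).2, (configSpace_iff.1 x.2).2, sub_self]
    · exact ⟨x, hx, by simp⟩
    · simp
  · rintro ⟨v, hv, rfl⟩
    exact hv

theorem levelCoord_mem_coneOver (p : π.configSpace) (A : Set π.configSpace) (t : ℝ)
    (v : LinearMap.ker (levelMap π)) : (levelCoord p (t, v)).1 ∈ coneOver π A ↔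
      0 < t ∧ t⁻¹ • v ∈ {v : LinearMap.ker (levelMap π) | p.1 + v.1 ∈ Subtype.val '' A} := by
  rw [mem_coneOver_iff, total_levelCoord]
  refine and_congr_right fun ht => ?_
  have : WithLp.toLp 2 (direction (levelCoord p (t, v)).1) = p.1 + t⁻¹ • v.1 := by
    rw [direction, total_levelCoord]
    change WithLp.toLp 2 (t⁻¹ • (t • p.1.ofLp + v.1.ofLp)) = _
    rw [smul_add, inv_smul_smul₀ ht.ne']
    rfl
  rw [this]
  rfl

/-- In the coordinates `levelCoord`, Haar measure is a multiple of Lebesgue measure times Hausdorff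
measure, and the section of the cone at height `t > 0` is a dilate by `t` of the translated set.
Fubini compares the null sets. -/
theorem hausdorffMeasure_eq_zero_iff (h : π.Admissible) {A : Set π.configSpace}
    (hA : MeasurableSet A) :
    μH[(d : ℝ) - 2] A = 0 ↔ flatMeasure (switchSpace π) (coneOver π A) = 0 := by
  obtain ⟨y, hy⟩ := h.recurrent
  have hd : 0 < d := by have := h.finrank_ker_levelMap; omega
  set p : π.configSpace := normalize π y (fun a => (hy.1 a).le)
    (by simpa using total_pos hd hy) hy.2
  rw [hausdorffMeasure_eq h p]
  set V := LinearMap.ker (levelMap π)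
  set S : Set V := {v : V | p.1 + v.1 ∈ Subtype.val '' A}
  set ν : Measure V := μH[(Module.finrank ℝ V : ℝ)]
  have hSm : MeasurableSet S :=
    (measurable_const.add measurable_subtype_coe : Measurable fun v : V => p.1 + v.1)
      (MeasurableSet.subtype_image (measurableSet_configSpace π) hA)
  set e : (ℝ × V) ≃ₗ[ℝ] switchSpace π := LinearEquiv.ofBijective _ (levelCoord_bijective p)
  have : IsAddHaarMeasure (((volume : Measure ℝ).prod ν).map e) :=
    e.toContinuousLinearEquiv.isAddHaarMeasure_map _
  obtain ⟨c, hc0, -, hc⟩ := exists_addHaar_eq_mul (addHaar : Measure (switchSpace π))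
    (((volume : Measure ℝ).prod ν).map e)
  have hem : Measurable e := (LinearMap.continuous_of_finiteDimensional e.toLinearMap).measurable
  have hCm := measurableSet_coneOver hA
  rw [flatMeasure_apply hCm, hc, map_apply hem (measurable_subtype_coe hCm), mul_eq_zero,
    or_iff_right hc0, measure_prod_null (hem (measurable_subtype_coe hCm))]
  have hslice : ∀ t : ℝ, 0 < t → ν (Prod.mk t ⁻¹' (e ⁻¹' (Subtype.val ⁻¹' coneOver π A))) =
      ENNReal.ofReal |((t⁻¹ ^ Module.finrank ℝ V)⁻¹)| * ν S := by
    intro t ht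
    rw [← addHaar_preimage_smul ν (inv_ne_zero ht.ne')]
    congr 1
    ext v
    exact (levelCoord_mem_coneOver p A t v).trans (and_iff_right ht)
  constructor
  · intro h0
    refine Filter.Eventually.of_forall fun t => ?_
    by_cases ht : 0 < t
    · change ν _ = 0
      rw [hslice t ht, h0, mul_zero]
    · refine measure_mono_null (t := (∅ : Set V)) (fun v hv => ?_) measure_empty
      exact ht ((levelCoord_mem_coneOver p A t v).1 hv).1
  · intro h0
    have hpos : (volume : Measure ℝ) (Set.Ioi 0) ≠ 0 := by simp
    obtain ⟨t, ht, hzero⟩ : ∃ t ∈ Set.Ioi (0 : ℝ),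
        ν (Prod.mk t ⁻¹' (e ⁻¹' (Subtype.val ⁻¹' coneOver π A))) = 0 := by
      by_contra! hcon
      exact hpos (measure_mono_null (fun t ht => hcon t ht) h0)
    rw [hslice t ht, mul_eq_zero] at hzero
    refine hzero.resolve_left ?_
    have ht' : (0 : ℝ) < t := ht
    rw [ENNReal.ofReal_eq_zero, not_le]
    positivity

theorem hausdorffMeasure_univ_lt_top (h : π.Admissible) :
    μH[(d : ℝ) - 2] (Set.univ : Set π.configSpace) < ⊤ := by
  by_cases hne : Nonempty π.configSpace
  · obtain ⟨p⟩ := hne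
    rw [hausdorffMeasure_eq h p]
    refine Bornology.IsBounded.measure_lt_top ?_
    refine (Metric.isBounded_closedBall (x := (0 : LinearMap.ker (levelMap π)))
      (r := Real.sqrt d + ‖p.1‖)).subset fun v hv => ?_
    obtain ⟨x, -, hx⟩ := hv
    rw [mem_closedBall_zero_iff]
    have hxn : ‖x.1‖ ≤ Real.sqrt d := by
      rw [EuclideanSpace.norm_eq]
      refine Real.sqrt_le_sqrt ?_
      calc ∑ i, ‖x.1 i‖ ^ 2 ≤ ∑ _i : Fin d, (1 : ℝ) := by
            refine Finset.sum_le_sum fun i _ => ?_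
            have h0 := x.2.1 i
            have h1 : x.1 i ≤ 1 := by
              rw [← x.2.2.1]
              exact Finset.single_le_sum (f := fun i => x.1 i) (fun j _ => x.2.1 j) (Finset.mem_univ i)
            rw [Real.norm_eq_abs, abs_of_nonneg h0]
            nlinarith
        _ = d := by simp
    have hv' : v.1 = x.1 - p.1 := by rw [hx]; simp
    calc ‖v‖ = ‖x.1 - p.1‖ := by rw [← hv']; rfl
      _ ≤ ‖x.1‖ + ‖p.1‖ := norm_sub_le _ _
      _ ≤ _ := by gcongr
  · have : (Set.univ : Set π.configSpace) = ∅ := by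
      ext x; exact (hne ⟨x⟩).elim
    rw [this, measure_empty]
    exact ENNReal.zero_lt_top

/-- Finite volume keeps the normalizing factor nonzero. Restricting to strictly positive widths
discards only parts of coordinate hyperplanes, which are null because the positive cone is nonempty.
-/
theorem lebesgue_eq_zero_iff (h : π.Admissible) {A : Set π.configSpace} (hA : MeasurableSet A) :
    π.lebesgue A = 0 ↔ flatMeasure (switchSpace π) (π.posCone ∩ coneOver π A) = 0 := by
  rw [lebesgue, Measure.smul_apply, smul_eq_mul, mul_eq_zero,
    or_iff_right (ENNReal.inv_ne_zero.2 (hausdorffMeasure_univ_lt_top h).ne),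
    hausdorffMeasure_eq_zero_iff h hA]
  refine ⟨measure_mono_null Set.inter_subset_right, fun h0 => ?_⟩
  obtain ⟨u, hu⟩ := h.recurrent
  have hbd : ∀ a, flatMeasure (switchSpace π)
      {z | (LinearMap.proj a : (Fin d → ℝ) →ₗ[ℝ] ℝ) z = 0} = 0 := fun a =>
    flatMeasure_ker ⟨u, posCone_subset_switchSpace hu, (hu.1 a).ne'⟩
  refine measure_mono_null (t := (π.posCone ∩ coneOver π A) ∪
    ⋃ a, {z | (LinearMap.proj a : (Fin d → ℝ) →ₗ[ℝ] ℝ) z = 0}) ?_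
    (measure_union_null h0 (measure_iUnion_null hbd))
  intro y hy
  by_cases hp : ∀ a, 0 < y a
  · obtain ⟨-, -, h2, -⟩ := id hy
    exact Or.inl ⟨⟨hp, h2⟩, hy⟩
  · push Not at hp
    obtain ⟨a, ha⟩ := hp
    obtain ⟨h0, -⟩ := id hy
    exact Or.inr (Set.mem_iUnion.2 ⟨a, le_antisymm ha (h0 a)⟩)

end

end RauzyInduction

end

/-! ### The Rauzy map lifted to cones of labelled widths. -/

noncomputable section

namespace RauzyInduction

open Rows

variable {d : ℕ}

/-! ### The Rauzy map in terms of labelled types -/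

theorem rauzyStep_eq {β : Bool} {π π' : Rows d} {a c : Fin d} (h : Split β π π' a c)
    (x : π.configSpace) (hlt : x.1 c < x.1 a) : ∃ h0 h1 h2,
      rauzyStep π x = some ⟨π', Rows.normalize π' (splitWidths x.1 a c) h0 h1 h2⟩ := by
  cases h with
  | top a t c b h =>
    exact ⟨_, _, _, by rw [rauzyStep, dif_pos hlt]⟩
  | bot _ t _ b h =>
    exact ⟨splitWidths_nonneg x.2.1 hlt, splitWidths_sum_pos x.2.1 hlt,
      (switch_topSplit (t := b) (b := t) hlt x.2.2.2.symm).symm,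
      by rw [rauzyStep, dif_neg (not_lt.2 hlt.le), dif_pos hlt]⟩

theorem exists_split_of_rauzyStep {π : Rows d} {x : π.configSpace}
    {q : Σ π' : Rows d, π'.configSpace} (h : rauzyStep π x = some q) :
    ∃ β a c, Split β π q.1 a c ∧ x.1 c < x.1 a := by
  obtain ⟨_ | ⟨a, t⟩, _ | ⟨c, b⟩⟩ := π
  · cases h
  · cases h
  · cases h
  · rw [rauzyStep] at h
    split_ifs at h with h1 h2
    · cases h
      exact ⟨true, a, c, Split.top a t c b (by rintro rfl; exact lt_irrefl _ h1), h1⟩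
    · cases h
      exact ⟨false, c, a, Split.bot a t c b (by rintro rfl; exact lt_irrefl _ h2), h2⟩

theorem Rows.Split.arrow {β : Bool} {π π' : Rows d} {a c : Fin d} (h : Split β π π' a c)
    (hne : π'.posCone.Nonempty) : Rows.Arrow π π' := by
  obtain ⟨y, hy⟩ := hne
  have hx := h.unsplit_mem_posCone hy
  have hpos : 0 < ∑ z, unsplit a c y z := by simpa using total_pos a.pos hx
  obtain ⟨h0, h1, h2, he⟩ := rauzyStep_eq h
    (Rows.normalize π (unsplit a c y) (fun z => (hx.1 z).le) hpos hx.2) (by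
      change unsplit a c y c / _ < unsplit a c y a / _
      refine div_lt_div_of_pos_right ?_ hpos
      rw [unsplit_apply, unsplit_apply, if_neg h.ne.symm, if_pos rfl]
      linarith [hy.1 a])
  exact ⟨_, _, he⟩

theorem Rows.Split.relabel {β : Bool} {π π' : Rows d} {a c : Fin d} (h : Split β π π' a c)
    (σ : Equiv.Perm (Fin d)) : Split β (relabel σ π) (relabel σ π') (σ a) (σ c) := by
  have key : ∀ (a : Fin d) (t : List (Fin d)) (c : Fin d) (b : List (Fin d)),
      Rows.relabel σ (topSplit a t c b) = topSplit (σ a) (t.map σ) (σ c) (b.map σ) := by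
    intro a t c b
    simp only [Rows.relabel, topSplit, List.map_cons, List.map_flatMap, List.flatMap_map]
    congr 2
    · congr 1; ext1 z
      by_cases hz : z = a <;> simp [hz]
    · ext1 z
      by_cases hz : z = a <;> simp [hz]
  cases h with
  | top a t c b h =>
    rw [key]
    exact Split.top _ _ _ _ (σ.injective.ne h)
  | bot _ t _ b h =>
    have key' : ∀ a c, Rows.relabel σ (botSplit a t c b) =
        botSplit (σ a) (t.map σ) (σ c) (b.map σ) := fun a c => congrArg Rows.swap (key c b a t)
    rw [key']
    exact Split.bot _ _ _ _ (σ.injective.ne h)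

/-- Every label occurs, so a relabelling is determined by its effect; hence the permutation chosen
in `toParam` is the only one. -/
theorem relabel_injective {π : Rows d} (he : π.IsExchange) {σ τ : Equiv.Perm (Fin d)}
    (h : relabel σ π = relabel τ π) : σ = τ := by
  ext1 a
  have h1 := congrArg Rows.top h
  have h2 := congrArg Rows.bot h
  have hc := he a
  have hmem : a ∈ π.top ++ π.bot := List.count_pos_iff.1 (by omega)
  rcases List.mem_append.1 hmem with hm | hm
  · exact List.map_inj_left.1 h1 a hm
  · exact List.map_inj_left.1 h2 a hm

theorem relabel_relabel (σ τ : Equiv.Perm (Fin d)) (π : Rows d) :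
    relabel τ (relabel σ π) = relabel (τ * σ) π := by
  simp [relabel]

theorem mk_relabel (σ : Equiv.Perm (Fin d)) (π : Rows d) : (⟦relabel σ π⟧ : UType d) = ⟦π⟧ :=
  (Quotient.sound ⟨σ, rfl⟩ : (⟦π⟧ : UType d) = ⟦relabel σ π⟧).symm

/-- The labelled types over a set of unlabelled types. -/
def labelledTypes (G : Set (UType d)) : Set (Rows d) := {π | (⟦π⟧ : UType d) ∈ G}

section Sink

variable {G : Set (UType d)} (hG : IsSink G)

include hG

theorem IsSink.pos : 0 < d := by
  obtain ⟨r, hr⟩ := hG.nonempty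
  obtain ⟨r', ⟨π, π', -, -, x, y, hxy⟩, -⟩ := Relation.TransGen.head'_iff.1 (hG.connected r hr r hr)
  obtain ⟨β, a, c, -⟩ := exists_split_of_rauzyStep hxy
  exact a.pos

theorem IsSink.admissible {π : Rows d} (hπ : π ∈ labelledTypes G) : π.Admissible := by
  obtain ⟨σ, hσ⟩ := exists_relabel π
  have h := ((hG.nonclassical _ hπ).admissible hG.pos).relabel σ⁻¹
  rwa [← hσ, relabel_relabel, inv_mul_cancel, show relabel 1 π = π by simp [relabel]] at h

theorem IsSink.isSplitClosed : IsSplitClosed (labelledTypes G) := by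
  refine ⟨?_, fun π hπ => hG.admissible hπ, fun π hπ β π' a c h hne => ?_, fun π hπ => ?_⟩
  · have hfin : ({l : List (Fin d) | l.length ≤ 2 * d} ×ˢ
        {l : List (Fin d) | l.length ≤ 2 * d}).Finite :=
      (List.finite_length_le _ _).prod (List.finite_length_le _ _)
    refine (hfin.preimage (f := fun π : Rows d => (π.top, π.bot)) ?_).subset fun π hπ => ?_
    · rintro ⟨t, b⟩ - ⟨t', b'⟩ - h
      cases h; rfl
    · have he := (hG.admissible hπ).exchange
      have hlen : (π.top ++ π.bot).length = 2 * d := by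
        rw [← Multiset.coe_card, ← Multiset.sum_count_eq_card (s := Finset.univ) (by simp)]
        simp only [Multiset.coe_count, he _]
        simp [mul_comm]
      rw [List.length_append] at hlen
      constructor
      · change π.top.length ≤ 2 * d; omega
      · change π.bot.length ≤ 2 * d; omega
  · exact hG.closed _ hπ _ ⟨π, π', rfl, rfl, h.arrow hne⟩
  · obtain ⟨r', ⟨π₁, π', h1, -, x, y, hxy⟩, -⟩ :=
      Relation.TransGen.head'_iff.1 (hG.connected _ hπ _ hπ)
    obtain ⟨σ, rfl⟩ : ∃ σ, relabel σ π₁ = π := Quotient.exact h1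
    obtain ⟨β, a, c, hs, hlt⟩ := exists_split_of_rauzyStep hxy
    have hπ₁ : π₁ ∈ labelledTypes G := by
      have : (⟦relabel σ π₁⟧ : UType d) ∈ G := hπ
      rwa [← h1] at this
    -- The arrow provides widths with different critical values, but possibly some zero widths.
    -- Adding them to positive widths with equal critical values repairs both defects.
    obtain ⟨u, hu, hne⟩ : ∃ u ∈ π₁.posCone, u a ≠ u c := by
      obtain ⟨u, hu⟩ := (hG.admissible hπ₁).recurrent
      by_cases hne : u a = u c
      · refine ⟨u + x.1.ofLp, ⟨fun z => add_pos_of_pos_of_nonneg (hu.1 z) (x.2.1 z), ?_⟩, ?_⟩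
        · exact mem_switchSpace.1 ((switchSpace π₁).add_mem (mem_switchSpace.2 hu.2)
            (mem_switchSpace.2 x.2.2.2))
        · rw [Pi.add_apply, Pi.add_apply, hne]
          exact fun h => hlt.ne' (add_left_cancel h)
      · exact ⟨u, hu, hne⟩
    have hu' : u ∘ σ.symm ∈ (relabel σ π₁).posCone :=
      (posCone_relabel σ π₁ _).2 (by simpa [Function.comp_assoc] using hu)
    have hs' := hs.relabel σ
    generalize relabel σ π' = ρ at hs'
    generalize hκ : relabel σ π₁ = κ at hs' hu'
    have h3 : (u ∘ σ.symm) (σ a) ≠ (u ∘ σ.symm) (σ c) := by simpa using hne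
    generalize σ a = a' at hs' h3
    generalize σ c = c' at hs' h3
    cases hs' with
    | top _ t _ b h => exact ⟨_, _, _, _, rfl, _, hu', h3⟩
    | bot _ t _ b h => exact ⟨_, _, _, _, rfl, _, hu', h3.symm⟩

end Sink

theorem paramSpace_ext {G : Set (UType d)} {p q : ParamSpace G} (h1 : (p.1 : UType d) = q.1)
    (h2 : ∀ a, p.2.1 a = q.2.1 a) : p = q := by
  obtain ⟨r, x⟩ := p
  obtain ⟨r', x'⟩ := q
  obtain rfl : r = r' := Subtype.ext h1
  congr 1
  exact Subtype.ext (by ext a; exact h2 a)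

/-- The points of a labelled configuration space that represent points of a set of parameters. -/
def fibre {G : Set (UType d)} (A : Set (ParamSpace G)) (π : Rows d) : Set π.configSpace :=
  {x | ∃ h : (⟦π⟧ : UType d) ∈ G, toParam ⟨π, x⟩ h ∈ A}

/-- The widths that represent, after rescaling, points of a set of parameters. -/
def lift {G : Set (UType d)} (A : Set (ParamSpace G)) (π : Rows d) : Set (Fin d → ℝ) :=
  coneOver π (fibre A π)

theorem measurable_sigmaMk {G : Set (UType d)} (r : G) :
    Measurable fun x : (r : UType d).rep.configSpace => (⟨r, x⟩ : ParamSpace G) :=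
  Measurable.of_le_map (iInf_le _ r)

theorem measurableSet_paramSpace {G : Set (UType d)} {A : Set (ParamSpace G)} :
    MeasurableSet A ↔ ∀ r : G, MeasurableSet (Sigma.mk r ⁻¹' A) :=
  MeasurableSpace.measurableSet_iInf

theorem measurableSet_fibre {G : Set (UType d)} {A : Set (ParamSpace G)} (hA : MeasurableSet A)
    (π : Rows d) : MeasurableSet (fibre A π) := by
  by_cases h : (⟦π⟧ : UType d) ∈ G
  · have hm : Measurable fun x : π.configSpace => (toParam ⟨π, x⟩ h : ParamSpace G) := by
      refine (measurable_sigmaMk (⟨⟦π⟧, h⟩ : G)).comp (Measurable.subtype_mk ?_)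
      refine (WithLp.measurable_toLp 2 _).comp (measurable_pi_lambda _ fun a => ?_)
      exact (measurable_pi_apply ((exists_relabel π).choose.symm a)).comp (measurable_ofLp.comp measurable_subtype_coe)
    convert hm hA using 1
    ext x
    exact ⟨fun hx => hx.2, fun hx => ⟨h, hx⟩⟩
  · convert MeasurableSet.empty
    refine Set.eq_empty_of_forall_notMem ?_
    rintro x ⟨h', -⟩
    exact h h'

theorem measurableSet_lift {G : Set (UType d)} {A : Set (ParamSpace G)} (hA : MeasurableSet A)
    (π : Rows d) : MeasurableSet (lift A π) := measurableSet_coneOver (measurableSet_fibre hA π)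

section Sink

variable {G : Set (UType d)} (hG : IsSink G)

include hG

theorem IsSink.toParam_rep (r : G) (x : (r : UType d).rep.configSpace)
    (h : (⟦(r : UType d).rep⟧ : UType d) ∈ G) : (toParam ⟨(r : UType d).rep, x⟩ h : ParamSpace G) = ⟨r, x⟩ := by
  have hr : (⟦(r : UType d).rep⟧ : UType d) = r := Quotient.out_eq _
  refine paramSpace_ext hr fun a => ?_
  have hσ := (exists_relabel (r : UType d).rep).choose_spec
  change x.1 ((exists_relabel (r : UType d).rep).choose.symm a) = x.1 a
  set σ := (exists_relabel (r : UType d).rep).choose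
  have h1 : relabel σ (r : UType d).rep = relabel 1 (r : UType d).rep := by
    rw [hσ, hr]; simp [relabel]
  rw [relabel_injective (hG.nonclassical r r.2).1 h1]
  rfl

theorem IsSink.fibre_rep (A : Set (ParamSpace G)) (r : G) :
    fibre A (r : UType d).rep = Sigma.mk r ⁻¹' A := by
  ext x
  have hr : (⟦(r : UType d).rep⟧ : UType d) = r := Quotient.out_eq _
  constructor
  · rintro ⟨h, hx⟩
    rwa [hG.toParam_rep] at hx
  · intro hx
    have h : (⟦(r : UType d).rep⟧ : UType d) ∈ G := hr.symm ▸ r.2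
    exact ⟨h, by rwa [hG.toParam_rep]⟩

/-- Both labellings reach the same chosen representative, and by uniqueness of relabellings they
give the same point there. -/
theorem IsSink.mem_lift_relabel (A : Set (ParamSpace G)) (σ : Equiv.Perm (Fin d)) (π : Rows d)
    (y : Fin d → ℝ) : y ∈ lift A (relabel σ π) ↔ y ∘ σ ∈ lift A π := by
  have hsum : ∑ a, (y ∘ σ) a = ∑ a, y a := Equiv.sum_comp σ y
  have key : ∀ h0 h1 h2 (h : (⟦relabel σ π⟧ : UType d) ∈ G) h0' h1' h2' (h' : (⟦π⟧ : UType d) ∈ G),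
      (toParam ⟨relabel σ π, Rows.normalize _ y h0 h1 h2⟩ h : ParamSpace G) =
        toParam ⟨π, Rows.normalize _ (y ∘ σ) h0' h1' h2'⟩ h' := by
    intro h0 h1 h2 h h0' h1' h2' h'
    refine paramSpace_ext (mk_relabel σ π) fun a => ?_
    have e1 := (exists_relabel (relabel σ π)).choose_spec
    have e2 := (exists_relabel π).choose_spec
    change y ((exists_relabel (relabel σ π)).choose.symm a) / ∑ b, y b =
      (y ∘ σ) ((exists_relabel π).choose.symm a) / ∑ b, (y ∘ σ) b
    set τ' := (exists_relabel (relabel σ π)).choose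
    set τ := (exists_relabel π).choose
    have e3 : τ' * σ = τ := by
      refine relabel_injective (hG.admissible h').exchange ?_
      rw [← relabel_relabel, e1, e2, mk_relabel]
    rw [hsum, Function.comp_apply, ← e3]
    congr 2
    simp [Equiv.Perm.mul_def]
  constructor
  · rintro ⟨h0, h1, h2, h, hA⟩
    have h' : (⟦π⟧ : UType d) ∈ G := mk_relabel σ π ▸ h
    have h1' : 0 < ∑ a, (y ∘ σ) a := by rw [hsum]; exact h1
    exact ⟨fun a => h0 _, h1', (switch_relabel σ π y).1 h2, h', by rwa [← key h0 h1 h2 h]⟩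
  · rintro ⟨h0, h1, h2, h', hA⟩
    have h : (⟦relabel σ π⟧ : UType d) ∈ G := by rwa [mk_relabel σ π]
    have h1' : 0 < ∑ a, y a := by rw [← hsum]; exact h1
    have h0' : ∀ a, 0 ≤ y a := fun a => by simpa using h0 (σ.symm a)
    exact ⟨h0', h1', (switch_relabel σ π y).2 h2, h, by rwa [key h0' h1' _ h h0 h1 h2 h']⟩

theorem IsSink.rauzyMap_mem_iff {A : Set (ParamSpace G)} {r : G} {x : (r : UType d).rep.configSpace}
    {β : Bool} {π' : Rows d} {a c : Fin d} (h : Split β (r : UType d).rep π' a c)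
    (hlt : x.1 c < x.1 a) :
    rauzyMap hG ⟨r, x⟩ ∈ A ↔ splitWidths x.1 a c ∈ lift A π' := by
  obtain ⟨h0, h1, h2, he⟩ := rauzyStep_eq h x hlt
  have hdom : (⟨r, x⟩ : ParamSpace G) ∈ rauzyDomain G := by
    change (rauzyStep _ x).isSome; rw [he]; rfl
  have key : ∃ hq, rauzyMap hG ⟨r, x⟩ =
      toParam ⟨π', Rows.normalize π' (splitWidths x.1 a c) h0 h1 h2⟩ hq := by
    have hget : (rauzyStep _ x).get hdom = ⟨π', Rows.normalize π' (splitWidths x.1 a c) h0 h1 h2⟩ := by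
      simp only [he, Option.get_some]
    rw [rauzyMap, dif_pos hdom]
    have hm := hG.step_mem ⟨r, x⟩ hdom
    revert hm
    change ∀ hm : (⟦((rauzyStep _ x).get hdom).1⟧ : UType d) ∈ G,
      ∃ hq, toParam ((rauzyStep _ x).get hdom) hm = _
    rw [hget]
    exact fun hm => ⟨hm, rfl⟩
  obtain ⟨hq, hT⟩ := key
  rw [hT]
  exact ⟨fun hA => ⟨h0, h1, h2, hq, hA⟩, fun ⟨_, _, _, _, hA⟩ => hA⟩

/-- On cones the rescaling in the Rauzy map disappears, so each branch of its inverse becomes the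
linear map `unsplit`. The case of a chosen representative implies the general one by relabelling. -/
theorem IsSink.unsplit_mem_lift_iff (A : Set (ParamSpace G)) {β : Bool} {π π' : Rows d} {a c : Fin d}
    (hπ : π ∈ labelledTypes G) (h : Split β π π' a c) {y : Fin d → ℝ} (hy : y ∈ π'.posCone) :
    unsplit a c y ∈ lift (rauzyMap hG ⁻¹' A) π ↔ y ∈ lift A π' := by
  have hrep : ∀ (r : G) {π' : Rows d} {a c : Fin d} {y : Fin d → ℝ},
      Split β (r : UType d).rep π' a c → y ∈ π'.posCone →
      (unsplit a c y ∈ lift (rauzyMap hG ⁻¹' A) (r : UType d).rep ↔ y ∈ lift A π') := by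
    intro r π' a c y h hy
    have hx := h.unsplit_mem_posCone hy
    have hpos : 0 < ∑ z, unsplit a c y z := by simpa using total_pos a.pos hx
    set x := Rows.normalize _ (unsplit a c y) (fun z => (hx.1 z).le) hpos hx.2
    have hlt : x.1 c < x.1 a := by
      change unsplit a c y c / _ < unsplit a c y a / _
      refine div_lt_div_of_pos_right ?_ hpos
      rw [unsplit_apply, unsplit_apply, if_neg h.ne.symm, if_pos rfl]
      linarith [hy.1 a]
    have hval : splitWidths x.1 a c = (∑ z, unsplit a c y z)⁻¹ • y := by
      have e1 : x.1.ofLp = (∑ z, unsplit a c y z)⁻¹ • unsplit a c y := by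
        ext z
        change unsplit a c y z / _ = _
        rw [div_eq_inv_mul]; rfl
      rw [e1, ← splitEquiv_symm_apply h.ne, map_smul, splitEquiv_symm_apply h.ne,
        splitWidths_unsplit h.ne]
    rw [lift, hG.fibre_rep]
    have h1 := hG.rauzyMap_mem_iff (A := A) h hlt
    rw [hval, lift, isConic_coneOver _ _ _ (inv_pos.2 hpos)] at h1
    exact ⟨fun ⟨_, _, _, h2⟩ => h1.1 h2, fun h2 => ⟨_, hpos, _, h1.2 h2⟩⟩
  obtain ⟨σ, hσ⟩ := exists_relabel π
  have hs := h.relabel σ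
  rw [hσ] at hs
  have h1 := hrep ⟨_, hπ⟩ hs (y := y ∘ σ.symm)
    ((posCone_relabel σ π' _).2 (by simpa [Function.comp_assoc] using hy))
  have h2 : unsplit (σ a) (σ c) (y ∘ σ.symm) = unsplit a c y ∘ σ.symm := by
    ext z
    simp only [unsplit_apply, Function.comp_apply, Equiv.symm_apply_apply, Equiv.symm_apply_eq]
  rw [h2, ← hσ, hG.mem_lift_relabel, hG.mem_lift_relabel] at h1
  simpa [Function.comp_assoc] using h1

end Sink

end RauzyInduction

end

/-! ### Null sets, quasi-invariance and ergodicity. -/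

noncomputable section

namespace RauzyInduction

open Rows

variable {d : ℕ}

/-! ### Null sets of parameters -/

theorem Rows.Split.map_switchSpace {β : Bool} {π π' : Rows d} {a c : Fin d}
    (h : Split β π π' a c) : (switchSpace π').map
      (splitEquiv a c : (Fin d → ℝ) →ₗ[ℝ] (Fin d → ℝ)) = switchSpace π := by
  ext x
  rw [Submodule.mem_map_equiv, mem_switchSpace, mem_switchSpace, h.switch_iff,
    splitEquiv_symm_apply h.ne, unsplit_splitWidths h.ne]

/-- The widths of type `π` that represent points of `A` form a null set. -/
def IsNull {G : Set (UType d)} (A : Set (ParamSpace G)) (π : Rows d) : Prop :=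
  flatMeasure (switchSpace π) (π.posCone ∩ lift A π) = 0

theorem rep_mem_labelledTypes {G : Set (UType d)} (r : G) : (r : UType d).rep ∈ labelledTypes G := by
  change (⟦(r : UType d).rep⟧ : UType d) ∈ G
  rw [UType.rep, Quotient.out_eq]; exact r.2

section Sink

variable {G : Set (UType d)} (hG : IsSink G) {A : Set (ParamSpace G)} (hA : MeasurableSet A)

include hG hA

theorem IsSink.isNull_relabel_iff (σ : Equiv.Perm (Fin d)) (π : Rows d) :
    IsNull A (relabel σ π) ↔ IsNull A π := by
  have hmap : (switchSpace (relabel σ π)).map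
      (LinearEquiv.funCongrLeft ℝ ℝ σ : (Fin d → ℝ) →ₗ[ℝ] (Fin d → ℝ)) = switchSpace π := by
    ext x
    rw [Submodule.mem_map_equiv, mem_switchSpace, mem_switchSpace, switch_relabel]
    exact Iff.of_eq (congrArg _ ((LinearEquiv.funCongrLeft ℝ ℝ σ).apply_symm_apply x))
  obtain ⟨c, hc0, -, hc⟩ := flatMeasure_map _ hmap
  rw [IsNull, IsNull, hc _ ((measurableSet_posCone π).inter (measurableSet_lift hA π)), mul_eq_zero,
    or_iff_right hc0]
  refine Iff.of_eq (congrArg (· = 0) (congrArg _ ?_))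
  ext y
  exact and_congr (posCone_relabel σ π y) (hG.mem_lift_relabel A σ π y)

theorem IsSink.isNull_of_mk_eq {π π' : Rows d} (h : (⟦π⟧ : UType d) = ⟦π'⟧) (hn : IsNull A π) :
    IsNull A π' := by
  obtain ⟨σ, rfl⟩ := Quotient.exact h
  exact (hG.isNull_relabel_iff hA σ π).2 hn

theorem IsSink.paramLebesgue_eq_zero_iff :
    paramLebesgue G A = 0 ↔ ∀ π ∈ labelledTypes G, IsNull A π := by
  have h1 : paramLebesgue G A = 0 ↔ ∀ r : G, IsNull A (r : UType d).rep := by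
    rw [paramLebesgue, Measure.sum_apply _ hA, ENNReal.tsum_eq_zero]
    refine forall_congr' fun r => ?_
    rw [map_apply (measurable_sigmaMk r) hA,
      lebesgue_eq_zero_iff (hG.admissible (rep_mem_labelledTypes r))
      (measurable_sigmaMk r hA), IsNull, lift, hG.fibre_rep]
  rw [h1]
  constructor
  · exact fun h π hπ => hG.isNull_of_mk_eq hA (Quotient.out_eq _) (h ⟨_, hπ⟩)
  · exact fun h r => h _ (rep_mem_labelledTypes r)

omit hA in
/-- The critical bands of a type in the sink. -/
theorem IsSink.exists_critical {π : Rows d} (hπ : π ∈ labelledTypes G) : ∃ a c π₁ π₂,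
    Split true π π₁ a c ∧ Split false π π₂ c a ∧
      flatMeasure (switchSpace π) {y | diffForm a c y = 0} = 0 ∧
      ∀ x : π.configSpace, (rauzyStep π x).isSome ↔ x.1 a ≠ x.1 c := by
  obtain ⟨a, t, c, b, rfl, u, hu, hne⟩ := hG.isSplitClosed.exists_ne π hπ
  have hac : a ≠ c := by rintro rfl; exact hne rfl
  refine ⟨a, c, _, _, Split.top a t c b hac, Split.bot a t c b hac,
    flatMeasure_ker ⟨u, posCone_subset_switchSpace hu, sub_ne_zero.2 hne⟩, fun x => ?_⟩
  rw [rauzyStep]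
  split_ifs with h1 h2
  · simpa using h1.ne'
  · simpa using h2.ne
  · simpa using le_antisymm (not_lt.1 h1) (not_lt.1 h2)

omit hA in
theorem IsSink.measurableSet_preimage_mk {r : G} {a c : Fin d} {π' : Rows d} {β : Bool}
    (h : Split β (r : UType d).rep π' a c) (hA : MeasurableSet A) :
    MeasurableSet {x : (r : UType d).rep.configSpace |
      x.1 c < x.1 a ∧ rauzyMap hG ⟨r, x⟩ ∈ A} := by
  have hv : Measurable fun x : (r : UType d).rep.configSpace => x.1.ofLp :=
    measurable_ofLp.comp measurable_subtype_coe
  have : {x : (r : UType d).rep.configSpace | x.1 c < x.1 a ∧ rauzyMap hG ⟨r, x⟩ ∈ A} =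
      {x | x.1 c < x.1 a} ∩ (fun x => (splitEquiv a c).symm x.1.ofLp) ⁻¹' lift A π' := by
    ext x
    refine and_congr_right fun hlt => ?_
    rw [hG.rauzyMap_mem_iff h hlt, Set.mem_preimage, splitEquiv_symm_apply h.ne]
  rw [this]
  refine (measurableSet_lt ((measurable_pi_apply c).comp hv) ((measurable_pi_apply a).comp hv)).inter ?_
  exact ((measurable_linearEquiv _).comp hv) (measurableSet_lift hA π')

omit hA in
theorem IsSink.measurable_rauzyMap : Measurable (rauzyMap hG) := by
  intro A hA
  rw [measurableSet_paramSpace]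
  intro r
  obtain ⟨a, c, π₁, π₂, h1, h2, -, h3⟩ := hG.exists_critical (rep_mem_labelledTypes r)
  have hv : Measurable fun x : (r : UType d).rep.configSpace => x.1.ofLp :=
    measurable_ofLp.comp measurable_subtype_coe
  have : Sigma.mk r ⁻¹' (rauzyMap hG ⁻¹' A) =
      {x : (r : UType d).rep.configSpace | x.1 c < x.1 a ∧ rauzyMap hG ⟨r, x⟩ ∈ A} ∪
      ({x : (r : UType d).rep.configSpace | x.1 a < x.1 c ∧ rauzyMap hG ⟨r, x⟩ ∈ A} ∪
      ({x : (r : UType d).rep.configSpace | x.1 a = x.1 c} ∩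
        (fun x => (⟨r, x⟩ : ParamSpace G)) ⁻¹' A)) := by
    ext x
    have hfix : x.1 a = x.1 c → rauzyMap hG ⟨r, x⟩ = ⟨r, x⟩ := by
      intro he
      rw [rauzyMap, dif_neg]
      exact fun hd => (h3 x).1 hd he
    rcases lt_trichotomy (x.1 c) (x.1 a) with hlt | he | hlt
    · simp [hlt, hlt.le, hlt.ne']
    · simp [he, hfix he.symm]
    · simp [hlt, hlt.le, hlt.ne]
  rw [this]
  refine (hG.measurableSet_preimage_mk h1 hA).union ((hG.measurableSet_preimage_mk h2 hA).union ?_)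
  exact (measurableSet_eq_fun ((measurable_pi_apply a).comp hv)
    ((measurable_pi_apply c).comp hv)).inter (measurable_sigmaMk r hA)

/-- `unsplit` embeds the cone of `π'` in that of `π` and multiplies Haar measure by a nonzero
factor. For an invariant set, nullity thus passes forward along arrows. -/
theorem IsSink.isNull_of_split {β : Bool} {π π' : Rows d} {a c : Fin d}
    (hπ : π ∈ labelledTypes G) (h : Split β π π' a c) (hn : IsNull (rauzyMap hG ⁻¹' A) π) :
    IsNull A π' := by
  obtain ⟨k, hk0, -, hk⟩ := flatMeasure_map _ h.map_switchSpace
  rw [IsNull, hk _ ((measurableSet_posCone π).inter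
    (measurableSet_lift (hG.measurable_rauzyMap hA) π)), mul_eq_zero, or_iff_right hk0] at hn
  refine measure_mono_null ?_ hn
  rintro y ⟨hy, hyA⟩
  rw [Set.mem_preimage, splitEquiv_apply h.ne]
  exact ⟨h.unsplit_mem_posCone hy, (hG.unsplit_mem_lift_iff A hπ h hy).2 hyA⟩

/-- Where `a` is wider than `c`, the preimage is the linear image of a null set at `π'`. An empty
target cone contributes nothing. -/
theorem IsSink.measure_preimage_of_split {β : Bool} {π π' : Rows d} {a c : Fin d}
    (hπ : π ∈ labelledTypes G) (h : Split β π π' a c) (hn : ∀ π ∈ labelledTypes G, IsNull A π) :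
    flatMeasure (switchSpace π)
      ({y | y c < y a} ∩ (π.posCone ∩ lift (rauzyMap hG ⁻¹' A) π)) = 0 := by
  obtain ⟨k, -, -, hk⟩ := flatMeasure_map _ h.map_switchSpace
  have hm : MeasurableSet {y : Fin d → ℝ | y c < y a} :=
    measurableSet_lt (measurable_pi_apply c) (measurable_pi_apply a)
  rw [hk _ (hm.inter ((measurableSet_posCone π).inter
    (measurableSet_lift (hG.measurable_rauzyMap hA) π))), mul_eq_zero]
  right
  have hsub : splitEquiv a c ⁻¹' ({y | y c < y a} ∩ (π.posCone ∩ lift (rauzyMap hG ⁻¹' A) π)) ⊆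
      π'.posCone ∩ lift A π' := by
    rintro y ⟨h1, h2, h3⟩
    rw [splitEquiv_apply h.ne] at h1 h2 h3
    have hy := h.splitWidths_mem_posCone h2 h1
    rw [splitWidths_unsplit h.ne] at hy
    exact ⟨hy, (hG.unsplit_mem_lift_iff A hπ h hy).1 h3⟩
  rcases (π'.posCone).eq_empty_or_nonempty with he | hne
  · rw [he, Set.empty_inter] at hsub
    exact measure_mono_null hsub measure_empty
  · exact measure_mono_null hsub (hn π' (hG.isSplitClosed.closed π hπ _ _ _ _ h hne))

omit hA in
theorem IsSink.quasiMeasurePreserving :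
    QuasiMeasurePreserving (rauzyMap hG) (paramLebesgue G) (paramLebesgue G) := by
  refine ⟨hG.measurable_rauzyMap, AbsolutelyContinuous.mk fun A hA h0 => ?_⟩
  rw [map_apply hG.measurable_rauzyMap hA, hG.paramLebesgue_eq_zero_iff (hG.measurable_rauzyMap hA)]
  rw [hG.paramLebesgue_eq_zero_iff hA] at h0
  intro π hπ
  obtain ⟨a, c, π₁, π₂, h1, h2, h3, -⟩ := hG.exists_critical hπ
  refine measure_mono_null ?_ (measure_union_null h3 (measure_union_null
    (hG.measure_preimage_of_split hA hπ h1 h0) (hG.measure_preimage_of_split hA hπ h2 h0)))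
  intro y hy
  rcases lt_trichotomy (y c) (y a) with hlt | he | hlt
  · exact Or.inr (Or.inl ⟨hlt, hy⟩)
  · exact Or.inl (sub_eq_zero.2 he.symm)
  · exact Or.inr (Or.inr ⟨hlt, hy⟩)

omit hA in
theorem IsSink.ae_mem_rauzyDomain : ∀ᵐ p ∂(paramLebesgue G), p ∈ rauzyDomain G := by
  have hm : MeasurableSet (rauzyDomain G)ᶜ := by
    rw [measurableSet_paramSpace]
    intro r
    obtain ⟨a, c, π₁, π₂, -, -, -, h⟩ := hG.exists_critical (rep_mem_labelledTypes r)
    have hv : Measurable fun x : (r : UType d).rep.configSpace => x.1.ofLp :=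
      measurable_ofLp.comp measurable_subtype_coe
    convert measurableSet_eq_fun ((measurable_pi_apply a).comp hv)
      ((measurable_pi_apply c).comp hv) using 1
    ext x
    exact (not_congr (h x)).trans not_not
  have hnull : paramLebesgue G (rauzyDomain G)ᶜ = 0 := by
    rw [hG.paramLebesgue_eq_zero_iff hm]
    suffices hr : ∀ r : G, IsNull (rauzyDomain G)ᶜ (r : UType d).rep from
      fun π hπ => hG.isNull_of_mk_eq hm (Quotient.out_eq _) (hr ⟨_, hπ⟩)
    intro r
    obtain ⟨a, c, π₁, π₂, -, -, h0, h⟩ := hG.exists_critical (rep_mem_labelledTypes r)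
    rw [IsNull, lift, hG.fibre_rep]
    refine measure_mono_null ?_ h0
    rintro y ⟨hy, h1, h2, h3, h4⟩
    by_contra hcon
    refine h4 ((h _).2 fun he => hcon (sub_eq_zero.2 ?_))
    change y a / _ = y c / _ at he
    exact (div_left_inj' h2.ne').1 he
  exact hnull

theorem IsSink.isInvariantFamily (hinv : rauzyMap hG ⁻¹' A = A) :
    IsInvariantFamily (labelledTypes G) (lift A) := by
  refine ⟨fun π _ => measurableSet_lift hA π, fun π _ => isConic_coneOver _ _, ?_⟩
  intro π hπ β π' a c h y hy
  have := hG.unsplit_mem_lift_iff A hπ h hy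
  rwa [hinv] at this

/-- Nullity propagates along arrows, and any two types of the sink are joined by a directed path. -/
theorem IsSink.isNull_all (hinv : rauzyMap hG ⁻¹' A = A) {π : Rows d} (hπ : π ∈ labelledTypes G)
    (hn : IsNull A π) {π' : Rows d} (hπ' : π' ∈ labelledTypes G) : IsNull A π' := by
  have step : ∀ r r' : UType d, UType.Arrow r r' → (∀ π, ⟦π⟧ = r → r ∈ G → IsNull A π) →
      ∀ π, ⟦π⟧ = r' → r ∈ G → IsNull A π := by
    rintro r r' ⟨π, π', rfl, rfl, x, y, hxy⟩ h ρ hρ hr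
    obtain ⟨β, a, c, hs, -⟩ := exists_split_of_rauzyStep hxy
    refine hG.isNull_of_mk_eq hA hρ.symm (hG.isNull_of_split hA hr hs ?_)
    rw [hinv]
    exact h π rfl hr
  have hall : ∀ r', Relation.TransGen UType.Arrow (⟦π⟧ : UType d) r' →
      r' ∈ G ∧ ∀ ρ, ⟦ρ⟧ = r' → IsNull A ρ := by
    intro r' hr'
    induction hr' with
    | single h =>
      exact ⟨hG.closed _ hπ _ h, fun ρ hρ => step _ _ h
        (fun κ hκ _ => hG.isNull_of_mk_eq hA hκ.symm hn) ρ hρ hπ⟩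
    | tail _ h ih =>
      exact ⟨hG.closed _ ih.1 _ h, fun ρ hρ => step _ _ h (fun κ hκ _ => ih.2 κ hκ) ρ hρ ih.1⟩
  exact (hall _ (hG.connected _ hπ _ hπ')).2 π' rfl

omit hA in
-- An invariant set is null at some type, hence at all, or null at none, and then the density
-- theorem makes its complement null.
theorem IsSink.preErgodic : PreErgodic (rauzyMap hG) (paramLebesgue G) := by
  refine ⟨fun A hA hinv => ?_⟩
  rw [Filter.eventuallyConst_set', ae_eq_empty, ae_eq_univ]
  by_cases h : ∃ π ∈ labelledTypes G, IsNull A π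
  · obtain ⟨π, hπ, hn⟩ := h
    left
    rw [hG.paramLebesgue_eq_zero_iff hA]
    exact fun π' hπ' => hG.isNull_all hA hinv hπ hn hπ'
  · right
    push Not at h
    rw [hG.paramLebesgue_eq_zero_iff hA.compl]
    intro π hπ
    refine measure_mono_null ?_ ((hG.isInvariantFamily hA hinv).measure_diff_eq_zero hG.pos
      hG.isSplitClosed h hπ)
    rintro y ⟨hy, h1, h2, h3, h4, h5⟩
    exact ⟨hy, fun ⟨_, _, _, _, h6⟩ => h5 h6⟩

end Sink

end RauzyInduction

end

theorem mainTheorem5 (d : ℕ) (G : Set (RauzyInduction.UType d))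
    (hG : RauzyInduction.IsSink G) :
    (∀ᵐ p ∂(RauzyInduction.paramLebesgue G), p ∈ RauzyInduction.rauzyDomain G) ∧
      QuasiErgodic (RauzyInduction.rauzyMap hG) (RauzyInduction.paramLebesgue G) :=
  ⟨hG.ae_mem_rauzyDomain, { hG.quasiMeasurePreserving, hG.preErgodic with }⟩
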